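/- Let $p$ be an odd prime, $\mathcal K$ a field of characteristic $p$, $n\ge 1$, $1\le k\le n$ and $q\in\mathcal K$. Let $\mathcal O=\mathcal O(2n{+}1;\underline 1)$ be the restricted divided power algebra over $\mathcal K$ with basis $x^{(\alpha)}$, $\alpha=(\alpha_{-n},\dots,\alpha_n)$, $0\le\alpha\le\tau:=(p-1,\dots,p-1)$, and product $x^{(\alpha)}x^{(\beta)}=\binom{\alpha+\beta}{\alpha}x^{(\alpha+\beta)}$ (where $x^{(\gamma)}=0$ if some component of $\gamma$ is negative or $\ge p$). Let $\epsilon_j$ be the unit multi-indices, $x_j=x^{(\epsilon_j)}$, and $D_j$ the derivation with $D_j x^{(\alpha)}=x^{(\alpha-\epsilon_j)}$. Put $$\mathcal D_K(x^{(\alpha)})=\Big(2-\sum_{i=1}^n(\alpha_i+\alpha_{-i})\Big)x^{(\alpha)}D_0+\sum_{i=1}^n x^{(\alpha-\epsilon_0)}(x_iD_i+x_{-i}D_{-i})+\sum_{i=1}^n\big(x^{(\alpha-\epsilon_{-i})}D_i-x^{(\alpha-\epsilon_i)}D_{-i}\big).$$ Then $\mathbf K'(2n{+}1;\underline1)=\mathcal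 D_K(\mathcal O)$ is a Lie subalgebra of $\mathrm{Der}\,\mathcal O$; let $\mathbf K(2n{+}1;\underline1)$ be its derived algebra. Let $\mathbf u=\mathbf u(\mathbf K(2n{+}1;\underline 1))$ be its restricted universal enveloping algebra, i.e. the quotient of $U(\mathbf K(2n{+}1;\underline1))$ by the ideal generated by $D^p-D$ for $D=\mathcal D_K(x^{(\epsilon_i+\epsilon_{-i})})$ $(1\le i\le n)$ and $D=\mathcal D_K(x^{(\epsilon_0)})$, and by $D^p$ for all other $D=\mathcal D_K(x^{(\alpha)})\in\mathbf K(2n{+}1;\underline1)$. Put $\mathcal K[t]_p^{(q)}=\mathcal K[t]/(t^p-qt)$ and $\mathbf u_{t,q}=\mathbf u\otimes_{\mathcal K}\mathcal K[t]_p^{(q)}$. In an associative algebra write $y_a^{\langle \ell\rangle}=(y+a)(y+a+1)\cdots(y+a+\ell-1)$ and $y^{\langle\ell\rangle}=y_0^{\langle\ell\rangle}$. Let $h=\mathcal D_K(x^{(\epsilon_k+\epsilon_{-k})})$, $e=2\mathcal D_K(x^{(2\epsilon_k+\epsilon_{-k})})$ and $d^{(\ell)}=\frac1{\ell!}(\mathrm{ad}\,e)^\ell$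 for $0\le\ell\le p-1$. Then $h,e\in\mathbf K(2n{+}1;\underline1)$, the element $1-et$ is invertible in $\mathbf u_{t,q}$, and there is a noncommutative and noncocommutative Hopf algebra structure over $\mathcal K[t]_p^{(q)}$ on $\mathbf u_{t,q}$, with its algebra structure undeformed, such that $$\Delta(\mathcal D_K(x^{(\alpha)}))=\mathcal D_K(x^{(\alpha)})\otimes(1-et)^{\alpha_k-\alpha_{-k}}+\sum_{\ell=0}^{p-1}(-1)^\ell h^{\langle\ell\rangle}\otimes(1-et)^{-\ell}\,d^{(\ell)}\big(\mathcal D_K(x^{(\alpha)})\big)t^\ell,$$ $$S(\mathcal D_K(x^{(\alpha)}))=-(1-et)^{\alpha_{-k}-\alpha_k}\sum_{\ell=0}^{p-1}d^{(\ell)}\big(\mathcal D_K(x^{(\alpha)})\big)\,h_1^{\langle\ell\rangle}\,t^\ell,\qquad \varepsilon(\mathcal D_K(x^{(\alpha)}))=0,$$ for all $0\le\alpha\le\tau$ if $2n+4\not\equiv0\pmod p$, and for all $0\le\alpha\le\tau$ with $\alpha\ne\tau$ if $2n+4\equiv0\pmod p$; for these $\alpha$ one has $\mathcal D_K(x^{(\alpha)})\in\mathbf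 K(2n{+}1;\underline1)$. Moreover $\mathbf u_{t,q}$ is finite dimensional, with $\dim_{\mathcal K}\mathbf u_{t,q}=p^{p^{2n+1}+1}$ if $2n+4\not\equiv0\pmod p$ and $\dim_{\mathcal K}\mathbf u_{t,q}=p^{p^{2n+1}}$ if $2n+4\equiv0\pmod p$. -/

import Mathlib

open scoped TensorProduct

/-! ### The truncated divided power algebra -/

/-- The restricted divided power algebra `O(m; 1)` in variables indexed by `σ`: an element is given
by its coefficients on the multi-indices `0 ≤ α ≤ τ = (p-1, …, p-1)`, and `f` stands for
`∑ α, f.coef α • x^(α)`. -/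
@[ext] structure DivPow (K : Type*) (p : ℕ) (σ : Type*) where
  coef : (σ → Fin p) → K

namespace DivPow

section

set_option linter.unusedSectionVars false

variable {K : Type*} [Field K] {p : ℕ} {σ : Type*} [Fintype σ] [DecidableEq σ]

/-- An element of `O(m; 1)` is the same as its coefficient function. -/
def equivFun : DivPow K p σ ≃ ((σ → Fin p) → K) where
  toFun := coef
  invFun := mk
  left_inv _ := rfl
  right_inv _ := rfl

instance : AddCommGroup (DivPow K p σ) := equivFun.addCommGroup

instance : Module K (DivPow K p σ) := equivFun.module K

theorem ext' {f g : DivPow K p σ} (h : ∀ γ, f.coef γ = g.coef γ) : f = g := DivPow.ext (funext h)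

@[simp] theorem add_apply (f g : DivPow K p σ) (γ : σ → Fin p) :
    (f + g).coef γ = f.coef γ + g.coef γ := rfl

@[simp] theorem smul_apply (c : K) (f : DivPow K p σ) (γ : σ → Fin p) :
    (c • f).coef γ = c * f.coef γ := rfl

@[simp] theorem zero_apply (γ : σ → Fin p) : (0 : DivPow K p σ).coef γ = 0 := rfl

/-- The basis element `x^(α)`. -/
def mono (α : σ → Fin p) : DivPow K p σ := ⟨fun γ => if γ = α then 1 else 0⟩

/-- The coefficient of `x^(c)` in `x^(a) x^(b)`, in one variable. -/
def coeffOne (K : Type*) [Field K] {p : ℕ} (a b c : Fin p) : K :=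
  if (a : ℕ) + b = c then (((c : ℕ).choose a : ℕ) : K) else 0

/-- The coefficient of `x^(γ)` in `x^(α) x^(β)`. -/
def coeff (K : Type*) [Field K] {p : ℕ} {σ : Type*} [Fintype σ] (α β γ : σ → Fin p) : K :=
  ∏ i, coeffOne K (α i) (β i) (γ i)

/-- The product determined by `x^(α) x^(β) = binom (α+β) α x^(α+β)`, where `x^(γ) = 0` if some
component of `γ` is at least `p`. -/
instance : Mul (DivPow K p σ) where
  mul f g := ⟨fun γ => ∑ α, ∑ β, coeff K α β γ * (f.coef α * g.coef β)⟩

theorem mul_apply (f g : DivPow K p σ) (γ : σ → Fin p) :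
    (f * g).coef γ = ∑ α, ∑ β, coeff K α β γ * (f.coef α * g.coef β) := rfl

theorem coeffOne_comm (a b c : Fin p) : coeffOne K a b c = coeffOne K b a c := by
  unfold coeffOne
  by_cases h : (a : ℕ) + b = c
  · rw [if_pos h, if_pos (by omega), ← h, Nat.choose_symm_add]
  · rw [if_neg h, if_neg (by omega)]

theorem coeff_comm (α β γ : σ → Fin p) : coeff K α β γ = coeff K β α γ :=
  Finset.prod_congr rfl fun _ _ => coeffOne_comm _ _ _

theorem sum_prod_fun (F : σ → Fin p → K) : ∑ δ : σ → Fin p, ∏ i, F i (δ i) = ∏ i, ∑ d, F i d := by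
  rw [Finset.prod_univ_sum, Fintype.piFinset_univ]

theorem coeffOne_assoc (a b e c : Fin p) :
    ∑ d, coeffOne K a b d * coeffOne K d e c = ∑ d, coeffOne K a d c * coeffOne K b e d := by
  by_cases h : (a : ℕ) + b + e = c
  · have h1 : (a : ℕ) + b < p := by omega
    have h2 : (b : ℕ) + e < p := by omega
    rw [Finset.sum_eq_single ⟨a + b, h1⟩, Finset.sum_eq_single ⟨b + e, h2⟩]
    · unfold coeffOne
      simp only [if_true, h, show (a : ℕ) + (b + e) = c by omega]
      norm_cast
      have := Nat.choose_mul (n := c) (k := a + b) (s := a) (by omega)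
      rw [mul_comm, this, show (c : ℕ) - a = b + e by omega, show (a : ℕ) + b - a = b by omega]
    · intro d _ hd
      unfold coeffOne
      rw [if_neg (c := (b : ℕ) + e = d), mul_zero]
      intro h'; exact hd (Fin.ext h'.symm)
    · simp
    · intro d _ hd
      unfold coeffOne
      rw [if_neg (c := (a : ℕ) + b = d), zero_mul]
      intro h'; exact hd (Fin.ext h'.symm)
    · simp
  · rw [Finset.sum_eq_zero, Finset.sum_eq_zero]
    · intro d _
      unfold coeffOne
      split_ifs <;> first | omega | simp
    · intro d _
      unfold coeffOne
      split_ifs <;> first | omega | simp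

theorem coeff_assoc (α β ε γ : σ → Fin p) :
    ∑ δ, coeff K α β δ * coeff K δ ε γ = ∑ δ, coeff K α δ γ * coeff K β ε δ := by
  simp only [coeff, ← Finset.prod_mul_distrib]
  rw [sum_prod_fun (fun i d => coeffOne K (α i) (β i) d * coeffOne K d (ε i) (γ i)),
    sum_prod_fun (fun i d => coeffOne K (α i) d (γ i) * coeffOne K (β i) (ε i) d)]
  exact Finset.prod_congr rfl fun _ _ => coeffOne_assoc _ _ _ _

theorem coeff_zero_left [NeZero p] (β γ : σ → Fin p) :
    coeff K (fun _ => 0) β γ = if γ = β then 1 else 0 := by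
  unfold coeff coeffOne
  by_cases h : γ = β
  · subst h; simp
  · rw [if_neg h]
    obtain ⟨i, hi⟩ := Function.ne_iff.mp h
    refine Finset.prod_eq_zero (Finset.mem_univ i) (if_neg ?_)
    simpa [Fin.ext_iff, eq_comm] using hi

theorem mul_comm' (f g : DivPow K p σ) : f * g = g * f := by
  refine ext' fun γ => ?_
  rw [mul_apply, mul_apply, Finset.sum_comm]
  refine Finset.sum_congr rfl fun α _ => Finset.sum_congr rfl fun β _ => ?_
  rw [coeff_comm, mul_comm (f.coef β)]

theorem add_mul' (f g h : DivPow K p σ) : (f + g) * h = f * h + g * h := by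
  refine ext' fun γ => ?_
  simp only [mul_apply, add_apply, add_mul, mul_add, Finset.sum_add_distrib]

theorem smul_mul' (c : K) (f g : DivPow K p σ) : c • f * g = c • (f * g) := by
  refine ext' fun γ => ?_
  simp only [mul_apply, smul_apply, Finset.mul_sum]
  refine Finset.sum_congr rfl fun α _ => Finset.sum_congr rfl fun β _ => ?_
  ring

theorem mul_assoc' (f g h : DivPow K p σ) : f * g * h = f * (g * h) := by
  refine ext' fun γ => ?_
  have e1 : (f * g * h).coef γ =
      ∑ α, ∑ β, ∑ ε, (∑ δ, coeff K α β δ * coeff K δ ε γ) * (f.coef α * g.coef β * h.coef ε) := by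
    simp only [mul_apply, Finset.sum_mul, Finset.mul_sum]
    rw [Finset.sum_comm' (t' := Finset.univ) (s' := fun _ => Finset.univ) (by simp)]
    rw [Finset.sum_congr rfl fun ε _ => Finset.sum_comm]
    rw [Finset.sum_comm]
    refine Finset.sum_congr rfl fun α _ => ?_
    rw [Finset.sum_congr rfl fun ε _ => Finset.sum_comm, Finset.sum_comm]
    refine Finset.sum_congr rfl fun β _ => Finset.sum_congr rfl fun ε _ =>
      Finset.sum_congr rfl fun δ _ => ?_
    ring
  have e2 : (f * (g * h)).coef γ =
      ∑ α, ∑ β, ∑ ε, (∑ δ, coeff K α δ γ * coeff K β ε δ) * (f.coef α * g.coef β * h.coef ε) := by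
    simp only [mul_apply, Finset.sum_mul, Finset.mul_sum]
    refine Finset.sum_congr rfl fun α _ => ?_
    rw [Finset.sum_comm]
    refine Finset.sum_congr rfl fun β _ => ?_
    rw [Finset.sum_comm]
    refine Finset.sum_congr rfl fun ε _ => Finset.sum_congr rfl fun δ _ => ?_
    ring
  rw [e1, e2]
  simp only [coeff_assoc]

instance [NeZero p] : One (DivPow K p σ) where
  one := mono fun _ => 0

theorem one_mul' [NeZero p] (f : DivPow K p σ) : 1 * f = f := by
  refine ext' fun γ => ?_
  change ∑ α, ∑ β, coeff K α β γ * ((if α = fun _ => 0 then 1 else 0) * f.coef β) = f.coef γ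
  rw [Finset.sum_eq_single (fun _ => 0) (by intro α _ hα; simp [hα]) (by simp)]
  rw [Finset.sum_eq_single γ (by intro β _ hβ; simp [coeff_zero_left, Ne.symm hβ]) (by simp)]
  simp [coeff_zero_left]

instance [NeZero p] : CommRing (DivPow K p σ) where
  __ := (inferInstance : AddCommGroup (DivPow K p σ))
  mul_assoc := mul_assoc'
  mul_comm := mul_comm'
  one_mul := one_mul'
  mul_one f := by rw [mul_comm', one_mul']
  right_distrib := add_mul'
  left_distrib f g h := by rw [mul_comm', add_mul', mul_comm' g, mul_comm' h]
  zero_mul f := by refine ext' fun γ => ?_; simp [mul_apply]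
  mul_zero f := by refine ext' fun γ => ?_; simp [mul_apply]

instance [NeZero p] : Algebra K (DivPow K p σ) :=
  Algebra.ofModule smul_mul' fun c f g => by rw [mul_comm', smul_mul', mul_comm']

/-- The linear map `D_j` with `D_j x^(α) = x^(α - ε_j)`: the coefficient of `x^(γ)` in `D_j f` is
the coefficient of `x^(γ + ε_j)` in `f`. -/
def partialLin (j : σ) : DivPow K p σ →ₗ[K] DivPow K p σ where
  toFun f := ⟨fun γ =>
    if h : (γ j : ℕ) + 1 < p then f.coef (Function.update γ j ⟨(γ j : ℕ) + 1, h⟩) else 0⟩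
  map_add' f g := by
    refine ext' fun γ => ?_
    simp only [add_apply]
    split_ifs <;> simp
  map_smul' c f := by
    refine ext' fun γ => ?_
    simp only [RingHom.id_apply, smul_apply]
    split_ifs <;> simp

/-- The matrix of `D_j`, in one variable. -/
def shiftOne (K : Type*) [Field K] {p : ℕ} (b : Prop) [Decidable b] (c d : Fin p) : K :=
  if (d : ℕ) = c + (if b then 1 else 0) then 1 else 0

/-- The matrix of `D_j`. -/
def shift (K : Type*) [Field K] {p : ℕ} {σ : Type*} [Fintype σ] [DecidableEq σ]
    (j : σ) (γ δ : σ → Fin p) : K :=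
  ∏ i, shiftOne K (i = j) (γ i) (δ i)

theorem shift_eq (j : σ) (γ δ : σ → Fin p) :
    shift K j γ δ = if ∀ i, (δ i : ℕ) = γ i + (if i = j then 1 else 0) then 1 else 0 := by
  unfold shift shiftOne
  rw [Finset.prod_ite_zero]
  simp

theorem partialLin_apply (j : σ) (f : DivPow K p σ) (γ : σ → Fin p) :
    (partialLin j f).coef γ = ∑ δ, shift K j γ δ * f.coef δ := by
  change dite _ _ _ = _
  simp only [shift_eq]
  split_ifs with h
  · rw [Finset.sum_eq_single (Function.update γ j ⟨(γ j : ℕ) + 1, h⟩)]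
    · rw [if_pos, one_mul]
      intro i
      by_cases hi : i = j
      · subst hi; simp
      · simp [hi]
    · intro δ _ hδ
      rw [if_neg, zero_mul]
      intro h'
      refine hδ (funext fun i => Fin.ext ?_)
      rw [h' i]
      by_cases hi : i = j
      · subst hi; simp
      · simp [hi]
    · simp
  · rw [Finset.sum_eq_zero]
    intro δ _
    rw [if_neg, zero_mul]
    intro h'
    have := h' j
    have := (δ j).isLt
    simp at *
    omega

theorem leibnizOne_false (a b c : Fin p) (P : Prop) [Decidable P] (hP : ¬ P) :
    ∑ d, shiftOne K P c d * coeffOne K a b d = coeffOne K a b c ∧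
    ∑ d, shiftOne K P d b * coeffOne K a d c = coeffOne K a b c ∧
    ∑ d, shiftOne K P d a * coeffOne K d b c = coeffOne K a b c := by
  simp only [shiftOne, if_neg hP, add_zero, Fin.val_inj, ite_mul, one_mul, zero_mul]
  simp [Finset.sum_ite_eq]

theorem sum_shiftOne_right (c : Fin p) (P : Prop) [Decidable P] (hP : P) (F : Fin p → K) :
    ∑ d, shiftOne K P c d * F d = if h : (c : ℕ) + 1 < p then F ⟨c + 1, h⟩ else 0 := by
  simp only [shiftOne, if_pos hP, ite_mul, one_mul, zero_mul]
  split_ifs with h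
  · rw [Finset.sum_eq_single ⟨c + 1, h⟩]
    · simp
    · intro d _ hd
      rw [if_neg]
      intro h'; exact hd (Fin.ext h')
    · simp
  · refine Finset.sum_eq_zero fun d _ => if_neg ?_
    have := d.isLt
    omega

theorem sum_shiftOne_left (b : Fin p) (P : Prop) [Decidable P] (hP : P) (F : Fin p → K) :
    ∑ d, shiftOne K P d b * F d = if h : 1 ≤ (b : ℕ) then F ⟨b - 1, by omega⟩ else 0 := by
  simp only [shiftOne, if_pos hP, ite_mul, one_mul, zero_mul]
  split_ifs with h
  · rw [Finset.sum_eq_single ⟨b - 1, by omega⟩]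
    · rw [if_pos]; simp; omega
    · intro d _ hd
      rw [if_neg]
      intro h'; exact hd (Fin.ext (by simp; omega))
    · simp
  · exact Finset.sum_eq_zero fun d _ => if_neg (by omega)

theorem leibnizOne_true [Fact p.Prime] [CharP K p] (a b c : Fin p) (P : Prop) [Decidable P]
    (hP : P) :
    ∑ d, shiftOne K P c d * coeffOne K a b d =
      ∑ d, shiftOne K P d b * coeffOne K a d c + ∑ d, shiftOne K P d a * coeffOne K d b c := by
  rw [sum_shiftOne_right c P hP, sum_shiftOne_left b P hP, sum_shiftOne_left a P hP]
  have ha := a.isLt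
  have hb := b.isLt
  have hc := c.isLt
  simp only [coeffOne]
  by_cases h : (a : ℕ) + b = c + 1
  · rcases Nat.eq_zero_or_pos (a : ℕ) with ha0 | ha0
    · rw [dif_pos (by omega), if_pos h, dif_pos (by omega), if_pos (by omega), dif_neg (by omega)]
      simp [ha0]
    rcases Nat.eq_zero_or_pos (b : ℕ) with hb0 | hb0
    · have hac : (a : ℕ) = c + 1 := by omega
      rw [dif_pos (by omega), if_pos h, dif_neg (by omega), dif_pos (by omega),
        if_pos (by omega)]
      simp [hac]
    · have key : (((c : ℕ) + 1).choose a : K) = ((c : ℕ).choose a : K) + ((c : ℕ).choose (a - 1) : K) := by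
        obtain ⟨m, hm⟩ : ∃ m, (a : ℕ) = m + 1 := ⟨a - 1, by omega⟩
        rw [hm, Nat.choose_succ_succ]
        push_cast
        simp only [Nat.succ_eq_add_one]
        rw [add_comm]
      rw [dif_pos (show 1 ≤ (b : ℕ) from hb0), if_pos (show (a : ℕ) + (b - 1) = c by omega),
        dif_pos (show 1 ≤ (a : ℕ) from ha0), if_pos (show (a : ℕ) - 1 + b = c by omega), ← key]
      split_ifs with h'
      · rfl
      · have hcp : (c : ℕ) + 1 = p := by omega
        rw [hcp, eq_comm, CharP.cast_eq_zero_iff K p]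
        exact (Fact.out : p.Prime).dvd_choose_self (by omega) ha
  · split_ifs <;> first | omega | simp

theorem leibniz_coeff [Fact p.Prime] [CharP K p] (j : σ) (α β γ : σ → Fin p) :
    ∑ δ, shift K j γ δ * coeff K α β δ =
      ∑ δ, shift K j δ β * coeff K α δ γ + ∑ δ, shift K j δ α * coeff K δ β γ := by
  simp only [shift, coeff, ← Finset.prod_mul_distrib]
  rw [sum_prod_fun (fun i d => shiftOne K (i = j) (γ i) d * coeffOne K (α i) (β i) d),
    sum_prod_fun (fun i d => shiftOne K (i = j) d (β i) * coeffOne K (α i) d (γ i)),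
    sum_prod_fun (fun i d => shiftOne K (i = j) d (α i) * coeffOne K d (β i) (γ i)),
    ← Finset.mul_prod_erase _ _ (Finset.mem_univ j),
    ← Finset.mul_prod_erase _ (fun i => ∑ d, shiftOne K (i = j) d (β i) * _)
      (Finset.mem_univ j),
    ← Finset.mul_prod_erase _ (fun i => ∑ d, shiftOne K (i = j) d (α i) * _)
      (Finset.mem_univ j),
    leibnizOne_true _ _ _ (j = j) rfl, add_mul]
  congr 2
  · refine Finset.prod_congr rfl fun i hi => ?_
    have := leibnizOne_false (K := K) (α i) (β i) (γ i) (i = j) (Finset.ne_of_mem_erase hi)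
    rw [this.1, this.2.1]
  · refine Finset.prod_congr rfl fun i hi => ?_
    have := leibnizOne_false (K := K) (α i) (β i) (γ i) (i = j) (Finset.ne_of_mem_erase hi)
    rw [this.1, this.2.2]

theorem partialLin_mul [Fact p.Prime] [CharP K p] (j : σ) (f g : DivPow K p σ) :
    partialLin j (f * g) = f * partialLin j g + g * partialLin j f := by
  refine ext' fun γ => ?_
  have e1 : (partialLin j (f * g)).coef γ =
      ∑ α, ∑ β, (∑ δ, shift K j γ δ * coeff K α β δ) * (f.coef α * g.coef β) := by
    simp only [partialLin_apply, mul_apply, Finset.mul_sum, Finset.sum_mul]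
    rw [Finset.sum_comm]
    refine Finset.sum_congr rfl fun α _ => ?_
    rw [Finset.sum_comm]
    refine Finset.sum_congr rfl fun β _ => Finset.sum_congr rfl fun δ _ => ?_
    ring
  have e2 : (f * partialLin j g).coef γ =
      ∑ α, ∑ β, (∑ δ, shift K j δ β * coeff K α δ γ) * (f.coef α * g.coef β) := by
    simp only [partialLin_apply, mul_apply, Finset.mul_sum, Finset.sum_mul]
    refine Finset.sum_congr rfl fun α _ => ?_
    rw [Finset.sum_comm]
    refine Finset.sum_congr rfl fun β _ => Finset.sum_congr rfl fun δ _ => ?_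
    ring
  have e3 : (g * partialLin j f).coef γ =
      ∑ α, ∑ β, (∑ δ, shift K j δ α * coeff K δ β γ) * (f.coef α * g.coef β) := by
    rw [mul_comm]
    simp only [partialLin_apply, mul_apply, Finset.mul_sum, Finset.sum_mul]
    rw [Finset.sum_comm, Finset.sum_congr rfl fun β _ => Finset.sum_comm, Finset.sum_comm]
    refine Finset.sum_congr rfl fun α _ => Finset.sum_congr rfl fun β _ =>
      Finset.sum_congr rfl fun δ _ => ?_
    ring
  rw [add_apply, e1, e2, e3]
  simp only [leibniz_coeff, add_mul, Finset.sum_add_distrib]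

variable (K p) in
/-- The derivation `D_j` of `O(m; 1)`. -/
def D [Fact p.Prime] [CharP K p] (j : σ) : Derivation K (DivPow K p σ) (DivPow K p σ) :=
  Derivation.mk' (partialLin j) fun f g => partialLin_mul j f g

theorem D_comm [Fact p.Prime] [CharP K p] (i j : σ) (f : DivPow K p σ) :
    D K p i (D K p j f) = D K p j (D K p i f) := by
  refine ext' fun γ => ?_
  by_cases hij : i = j
  · rw [hij]
  change dite _ (fun h => dite _ _ _) _ = dite _ (fun h => dite _ _ _) _
  simp only [Function.update_of_ne hij, Function.update_of_ne (Ne.symm hij)]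
  split_ifs <;> first | rfl | rw [Function.update_comm hij]

/-- The multi-index `ε_j`. -/
def eps [Fact p.Prime] (j : σ) : σ → Fin p :=
  Pi.single j ⟨1, (Fact.out : p.Prime).one_lt⟩

/-- The multi-index `τ = (p-1, …, p-1)`. -/
def tau [Fact p.Prime] : σ → Fin p :=
  fun _ => ⟨p - 1, Nat.sub_lt (Fact.out : p.Prime).pos one_pos⟩

variable (K p) in
/-- The variable `x_j = x^(ε_j)`. -/
def X [Fact p.Prime] (j : σ) : DivPow K p σ := mono (eps j)

end

end DivPow

/-! ### The contact algebra -/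

/-- The index set `{-n, …, n}` of the variables: `none` is `0`, `some (inl i)` is the `i`-th
positive index and `some (inr i)` is its negative. -/
abbrev CIdx (n : ℕ) : Type := Option (Fin n ⊕ Fin n)

namespace CIdx

/-- The index `0`. -/
abbrev zero {n : ℕ} : CIdx n := none

/-- The index `i` with `1 ≤ i ≤ n`. -/
abbrev pos {n : ℕ} (i : Fin n) : CIdx n := some (Sum.inl i)

/-- The index `-i` with `1 ≤ i ≤ n`. -/
abbrev neg {n : ℕ} (i : Fin n) : CIdx n := some (Sum.inr i)

end CIdx

namespace Contact

open CIdx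

section

set_option linter.unusedSectionVars false

variable (K : Type*) [Field K] (p : ℕ) [Fact p.Prime] [CharP K p] (n : ℕ)

/-- The algebra `O(2n+1; 1)`. -/
abbrev O : Type _ := DivPow K p (CIdx n)

/-- All derivations of `O(2n+1; 1)`; this is the Jacobson-Witt algebra `W(2n+1; 1)`. -/
abbrev W : Type _ := Derivation K (O K p n) (O K p n)

variable {K p n}

/-- The coefficient of `D_j` in `D_K(f)`. On `f = x^(α)` one has `D_0 f = x^(α - ε_0)`,
`D_{±i} f = x^(α - ε_{±i})` and `x_{±i} D_{±i} f = α_{±i} x^(α)`. -/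
def dkCoef (f : O K p n) : CIdx n → O K p n
  | none => (2 : K) • f - ∑ i : Fin n, (DivPow.X K p (pos i) * DivPow.D K p (pos i) f +
      DivPow.X K p (neg i) * DivPow.D K p (neg i) f)
  | some (Sum.inl i) => DivPow.D K p zero f * DivPow.X K p (pos i) + DivPow.D K p (neg i) f
  | some (Sum.inr i) => DivPow.D K p zero f * DivPow.X K p (neg i) - DivPow.D K p (pos i) f

/-- The contact vector field `D_K(f)`. -/
def DK : O K p n →ₗ[K] W K p n where
  toFun f := ∑ j, dkCoef f j • DivPow.D K p j
  map_add' f g := by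
    rw [← Finset.sum_add_distrib]
    refine Finset.sum_congr rfl fun j _ => ?_
    rw [← add_smul]
    congr 1
    rcases j with _ | i | i <;>
      simp only [dkCoef, map_add, smul_add, mul_add, add_mul, Finset.sum_add_distrib] <;> ring
  map_smul' c f := by
    rw [RingHom.id_apply, Finset.smul_sum]
    refine Finset.sum_congr rfl fun j _ => ?_
    rw [← smul_assoc]
    congr 1
    rcases j with _ | i | i <;>
      simp only [dkCoef, Derivation.map_smul, smul_add, smul_sub, mul_smul_comm, smul_mul_assoc,
        Finset.smul_sum, smul_comm c (2 : K)]

/-- The Euler field `E = ∑ x_j D_j` over the nonzero indices. -/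
def euler : W K p n :=
  ∑ i : Fin n, (DivPow.X K p (pos i) • DivPow.D K p (pos i) +
    DivPow.X K p (neg i) • DivPow.D K p (neg i))

/-- The Poisson bracket with respect to the nonzero indices. -/
def pois (f g : O K p n) : O K p n :=
  ∑ i : Fin n, (DivPow.D K p (neg i) f * DivPow.D K p (pos i) g -
    DivPow.D K p (pos i) f * DivPow.D K p (neg i) g)

theorem sum_apply' {ι : Type*} (s : Finset ι) (d : ι → W K p n) (f : O K p n) :
    (∑ i ∈ s, d i) f = ∑ i ∈ s, d i f := by
  classical
  induction s using Finset.induction_on with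
  | empty => simp
  | insert a s ha ih => rw [Finset.sum_insert ha, Finset.sum_insert ha, Derivation.add_apply, ih]

theorem D_mono_coef (j : CIdx n) (α γ : CIdx n → Fin p) :
    (DivPow.D K p j (DivPow.mono α)).coef γ =
      if ∀ i, (α i : ℕ) = γ i + (if i = j then 1 else 0) then 1 else 0 := by
  change (DivPow.partialLin j (DivPow.mono α)).coef γ = _
  rw [DivPow.partialLin_apply, ← DivPow.shift_eq, Finset.sum_eq_single α]
  · simp [DivPow.mono]
  · intro δ _ hδ
    simp [DivPow.mono, hδ]
  · simp

theorem X_apply (j l : CIdx n) : DivPow.D K p j (DivPow.X K p l) = if j = l then 1 else 0 := by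
  have hp : 1 < p := (Fact.out : p.Prime).one_lt
  refine DivPow.ext' fun γ => ?_
  rw [DivPow.X, DivPow.eps, D_mono_coef]
  by_cases h : j = l
  · subst h
    rw [if_pos rfl]
    change _ = if γ = fun _ => 0 then 1 else 0
    congr 1
    rw [eq_iff_iff]
    constructor
    · intro h'
      funext i
      have := h' i
      by_cases hi : i = j
      · subst hi
        simp at this
        exact this
      · simp [hi] at this
        exact Fin.ext this.symm
    · rintro rfl i
      by_cases hi : i = j
      · subst hi; simp
      · simp [hi]
  · rw [if_neg h, if_neg, DivPow.zero_apply]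
    intro h'
    have := h' j
    simp [h] at this

theorem euler_apply (f : O K p n) : euler f =
    ∑ i : Fin n, (DivPow.X K p (pos i) * DivPow.D K p (pos i) f +
      DivPow.X K p (neg i) * DivPow.D K p (neg i) f) := by
  simp [euler, sum_apply']

theorem dkCoef_zero (f : O K p n) : dkCoef f zero = 2 * f - euler f := by
  rw [euler_apply]
  simp only [dkCoef, two_smul, two_mul]

theorem DK_apply (f g : O K p n) : DK f g =
    (2 * f - euler f) * DivPow.D K p zero g + DivPow.D K p zero f * euler g + pois f g := by
  change (∑ j, dkCoef f j • DivPow.D K p j) g = _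
  rw [sum_apply', Fintype.sum_option, Fintype.sum_sum_type, ← dkCoef_zero, add_assoc]
  congr 1
  simp only [dkCoef, Derivation.smul_apply, smul_eq_mul, euler_apply, pois, Finset.mul_sum,
    ← Finset.sum_add_distrib]
  exact Finset.sum_congr rfl fun i _ => by ring

theorem D_zero_euler (f : O K p n) :
    DivPow.D K p zero (euler f) = euler (DivPow.D K p zero f) := by
  simp only [euler_apply, map_sum, map_add, Derivation.leibniz, smul_eq_mul, X_apply,
    DivPow.D_comm zero]
  simp

theorem D_some_euler (s : Fin n ⊕ Fin n) (f : O K p n) :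
    DivPow.D K p (some s) (euler f) = euler (DivPow.D K p (some s) f) + DivPow.D K p (some s) f := by
  simp only [euler_apply, map_sum, map_add, Derivation.leibniz, smul_eq_mul, X_apply,
    DivPow.D_comm (some s), Finset.sum_add_distrib]
  rcases s with i | i <;> simp <;> ring

theorem pois_swap (f g : O K p n) : pois g f = - pois f g := by
  simp only [pois, ← Finset.sum_neg_distrib]
  exact Finset.sum_congr rfl fun i _ => by ring

theorem D_pois (j : CIdx n) (f g : O K p n) : DivPow.D K p j (pois f g) =
    pois (DivPow.D K p j f) g + pois f (DivPow.D K p j g) := by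
  simp only [pois, map_sum, map_sub, ← Finset.sum_add_distrib, Derivation.leibniz, smul_eq_mul,
    DivPow.D_comm j]
  exact Finset.sum_congr rfl fun i _ => by ring

theorem euler_pois (f g : O K p n) : euler (pois f g) =
    pois (euler f) g + pois f (euler g) - 2 * pois f g := by
  simp only [pois, map_sum, map_sub, ← Finset.sum_add_distrib, Derivation.leibniz, smul_eq_mul,
    D_some_euler, Finset.mul_sum, ← Finset.sum_sub_distrib]
  exact Finset.sum_congr rfl fun i _ => by ring

/-- The function `w` with `[D_K(f), D_K(g)] = D_K(w)`. -/
def contactBracket (f g : O K p n) : O K p n :=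
  (2 * f - euler f) * DivPow.D K p zero g - (2 * g - euler g) * DivPow.D K p zero f + pois f g

theorem lie_fields (a b : CIdx n → O K p n) :
    ⁅∑ j, a j • DivPow.D K p j, ∑ j, b j • DivPow.D K p j⁆ =
      ∑ l, ((∑ j, a j • DivPow.D K p j) (b l) - (∑ j, b j • DivPow.D K p j) (a l)) •
        DivPow.D K p l := by
  refine Derivation.ext fun u => ?_
  have key : ∀ a b : CIdx n → O K p n,
      (∑ j, a j • DivPow.D K p j) ((∑ j, b j • DivPow.D K p j) u) =
        ∑ l, (∑ j, a j • DivPow.D K p j) (b l) * DivPow.D K p l u +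
          ∑ l, ∑ j, b l * (a j * DivPow.D K p j (DivPow.D K p l u)) := by
    intro a b
    rw [sum_apply' _ _ u, map_sum, ← Finset.sum_add_distrib]
    refine Finset.sum_congr rfl fun l _ => ?_
    rw [Derivation.smul_apply, smul_eq_mul, Derivation.leibniz, smul_eq_mul, smul_eq_mul,
      ← Finset.mul_sum, sum_apply' _ _ (DivPow.D K p l u)]
    simp only [Derivation.smul_apply, smul_eq_mul]
    ring
  rw [Derivation.commutator_apply, key a b, key b a, sum_apply']
  have e : ∑ l, ∑ j, b l * (a j * DivPow.D K p j (DivPow.D K p l u)) =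
      ∑ l, ∑ j, a l * (b j * DivPow.D K p j (DivPow.D K p l u)) := by
    rw [Finset.sum_comm]
    refine Finset.sum_congr rfl fun l _ => Finset.sum_congr rfl fun j _ => ?_
    rw [DivPow.D_comm l j]
    ring
  rw [e, add_sub_add_right_eq_sub, ← Finset.sum_sub_distrib]
  exact Finset.sum_congr rfl fun l _ => by rw [Derivation.smul_apply, smul_eq_mul, sub_mul]

theorem pois_X_pos (f : O K p n) (i : Fin n) :
    pois f (DivPow.X K p (pos i)) = DivPow.D K p (neg i) f := by
  simp [pois, X_apply]

theorem pois_X_neg (f : O K p n) (i : Fin n) :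
    pois f (DivPow.X K p (neg i)) = - DivPow.D K p (pos i) f := by
  simp [pois, X_apply]

theorem euler_X (s : Fin n ⊕ Fin n) :
    euler (DivPow.X K p (some s)) = DivPow.X K p (some s) := by
  rcases s with i | i <;> simp [euler_apply, X_apply]

theorem D_two (d : W K p n) : d 2 = 0 := by
  rw [← one_add_one_eq_two, map_add, Derivation.map_one_eq_zero, add_zero]

theorem dkCoef_bracket (f g : O K p n) (l : CIdx n) :
    DK f (dkCoef g l) - DK g (dkCoef f l) = dkCoef (contactBracket f g) l := by
  rcases l with _ | i | i
  · change DK f (dkCoef g zero) - DK g (dkCoef f zero) = dkCoef (contactBracket f g) zero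
    simp only [dkCoef_zero, DK_apply, contactBracket, map_sub, map_add, D_zero_euler,
      two_mul, euler_pois, Derivation.leibniz, smul_eq_mul,
      pois_swap f g, pois_swap (euler f) g]
    ring
  · simp only [dkCoef, DK_apply, contactBracket, map_sub, map_add, D_two, D_zero_euler,
      D_some_euler, pois_X_pos, euler_X, X_apply, D_pois,
      Derivation.leibniz, smul_eq_mul,
      pois_swap (DivPow.D K p zero f) g, pois_swap (DivPow.D K p (neg i) f) g,
      DivPow.D_comm (neg i) zero]
    simp
    ring
  · simp only [dkCoef, DK_apply, contactBracket, map_sub, map_add, D_two, D_zero_euler,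
      D_some_euler, pois_X_neg, euler_X, X_apply, D_pois,
      Derivation.leibniz, smul_eq_mul,
      pois_swap (DivPow.D K p zero f) g, pois_swap (DivPow.D K p (pos i) f) g,
      DivPow.D_comm (pos i) zero]
    simp
    ring

theorem lie_DK (f g : O K p n) : ⁅DK f, DK g⁆ = DK (contactBracket f g) := by
  change ⁅∑ j, dkCoef f j • DivPow.D K p j, ∑ j, dkCoef g j • DivPow.D K p j⁆ = _
  rw [lie_fields]
  change _ = ∑ j, dkCoef (contactBracket f g) j • DivPow.D K p j
  refine Finset.sum_congr rfl fun l _ => ?_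
  rw [← dkCoef_bracket]
  rfl

variable (K p n)

/-- The Lie algebra `K'(2n+1; 1) = D_K(O(2n+1; 1))`. -/
def contactPrime : LieSubalgebra K (W K p n) where
  __ := LinearMap.range (DK : O K p n →ₗ[K] W K p n)
  lie_mem' := by
    rintro _ _ ⟨f, rfl⟩ ⟨g, rfl⟩
    exact ⟨contactBracket f g, (lie_DK f g).symm⟩

/-- The contact algebra `K(2n+1; 1)`: the derived algebra of `K'(2n+1; 1)`. -/
abbrev ContactAlg : Type _ := LieAlgebra.derivedSeries K (contactPrime K p n) 1

variable {K p n}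

/-- An element of the contact algebra, as a derivation of `O(2n+1; 1)`. -/
abbrev toDer (x : ContactAlg K p n) : W K p n := ((x : contactPrime K p n) : W K p n)

variable (K p n)

/-- The relations `D_K(x^(ε_i + ε_{-i}))^p = D_K(x^(ε_i + ε_{-i}))`, `D_K(x^(ε_0))^p = D_K(x^(ε_0))`
and `D_K(x^(α))^p = 0` for the other `α` with `D_K(x^(α))` in the contact algebra; these are the
values of the `p`-map `D ↦ D^p` on the standard basis. -/
inductive RestrictedRel : UniversalEnvelopingAlgebra K (ContactAlg K p n) →
    UniversalEnvelopingAlgebra K (ContactAlg K p n) → Prop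
  | pair (x : ContactAlg K p n) (i : Fin n)
      (hx : toDer x = DK (DivPow.mono (DivPow.eps (pos i) + DivPow.eps (neg i)))) :
      RestrictedRel (UniversalEnvelopingAlgebra.ι K x ^ p) (UniversalEnvelopingAlgebra.ι K x)
  | zero (x : ContactAlg K p n) (hx : toDer x = DK (DivPow.mono (DivPow.eps zero))) :
      RestrictedRel (UniversalEnvelopingAlgebra.ι K x ^ p) (UniversalEnvelopingAlgebra.ι K x)
  | nil (x : ContactAlg K p n) (α : CIdx n → Fin p)
      (h1 : ∀ i : Fin n, α ≠ DivPow.eps (pos i) + DivPow.eps (neg i)) (h0 : α ≠ DivPow.eps zero)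
      (hx : toDer x = DK (DivPow.mono α)) :
      RestrictedRel (UniversalEnvelopingAlgebra.ι K x ^ p) 0

/-- The restricted universal enveloping algebra `u(K(2n+1; 1))`. -/
abbrev RestrictedEnv : Type _ := RingQuot (RestrictedRel K p n)

/-- The ring `K[t]_p^(q) = K[t] / (t^p - q t)`. -/
abbrev TruncPoly (K : Type*) [Field K] (p : ℕ) (q : K) : Type _ :=
  AdjoinRoot (Polynomial.X ^ p - Polynomial.C q * Polynomial.X : Polynomial K)

/-- The class of `t` in `K[t]_p^(q)`. -/
noncomputable abbrev tElt (K : Type*) [Field K] (p : ℕ) (q : K) : TruncPoly K p q :=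
  AdjoinRoot.root (Polynomial.X ^ p - Polynomial.C q * Polynomial.X : Polynomial K)

/-- The `K[t]_p^(q)`-algebra `u_{t,q}(K(2n+1; 1))`, the base change of `u(K(2n+1; 1))`. -/
abbrev UTQ (q : K) : Type _ := TruncPoly K p q ⊗[K] RestrictedEnv K p n

variable {K p n}

/-- The image of an element of the contact algebra in `u_{t,q}(K(2n+1; 1))`. -/
noncomputable def inc (q : K) (x : ContactAlg K p n) : UTQ K p n q :=
  1 ⊗ₜ[K] RingQuot.mkAlgHom K (RestrictedRel K p n) (UniversalEnvelopingAlgebra.ι K x)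

end

end Contact

/-! ### Hopf algebra structures on a given algebra -/

/-- A Hopf algebra structure on the `R`-algebra `A` whose product and unit are the given ones. -/
structure HopfStructure (R A : Type*) [CommRing R] [Ring A] [Algebra R A] where
  comul : A →ₐ[R] A ⊗[R] A
  counit : A →ₐ[R] R
  antipode : A →ₗ[R] A
  coassoc : (Algebra.TensorProduct.assoc R R R A A A).toAlgHom.comp
      ((Algebra.TensorProduct.map comul (AlgHom.id R A)).comp comul) =
    (Algebra.TensorProduct.map (AlgHom.id R A) comul).comp comul
  rTensor_counit_comul : (Algebra.TensorProduct.map counit (AlgHom.id R A)).comp comul =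
    (Algebra.TensorProduct.lid R A).symm
  lTensor_counit_comul : (Algebra.TensorProduct.map (AlgHom.id R A) counit).comp comul =
    (Algebra.TensorProduct.rid R R A).symm
  mul_antipode_rTensor_comul :
    LinearMap.mul' R A ∘ₗ antipode.rTensor A ∘ₗ comul.toLinearMap =
      Algebra.linearMap R A ∘ₗ counit.toLinearMap
  mul_antipode_lTensor_comul :
    LinearMap.mul' R A ∘ₗ antipode.lTensor A ∘ₗ comul.toLinearMap =
      Algebra.linearMap R A ∘ₗ counit.toLinearMap

/-- The Hopf algebra of Mathlib given by a `HopfStructure`. -/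
abbrev HopfStructure.toHopfAlgebra {R A : Type*} [CommRing R] [Ring A] [Algebra R A]
    (H : HopfStructure R A) : HopfAlgebra R A where
  __ := Bialgebra.ofAlgHom H.comul H.counit H.coassoc H.rTensor_counit_comul
    H.lTensor_counit_comul
  antipode := H.antipode
  mul_antipode_rTensor_comul := H.mul_antipode_rTensor_comul
  mul_antipode_lTensor_comul := H.mul_antipode_lTensor_comul

/-- The rising factorial `y (y + 1) ⋯ (y + m - 1)`; thus `x_a^⟨m⟩ = risingFac (x + a) m`. -/
def risingFac {A : Type*} [Ring A] (y : A) : ℕ → A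
  | 0 => 1
  | m + 1 => risingFac y m * (y + m)

/-- The divided power `d^(ℓ) = (ad e)^ℓ / ℓ!` of the inner derivation `ad e`. -/
def divAd (K : Type*) {A : Type*} [Field K] [Ring A] [Algebra K A] (e : A) (l : ℕ) (x : A) : A :=
  ((l.factorial : K)⁻¹) • (fun y : A => e * y - y * e)^[l] x

/-! The structure is a Drinfeld twist of the standard cocommutative one on `u ⊗ K[t]/(t^p - qt)`.
Since `h^p = h`, the element `h` is diagonalizable with eigenvalues in `F_p`, and `π_j = 1 - (h -
j)^(p-1)` are its spectral projections. Since `e^p = 0`, the unit `w = 1 - te` satisfies `w^p = 1`,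
so `w^j` makes sense for a residue `j` modulo `p`. The twist is the finite sum `F = ∑ π_j ⊗ w^j`;
the new comultiplication is conjugation by `F`, and the new antipode is conjugation by `V = ∑ π_j (1
+ te)^j`, the image of `F` under `id ⊗ S` followed by multiplication. The counit is unchanged.

If `[h, x] = m x` and `x` is primitive, then `x` shifts the projections by `m`, which gives `Δ(x) =
x ⊗ w^m + ∑ π_j ⊗ w^j x w^(-j)`. Right multiplication by `w` is left multiplication by `w` plus `t
ad e`, and the two commute, so the binomial theorem expands `w^j x w^(-j)` in the divided powers of
`ad e`, with coefficients that are rising factorials in `j`; summing against `π_j` turns `j` into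
`h` (`TwistDatum.comul_eq`, `TwistDatum.antipode_eq`). No cocycle identity is isolated:
coassociativity and the counit axioms are compared on weight generators, using that `w` becomes
grouplike, and the antipode axiom is extended from generators to products (`TwistDatum.hopf`).

The dimension needs a basis of `u` and the dimension of the contact algebra. For the first, ordered
monomials with exponents below `p` span by straightening, and a relation among them is reduced by
the coproduct to a linear relation among generators (`OrderedMonomials.basis`). The generators are
independent because the contact algebra acts faithfully on `O` and this action respects the
relations imposed in `u` (`Contact.incU_injective`), which amounts to computing the `p`-th powers of
the fields `D_K(x^(α))`. For the second, `D_K` is injective, every `x^(α)` with `α ≠ τ` is a partial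
derivative and hence comes from the derived algebra, and `x^(τ)` does so exactly when `2n + 4` is
nonzero in `K`, because the contact bracket is `(2n + 4) f D_0 g` plus total derivatives.

Finally `[h, e] = e ≠ 0` gives noncommutativity, and symmetry of `Δ(h) = h ⊗ w^(-1) + 1 ⊗ h` would
force `h` to commute with `w`, hence `te = 0`. -/

/-! ### Bases of primitively generated algebras in characteristic `p` -/

namespace OrderedMonomials

/-! ### Straightening into ordered monomials -/

section Span

variable {K A : Type*} [Field K] [Ring A] [Algebra K A] {N : ℕ} (x : Fin N → A)

/-- The span of the products of at most `m` generators. -/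
def filt (K : Type*) {A : Type*} [Field K] [Ring A] [Algebra K A] {N : ℕ} (x : Fin N → A) (m : ℕ) :
    Submodule K A :=
  Submodule.span K {y | ∃ l : List (Fin N), l.length ≤ m ∧ (l.map x).prod = y}

theorem prod_mem_filt {m : ℕ} {l : List (Fin N)} (h : l.length ≤ m) :
    (l.map x).prod ∈ filt K x m := Submodule.subset_span ⟨l, h, rfl⟩

theorem filt_mono {m k : ℕ} (h : m ≤ k) : filt K x m ≤ filt K x k :=
  Submodule.span_mono fun _ ⟨l, hl, e⟩ => ⟨l, hl.trans h, e⟩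

theorem mul_mem_filt {m k : ℕ} {a b : A} (ha : a ∈ filt K x m) (hb : b ∈ filt K x k) :
    a * b ∈ filt K x (m + k) := by
  have h : filt K x m * filt K x k ≤ filt K x (m + k) := by
    rw [filt, filt, Submodule.span_mul_span, Submodule.span_le]
    rintro _ ⟨_, ⟨l, hl, rfl⟩, _, ⟨l', hl', rfl⟩, rfl⟩
    refine Submodule.subset_span ⟨l ++ l', by simp; omega, by simp⟩
  exact h (Submodule.mul_mem_mul ha hb)

theorem span_le_filt_one : Submodule.span K (Set.range x) ≤ filt K x 1 := by
  rw [Submodule.span_le]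
  rintro _ ⟨i, rfl⟩
  exact Submodule.subset_span ⟨[i], by simp, by simp⟩

/-- Swapping two adjacent factors costs a commutator, which is a combination of single generators
and so makes the product one factor shorter. A permutation is a chain of such swaps. -/
theorem prod_sub_prod_mem_filt
    (hx : ∀ i j, x i * x j - x j * x i ∈ Submodule.span K (Set.range x))
    {l l' : List (Fin N)} (h : l.Perm l') :
    ∀ m, l.length = m + 1 → (l.map x).prod - (l'.map x).prod ∈ filt K x m := by
  induction h with
  | nil => simp
  | @cons a l l' hl ih =>
    intro m hm
    have hlen : l.length = m := by simpa using hm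
    rcases m with _ | m
    · have h0 : l = [] := List.length_eq_zero_iff.mp hlen
      subst h0
      rw [List.nil_perm.mp hl]
      simp
    · rw [List.map_cons, List.map_cons, List.prod_cons, List.prod_cons, ← mul_sub, add_comm m]
      exact mul_mem_filt x (span_le_filt_one x (Submodule.subset_span ⟨a, rfl⟩)) (ih m hlen)
  | swap a b l =>
    intro m hm
    have hlen : m = 1 + l.length := by simp at hm; omega
    have e : ((b :: a :: l).map x).prod - ((a :: b :: l).map x).prod =
        (x b * x a - x a * x b) * (l.map x).prod := by
      simp only [List.map_cons, List.prod_cons, sub_mul, mul_assoc]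
    rw [e, hlen]
    exact mul_mem_filt x (span_le_filt_one x (hx b a)) (prod_mem_filt x le_rfl)
  | trans h₁ _ ih₁ ih₂ =>
    intro m hm
    rw [← sub_add_sub_cancel]
    exact Submodule.add_mem _ (ih₁ m hm) (ih₂ m (h₁.length_eq ▸ hm))

/-- The ordered monomial with exponents `a`. -/
def mon (a : Fin N → ℕ) : A := (List.ofFn fun i => x i ^ a i).prod

theorem prod_map_flatten_ofFn (a : Fin N → ℕ) :
    (((List.ofFn fun i => List.replicate (a i) i).flatten).map x).prod = mon x a := by
  rw [List.map_flatten, List.prod_flatten, mon, List.map_map, List.map_ofFn]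
  congr 1
  congr 1
  funext i
  simp

theorem perm_flatten_count (l : List (Fin N)) :
    l.Perm (List.ofFn fun i => List.replicate (l.count i) i).flatten := by
  rw [List.perm_iff_count]
  intro a
  rw [List.count_flatten, List.map_ofFn, List.sum_ofFn]
  simp [List.count_replicate, Finset.sum_ite_eq']

/-- Induction on the length, reordering modulo shorter products. Either every index occurs fewer
than `p` times and sorting gives an allowed monomial, or `p` equal factors can be collected and
replaced by a combination of single generators, which shortens the product because `p ≥ 2`. -/
theorem prod_mem_span_mon {p : ℕ} (hp : 2 ≤ p)
    (hx : ∀ i j, x i * x j - x j * x i ∈ Submodule.span K (Set.range x))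
    (hxp : ∀ i, x i ^ p ∈ Submodule.span K (Set.range x)) (m : ℕ) :
    ∀ l : List (Fin N), l.length ≤ m →
      (l.map x).prod ∈ Submodule.span K (Set.range fun a : Fin N → Fin p => mon x fun i => a i) := by
  induction m with
  | zero =>
    intro l hl
    have h0 : l = [] := List.length_eq_zero_iff.mp (by omega)
    subst h0
    refine Submodule.subset_span ⟨fun _ => ⟨0, by omega⟩, ?_⟩
    simp [mon]
  | succ m ih =>
    intro l hl
    have ih' : filt K x m ≤
        Submodule.span K (Set.range fun a : Fin N → Fin p => mon x fun i => a i) := by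
      rw [filt, Submodule.span_le]
      rintro _ ⟨l, hl, rfl⟩
      exact ih l hl
    rcases Nat.lt_or_ge l.length (m + 1) with hl' | hl'
    · exact ih l (by omega)
    have hlen : l.length = m + 1 := le_antisymm hl hl'
    suffices h : ∃ l', l.Perm l' ∧ (l'.map x).prod ∈
        Submodule.span K (Set.range fun a : Fin N → Fin p => mon x fun i => a i) by
      obtain ⟨l', hll', hl'⟩ := h
      have := Submodule.add_mem _ (ih' (prod_sub_prod_mem_filt x hx hll' m hlen)) hl'
      rwa [sub_add_cancel] at this
    by_cases hc : ∀ i, l.count i < p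
    · refine ⟨_, perm_flatten_count l, ?_⟩
      rw [prod_map_flatten_ofFn]
      exact Submodule.subset_span ⟨fun i => ⟨l.count i, hc i⟩, rfl⟩
    · push Not at hc
      obtain ⟨i, hi⟩ := hc
      have hl'' : l.Perm (List.replicate p i ++ l.diff (List.replicate p i)) := by
        refine (List.subperm_append_diff_self_of_count_le fun j hj => ?_).symm
        rw [List.eq_of_mem_replicate hj, List.count_replicate_self]
        exact hi
      have hlen' := hl''.length_eq
      simp only [List.length_append, List.length_replicate] at hlen'
      refine ⟨_, hl'', ih' ?_⟩
      rw [List.map_append, List.prod_append, List.map_replicate, List.prod_replicate]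
      exact filt_mono x (show 1 + (l.diff (List.replicate p i)).length ≤ m by omega)
        (mul_mem_filt x (span_le_filt_one x (hxp i)) (prod_mem_filt x le_rfl))

theorem span_mon_eq_top {p : ℕ} (hp : 2 ≤ p)
    (hx : ∀ i j, x i * x j - x j * x i ∈ Submodule.span K (Set.range x))
    (hxp : ∀ i, x i ^ p ∈ Submodule.span K (Set.range x))
    (hgen : Algebra.adjoin K (Set.range x) = ⊤) :
    Submodule.span K (Set.range fun a : Fin N → Fin p => mon x fun i => a i) = ⊤ := by
  rw [eq_top_iff, ← Algebra.top_toSubmodule, ← hgen, Algebra.adjoin_eq_span, Submodule.span_le]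
  intro y hy
  obtain ⟨l, rfl⟩ : ∃ l : List (Fin N), (l.map x).prod = y := by
    induction hy using Submonoid.closure_induction with
    | mem y hy => obtain ⟨i, rfl⟩ := hy; exact ⟨[i], by simp⟩
    | one => exact ⟨[], rfl⟩
    | mul y z _ _ hy hz =>
      obtain ⟨l, rfl⟩ := hy
      obtain ⟨l', rfl⟩ := hz
      exact ⟨l ++ l', by simp⟩
  exact prod_mem_span_mon x hp hx hxp _ l le_rfl

end Span

/-! ### Independence of ordered monomials through the coproduct -/

section Independence

variable {K A : Type*} [Field K] [Ring A] [Algebra K A] {N : ℕ} (x : Fin N → A)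

/-- The divided power `y^k / k!`. -/
def dp (K : Type*) {A : Type*} [Field K] [Ring A] [Algebra K A] (y : A) (k : ℕ) : A :=
  ((k.factorial : K)⁻¹) • y ^ k

/-- The ordered monomial with divided exponents `a`. -/
def dpMon (K : Type*) {A : Type*} [Field K] [Ring A] [Algebra K A] {N : ℕ} (x : Fin N → A)
    (a : Fin N → ℕ) : A := (List.ofFn fun i => dp K (x i) (a i)).prod

theorem dpMon_eq_smul (a : Fin N → ℕ) :
    dpMon K x a = (∏ i, ((a i).factorial : K)⁻¹) • mon x a := by
  have := (MultilinearMap.mkPiAlgebraFin K N A).map_smul_univ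
    (fun i => ((a i).factorial : K)⁻¹) (fun i => x i ^ a i)
  simpa [dpMon, mon, dp] using this

theorem factorial_ne_zero_of_lt (p : ℕ) [Fact p.Prime] [CharP K p] {k : ℕ} (hk : k < p) :
    (k.factorial : K) ≠ 0 := by
  rw [Ne, CharP.cast_eq_zero_iff K p, (Fact.out : p.Prime).dvd_factorial]
  omega

theorem list_prod_tmul (f g : Fin N → A) :
    (List.ofFn fun i => f i ⊗ₜ[K] g i).prod = (List.ofFn f).prod ⊗ₜ[K] (List.ofFn g).prod := by
  induction N with
  | zero => simp [Algebra.TensorProduct.one_def]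
  | succ N ih =>
    rw [List.ofFn_succ, List.ofFn_succ, List.ofFn_succ, List.prod_cons, List.prod_cons,
      List.prod_cons, ih, Algebra.TensorProduct.tmul_mul_tmul]

variable (p : ℕ) [Fact p.Prime] [CharP K p] (Δ : A →ₐ[K] A ⊗[K] A)

/-- Dividing by `k!` absorbs the binomial coefficients, so all coefficients of the coproduct become
`1`; the factorials are invertible because `k < p`. -/
theorem comul_dp {y : A} (hy : Δ y = y ⊗ₜ 1 + 1 ⊗ₜ y) {k : ℕ} (hk : k < p) :
    Δ (dp K y k) = ∑ j ∈ Finset.HasAntidiagonal.antidiagonal k, dp K y j.1 ⊗ₜ[K] dp K y j.2 := by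
  have hcomm : Commute (y ⊗ₜ[K] (1 : A)) ((1 : A) ⊗ₜ[K] y) := by
    simp [Commute, SemiconjBy]
  rw [dp, map_smul, map_pow, hy, hcomm.add_pow', Finset.smul_sum]
  refine Finset.sum_congr rfl fun j hj => ?_
  rw [Finset.HasAntidiagonal.mem_antidiagonal] at hj
  rw [dp, dp, TensorProduct.smul_tmul_smul, Algebra.TensorProduct.tmul_pow, one_pow,
    Algebra.TensorProduct.tmul_pow, one_pow, Algebra.TensorProduct.tmul_mul_tmul, one_mul, mul_one,
    ← Nat.cast_smul_eq_nsmul K, smul_smul]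
  congr 1
  have h1 : (k.choose j.1 : K) * j.1.factorial * j.2.factorial = k.factorial := by
    have := Nat.choose_mul_factorial_mul_factorial (n := k) (k := j.1) (by omega)
    rw [show k - j.1 = j.2 by omega] at this
    rw [← this]
    push_cast
    rfl
  have hk0 := factorial_ne_zero_of_lt (K := K) p hk
  have hj1 := factorial_ne_zero_of_lt (K := K) p (show j.1 < p by omega)
  have hj2 := factorial_ne_zero_of_lt (K := K) p (show j.2 < p by omega)
  field_simp
  linear_combination h1

theorem comul_dpMon (hΔ : ∀ i, Δ (x i) = x i ⊗ₜ 1 + 1 ⊗ₜ x i) {a : Fin N → ℕ}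
    (ha : ∀ i, a i < p) :
    Δ (dpMon K x a) = ∑ r ∈ Fintype.piFinset fun i => Finset.HasAntidiagonal.antidiagonal (a i),
      dpMon K x (fun i => (r i).1) ⊗ₜ[K] dpMon K x (fun i => (r i).2) := by
  have h := (MultilinearMap.mkPiAlgebraFin K N (A ⊗[K] A)).map_sum_finset
    (fun i (j : ℕ × ℕ) => dp K (x i) j.1 ⊗ₜ[K] dp K (x i) j.2)
    (fun i => Finset.HasAntidiagonal.antidiagonal (a i))
  simp only [MultilinearMap.mkPiAlgebraFin_apply, list_prod_tmul] at h
  rw [dpMon, map_list_prod, List.map_ofFn]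
  simp only [dpMon]
  rw [← h]
  congr 2
  funext i
  exact comul_dp p Δ (hΔ i) (ha i)

/-- The exponents less than `p` of total degree at most `d`. -/
def exps (N p d : ℕ) : Finset (Fin N → ℕ) :=
  (Fintype.piFinset fun _ => Finset.range p).filter fun a => ∑ i, a i ≤ d

theorem mem_exps {N p d : ℕ} {a : Fin N → ℕ} :
    a ∈ exps N p d ↔ (∀ i, a i < p) ∧ ∑ i, a i ≤ d := by
  simp [exps]

/-- Independence in degree at most `d` provides coordinate functionals `λ_b` on `A`. Apply `Δ` to
the relation and then `λ_{b₁} ⊗ λ_{b₂}`: the coproduct of a monomial runs over the splittings of its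
exponent, so only the exponent `b₁ + b₂` survives, with coefficient `1`. -/
theorem coeff_eq_zero_of_two_le (hΔ : ∀ i, Δ (x i) = x i ⊗ₜ 1 + 1 ⊗ₜ x i) {d : ℕ}
    (hd : LinearIndepOn K (dpMon K x) (exps N p d)) {c : (Fin N → ℕ) → K}
    (hc : ∑ a ∈ exps N p (d + 1), c a • dpMon K x a = 0) {b₁ b₂ : Fin N → ℕ}
    (h1 : 1 ≤ ∑ i, b₁ i) (h2 : 1 ≤ ∑ i, b₂ i) (hb : b₁ + b₂ ∈ exps N p (d + 1)) :
    c (b₁ + b₂) = 0 := by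
  classical
  obtain ⟨g, hg⟩ := LinearMap.exists_leftInverse_of_injective _
    (LinearMap.ker_eq_bot.mpr (show Function.Injective (Finsupp.linearCombination K
      fun a : (exps N p d : Set (Fin N → ℕ)) => dpMon K x a) from hd))
  have hg' : ∀ a : (exps N p d : Set (Fin N → ℕ)), g (dpMon K x a) = Finsupp.single a 1 := by
    intro a
    have := LinearMap.congr_fun hg (Finsupp.single a 1)
    simpa using this
  obtain ⟨hbp, hbd⟩ := mem_exps.mp hb
  simp only [Pi.add_apply, Finset.sum_add_distrib] at hbp hbd
  have hb1 : b₁ ∈ exps N p d := mem_exps.mpr ⟨fun i => by have := hbp i; omega, by omega⟩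
  have hb2 : b₂ ∈ exps N p d := mem_exps.mpr ⟨fun i => by have := hbp i; omega, by omega⟩
  have h0 : (0 : Fin N → ℕ) ∈ exps N p d :=
    mem_exps.mpr ⟨fun _ => (Fact.out : p.Prime).pos, by simp⟩
  let lam (b : Fin N → ℕ) (hb : b ∈ exps N p d) : A →ₗ[K] K := Finsupp.lapply ⟨b, hb⟩ ∘ₗ g
  have hlam : ∀ b hb a, a ∈ exps N p d → lam b hb (dpMon K x a) = if a = b then 1 else 0 := by
    intro b hb a ha
    change (g (dpMon K x a)) ⟨b, hb⟩ = _
    rw [hg' ⟨a, ha⟩, Finsupp.single_apply]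
    simp
  -- A factor of degree `d + 1` lies outside the range where the functionals are known. Its partner
  -- is then the monomial `1`, on which the other functional vanishes because `b₁` and `b₂` are
  -- nonzero.
  have hpair : ∀ r₁ r₂ : Fin N → ℕ, r₁ + r₂ ∈ exps N p (d + 1) →
      lam b₁ hb1 (dpMon K x r₁) * lam b₂ hb2 (dpMon K x r₂) =
        if r₁ = b₁ ∧ r₂ = b₂ then 1 else 0 := by
    intro r₁ r₂ hr
    obtain ⟨hrp, hrd⟩ := mem_exps.mp hr
    simp only [Pi.add_apply, Finset.sum_add_distrib] at hrp hrd
    by_cases hr1 : r₁ ∈ exps N p d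
    · by_cases hr2 : r₂ ∈ exps N p d
      · rw [hlam _ _ _ hr1, hlam _ _ _ hr2]
        split_ifs <;> simp_all
      · have hs : ∑ i, r₁ i = 0 := by
          by_contra hne
          exact hr2 (mem_exps.mpr ⟨fun i => by have := hrp i; omega, by omega⟩)
        have hne : r₁ ≠ b₁ := by rintro rfl; omega
        rw [hlam _ _ _ hr1, if_neg hne, zero_mul, if_neg fun h => hne h.1]
    · have hs : ∑ i, r₂ i = 0 := by
        by_contra hne
        exact hr1 (mem_exps.mpr ⟨fun i => by have := hrp i; omega, by omega⟩)
      have hne : r₂ ≠ b₂ := by rintro rfl; omega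
      have hr2 : r₂ ∈ exps N p d := mem_exps.mpr ⟨fun i => by have := hrp i; omega, by omega⟩
      rw [hlam _ _ _ hr2, if_neg hne, mul_zero, if_neg fun h => hne h.2]
  have hap := congrArg (LinearMap.mul' K K ∘ₗ TensorProduct.map (lam b₁ hb1) (lam b₂ hb2))
    (congrArg Δ hc)
  rw [map_zero, map_zero, map_sum, map_sum] at hap
  rw [Finset.sum_eq_single (b₁ + b₂)] at hap
  · rw [map_smul, comul_dpMon x p Δ hΔ (mem_exps.mp hb).1, map_smul, map_sum,
      Finset.sum_eq_single (fun i => (b₁ i, b₂ i))] at hap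
    · simp only [LinearMap.comp_apply, TensorProduct.map_tmul, LinearMap.mul'_apply] at hap
      rw [hpair b₁ b₂ hb, if_pos ⟨rfl, rfl⟩, smul_eq_mul, mul_one] at hap
      exact hap
    · intro r hr hne
      have hr' : (fun i => (r i).1) + (fun i => (r i).2) = b₁ + b₂ := by
        funext i
        simpa using Fintype.mem_piFinset.mp hr i
      simp only [LinearMap.comp_apply, TensorProduct.map_tmul, LinearMap.mul'_apply]
      rw [hpair _ _ (hr' ▸ hb), if_neg]
      rintro ⟨rfl, rfl⟩
      exact hne rfl
    · intro h
      exact absurd (Fintype.mem_piFinset.mpr fun i => by simp) h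
  · intro a ha hne
    rw [map_smul, comul_dpMon x p Δ hΔ (mem_exps.mp ha).1, map_smul, map_sum,
      Finset.sum_eq_zero, smul_zero]
    intro r hr
    have hr' : (fun i => (r i).1) + (fun i => (r i).2) = a := by
      funext i
      simpa using Fintype.mem_piFinset.mp hr i
    simp only [LinearMap.comp_apply, TensorProduct.map_tmul, LinearMap.mul'_apply]
    rw [hpair _ _ (hr' ▸ ha), if_neg]
    rintro ⟨h, h'⟩
    rw [h, h'] at hr'
    exact hne hr'.symm
  · intro h
    exact absurd hb h

theorem dpMon_zero : dpMon K x 0 = 1 := by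
  simp [dpMon, dp]

theorem dpMon_single (i : Fin N) : dpMon K x (Pi.single i 1) = x i := by
  have h : ∀ {M : ℕ} (y : Fin M → A) (i : Fin M), dpMon K y (Pi.single i 1) = y i := by
    intro M
    induction M with
    | zero => intro y i; exact i.elim0
    | succ M ih =>
      intro y i
      rw [dpMon, List.ofFn_succ, List.prod_cons]
      refine Fin.cases ?_ (fun j => ?_) i
      · have hz : (fun l : Fin M => dp K (y l.succ)
            ((Pi.single (0 : Fin (M + 1)) 1 : Fin (M + 1) → ℕ) l.succ)) = fun _ => 1 := by
          funext l; simp [dp]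
        rw [hz]
        simp [dp]
      · have hz : (fun l : Fin M => dp K (y l.succ)
            ((Pi.single j.succ 1 : Fin (M + 1) → ℕ) l.succ)) =
            fun l => dp K (y l.succ) ((Pi.single j 1 : Fin M → ℕ) l) := by
          funext l
          congr 1
          by_cases hl : l = j <;> simp [hl]
        have := ih (fun l => y l.succ) j
        rw [dpMon] at this
        rw [hz, this]
        simp [dp, (Fin.succ_ne_zero j).symm]
  exact h x i

theorem eq_zero_or_single {a : Fin N → ℕ} (ha : ∑ i, a i ≤ 1) :
    a = 0 ∨ ∃ i, a = Pi.single i 1 := by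
  by_cases h : a = 0
  · exact Or.inl h
  · right
    obtain ⟨i, hi⟩ := Function.ne_iff.mp h
    refine ⟨i, funext fun j => ?_⟩
    have h1 : ∑ i, a i = a i + ∑ j ∈ Finset.univ.erase i, a j :=
      (Finset.add_sum_erase _ _ (Finset.mem_univ i)).symm
    have hi' : 1 ≤ a i := Nat.one_le_iff_ne_zero.mpr hi
    by_cases hj : j = i
    · subst hj; simp; omega
    · have h2 : a j ≤ ∑ j ∈ Finset.univ.erase i, a j :=
        Finset.single_le_sum (f := a) (fun _ _ => Nat.zero_le _)
          (Finset.mem_erase.mpr ⟨hj, Finset.mem_univ j⟩)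
      simp [hj]; omega

/-- Induction on the degree. An exponent of degree at least `2` splits as `ε_i` plus a nonzero rest,
so its coefficient vanishes by `coeff_eq_zero_of_two_le`. Then `ε` isolates the constant term, and
what remains is a linear relation among the generators. -/
theorem linearIndepOn_dpMon (hΔ : ∀ i, Δ (x i) = x i ⊗ₜ 1 + 1 ⊗ₜ x i)
    (hli : LinearIndependent K x) (ε : A →ₐ[K] K) (hε : ∀ i, ε (x i) = 0) (d : ℕ) :
    LinearIndepOn K (dpMon K x) (exps N p d) := by
  classical
  have low : ∀ (d : ℕ) (c : (Fin N → ℕ) → K), ∑ a ∈ exps N p d, c a • dpMon K x a = 0 →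
      (∀ a ∈ exps N p d, 2 ≤ ∑ i, a i → c a = 0) → ∀ a ∈ exps N p d, c a = 0 := by
    intro d c hc h2
    have h0 : (0 : Fin N → ℕ) ∈ exps N p d :=
      mem_exps.mpr ⟨fun _ => (Fact.out : p.Prime).pos, by simp⟩
    have hc0 : c 0 = 0 := by
      have := congrArg ε hc
      rw [map_sum, map_zero, Finset.sum_eq_single 0] at this
      · simpa [dpMon_zero] using this
      · intro a ha hne
        by_cases ha2 : 2 ≤ ∑ i, a i
        · rw [h2 a ha ha2, zero_smul, map_zero]
        · rcases eq_zero_or_single (show ∑ i, a i ≤ 1 by omega) with h | ⟨i, rfl⟩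
          · exact absurd h hne
          · rw [dpMon_single, map_smul, hε, smul_zero]
      · exact fun h => absurd h0 h
    rcases Nat.eq_zero_or_pos d with rfl | hd
    · intro a ha
      rcases eq_zero_or_single (le_trans (mem_exps.mp ha).2 zero_le_one) with rfl | ⟨i, rfl⟩
      · exact hc0
      · have := (mem_exps.mp ha).2
        simp at this
    have hs : ∑ i, c (Pi.single i 1) • x i = 0 := by
      rw [← hc]
      have hinj : Function.Injective fun i : Fin N => (Pi.single i 1 : Fin N → ℕ) := by
        intro i j hij
        by_contra hne
        have := congrFun hij i
        simp [hne] at this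
      have hmem : ∀ i : Fin N, (Pi.single i 1 : Fin N → ℕ) ∈ exps N p d := by
        intro i
        refine mem_exps.mpr ⟨fun j => ?_, by simpa using Nat.succ_le_of_lt hd⟩
        have := (Fact.out : p.Prime).one_lt
        by_cases hj : j = i
        · subst hj; simpa
        · simp [hj]; omega
      rw [← Finset.sum_subset (s₁ := Finset.univ.image fun i : Fin N => (Pi.single i 1 : Fin N → ℕ)),
        Finset.sum_image hinj.injOn]
      · simp only [dpMon_single]
      · intro a ha
        obtain ⟨i, _, rfl⟩ := Finset.mem_image.mp ha
        exact hmem i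
      · intro a ha hni
        by_cases ha2 : 2 ≤ ∑ i, a i
        · rw [h2 a ha ha2, zero_smul]
        · rcases eq_zero_or_single (show ∑ i, a i ≤ 1 by omega) with rfl | ⟨i, rfl⟩
          · rw [hc0, zero_smul]
          · exact absurd (Finset.mem_image.mpr ⟨i, Finset.mem_univ i, rfl⟩) hni
    intro a ha
    by_cases ha2 : 2 ≤ ∑ i, a i
    · exact h2 a ha ha2
    · rcases eq_zero_or_single (show ∑ i, a i ≤ 1 by omega) with rfl | ⟨i, rfl⟩
      · exact hc0
      · exact Fintype.linearIndependent_iff.mp hli _ hs i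
  induction d with
  | zero =>
    rw [linearIndepOn_finset_iff]
    intro c hc
    exact low 0 c hc fun a ha h => by have := (mem_exps.mp ha).2; omega
  | succ d ih =>
    rw [linearIndepOn_finset_iff]
    intro c hc
    refine low (d + 1) c hc fun a ha h => ?_
    obtain ⟨i, hi⟩ : ∃ i, a i ≠ 0 := by
      by_contra hne
      push Not at hne
      simp [hne] at h
    have hle : (Pi.single i 1 : Fin N → ℕ) ≤ a := by
      intro j
      by_cases hj : j = i
      · subst hj; simp; omega
      · simp [hj]
    have hdec : Pi.single i 1 + (a - Pi.single i 1) = a := add_tsub_cancel_of_le hle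
    have hsum : ∑ j, a j = 1 + ∑ j, (a - Pi.single i 1 : Fin N → ℕ) j := by
      conv_lhs => rw [← hdec]
      simp only [Pi.add_apply, Finset.sum_add_distrib, Finset.sum_pi_single', Finset.mem_univ,
        if_true]
    rw [← hdec]
    exact coeff_eq_zero_of_two_le x p Δ hΔ ih hc (by simp) (by omega) (by rwa [hdec])

end Independence

/-- If `A` is generated by linearly independent primitive elements `x_1, …, x_N` whose span is
closed under commutators and `p`-th powers, then the ordered monomials with exponents less than
`p` form a basis of `A`. -/
noncomputable def basis {K A : Type*} [Field K] [Ring A] [Algebra K A] {N : ℕ} (x : Fin N → A)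
    (p : ℕ) [Fact p.Prime] [CharP K p]
    (hx : ∀ i j, x i * x j - x j * x i ∈ Submodule.span K (Set.range x))
    (hxp : ∀ i, x i ^ p ∈ Submodule.span K (Set.range x))
    (hgen : Algebra.adjoin K (Set.range x) = ⊤) (Δ : A →ₐ[K] A ⊗[K] A)
    (hΔ : ∀ i, Δ (x i) = x i ⊗ₜ 1 + 1 ⊗ₜ x i)
    (hli : LinearIndependent K x) (ε : A →ₐ[K] K) (hε : ∀ i, ε (x i) = 0) :
    Module.Basis (Fin N → Fin p) K A :=
  Module.Basis.mk (v := fun a : Fin N → Fin p => mon x fun i => a i)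
    (by
      -- The bound `N * p` exceeds the degree of every exponent with entries below `p`, so the
      -- degree restriction disappears. Plain monomials differ from divided ones by the unit `∏ (a
      -- i)!`.
      have h := linearIndepOn_dpMon x p Δ hΔ hli ε hε (N * p)
      have hmem : ∀ a : Fin N → Fin p, (fun i => (a i : ℕ)) ∈ exps N p (N * p) := fun a =>
        mem_exps.mpr ⟨fun i => (a i).isLt, by
          calc ∑ i, (a i : ℕ) ≤ ∑ _i : Fin N, p := Finset.sum_le_sum fun i _ => (a i).isLt.le
            _ = N * p := by simp⟩
      have h' := LinearIndependent.comp h (fun a : Fin N → Fin p => ⟨_, hmem a⟩) (by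
        intro a b hab
        funext i
        exact Fin.ext (congrFun (Subtype.ext_iff.mp hab) i))
      have hne : ∀ a : Fin N → Fin p, (∏ i, ((a i : ℕ).factorial : K)) ≠ 0 := fun a =>
        Finset.prod_ne_zero_iff.mpr fun i _ => factorial_ne_zero_of_lt p (a i).isLt
      convert h'.units_smul (fun a => Units.mk0 _ (hne a)) using 1
      funext a
      change mon x _ = (∏ i, ((a i : ℕ).factorial : K)) • dpMon K x _
      rw [dpMon_eq_smul, smul_smul, Finset.prod_inv_distrib, mul_inv_cancel₀ (hne a), one_smul])
    (span_mon_eq_top x (Fact.out : p.Prime).two_le hx hxp hgen).ge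

end OrderedMonomials

/-! ### Idempotents and powers modulo `p` -/

namespace ModP

/-! ### Spectral projections of an element with `y ^ p = y` -/

section Scalars

theorem add_pow_char_algebra (R : Type*) [CommRing R] {A : Type*} [Ring A] [Algebra R A] (p : ℕ)
    [Fact p.Prime] [CharP R p] {x y : A} (h : Commute x y) : (x + y) ^ p = x ^ p + y ^ p := by
  rcases subsingleton_or_nontrivial A with _ | _
  · exact Subsingleton.elim _ _
  · have h0 : (p : A) = 0 := by
      rw [← map_natCast (algebraMap R A), CharP.cast_eq_zero, map_zero]
    have := (CharP.charP_iff_prime_eq_zero (Fact.out : p.Prime)).mpr h0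
    exact add_pow_char_of_commute p h

theorem sub_pow_char_algebra (R : Type*) [CommRing R] {A : Type*} [Ring A] [Algebra R A] (p : ℕ)
    [Fact p.Prime] [CharP R p] (hp : Odd p) {x y : A} (h : Commute x y) :
    (x - y) ^ p = x ^ p - y ^ p := by
  rw [sub_eq_add_neg, add_pow_char_algebra R p h.neg_right, hp.neg_pow, ← sub_eq_add_neg]

variable {R : Type*} [CommRing R] {A : Type*} [Ring A] [Algebra R A] (p : ℕ) [Fact p.Prime]
  [CharP R p]

variable (R) in
/-- The scalar of `R` given by a residue class modulo `p`. -/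
def sc : ZMod p →+* R := ZMod.castHom (dvd_refl p) R

theorem sc_val (j : ZMod p) : ((j.val : ℕ) : R) = sc R p j := by
  rw [← map_natCast (sc R p), ZMod.natCast_val, ZMod.cast_id', id]

theorem sc_pow_pred {j : ZMod p} (hj : j ≠ 0) : sc R p j ^ (p - 1) = 1 := by
  rw [← map_pow, ZMod.pow_card_sub_one_eq_one hj, map_one]

/-- For `y` with `y ^ p = y`, the projection to the eigenvalue `j` of `y`. -/
def proj (R : Type*) [CommRing R] {A : Type*} [Ring A] [Algebra R A] (p : ℕ) [Fact p.Prime]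
    [CharP R p] (y : A) (j : ZMod p) : A := 1 - (y - algebraMap R A (sc R p j)) ^ (p - 1)

theorem map_proj {B : Type*} [Ring B] [Algebra R B] (f : A →ₐ[R] B) (y : A) (j : ZMod p) :
    f (proj R p y j) = proj R p (f y) j := by
  simp [proj]

/-- On `z` the element `y - j` acts as `i - j`, whose `(p-1)`-th power is `1` by Fermat unless `i =
j`. -/
theorem proj_mul_of_eigen {y z : A} {i : ZMod p} (h : y * z = sc R p i • z) (j : ZMod p) :
    proj R p y j * z = if i = j then z else 0 := by
  have h1 : (y - algebraMap R A (sc R p j)) * z = sc R p (i - j) • z := by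
    rw [sub_mul, h, ← Algebra.smul_def, map_sub, sub_smul]
  have h2 : ∀ m : ℕ, (y - algebraMap R A (sc R p j)) ^ m * z = sc R p (i - j) ^ m • z := by
    intro m
    induction m with
    | zero => simp
    | succ m ih => rw [pow_succ, mul_assoc, h1, mul_smul_comm, ih, smul_smul, pow_succ']
  rw [proj, sub_mul, one_mul, h2]
  have hp : p - 1 ≠ 0 := Nat.sub_ne_zero_of_lt (Fact.out : p.Prime).one_lt
  split_ifs with hij
  · simp [hij, hp]
  · rw [sc_pow_pred p (sub_ne_zero.mpr hij), one_smul, sub_self]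

/-- The power sums `∑ j^r` over `F_p` vanish for `r < p - 1` and equal `-1` for `r = p - 1`. Hence
`∑ (y - j)^(p-1) = -1`, while the `p` summands `1` add up to zero. Nothing about `y ^ p` is needed.
-/
theorem sum_proj (hp : Odd p) (y : A) : ∑ j, proj R p y j = 1 := by
  have hp1 : Even (p - 1) := Nat.Odd.sub_odd hp odd_one
  have hcard : (p : A) = 0 := by
    rw [← map_natCast (algebraMap R A), CharP.cast_eq_zero, map_zero]
  have hpow : ∀ r ∈ Finset.range p, ∑ j : ZMod p, j ^ r = if r = p - 1 then -1 else 0 := by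
    intro r hr
    rw [Finset.mem_range] at hr
    split_ifs with h
    · rw [h, ← Finset.sum_erase_add _ _ (Finset.mem_univ (0 : ZMod p)),
        Finset.sum_congr rfl (g := fun _ => 1)]
      · have : p - 1 ≠ 0 := Nat.sub_ne_zero_of_lt (Fact.out : p.Prime).one_lt
        simp [this, ZMod.card, Nat.cast_sub (Fact.out : p.Prime).one_le]
      · intro j hj
        exact ZMod.pow_card_sub_one_eq_one (by simpa using hj)
    · exact FiniteField.sum_pow_lt_card_sub_one (ZMod p) r (by rw [ZMod.card]; omega)
  have hexp : ∀ j : ZMod p, (y - algebraMap R A (sc R p j)) ^ (p - 1) =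
      ∑ r ∈ Finset.range p, ((-1) ^ r * sc R p (j ^ r) * ((p - 1).choose r : R)) • y ^ (p - 1 - r) := by
    intro j
    have hc : Commute (-algebraMap R A (sc R p j)) y := Commute.neg_left (Algebra.commutes _ _)
    rw [sub_eq_neg_add, hc.add_pow, Nat.sub_add_cancel (Fact.out : p.Prime).one_le]
    refine Finset.sum_congr rfl fun r _ => ?_
    rw [Algebra.smul_def, map_mul, map_mul, map_pow (sc R p), map_pow (algebraMap R A) (sc R p j),
      map_pow (algebraMap R A) (-1), map_natCast, map_neg, map_one, neg_pow (algebraMap R A _),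
      mul_assoc _ (y ^ _), mul_assoc _ ((p - 1).choose r : A), (Nat.cast_commute _ _).eq]
  simp only [proj, Finset.sum_sub_distrib, hexp]
  rw [Finset.sum_comm, Finset.sum_eq_single (p - 1)]
  · simp only [Nat.choose_self, Nat.cast_one, mul_one, Nat.sub_self, pow_zero, hp1.neg_one_pow,
      one_mul, ← Finset.sum_smul, ← map_sum]
    rw [hpow _ (by simp [(Fact.out : p.Prime).pos]), if_pos rfl]
    simp [ZMod.card, hcard]
  · intro r hr hne
    rw [← Finset.sum_smul, ← Finset.sum_mul, ← Finset.mul_sum, ← map_sum, hpow r hr, if_neg hne]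
    simp
  · intro h
    exact absurd (Finset.mem_range.mpr (by have := (Fact.out : p.Prime).pos; omega)) h

/-- By Frobenius `(y - j)(1 - (y - j)^(p-1)) = (y - j) - (y^p - j^p)`, which vanishes because `y^p =
y` and `j^p = j`. -/
theorem mul_proj (hp : Odd p) {y : A} (hy : y ^ p = y) (j : ZMod p) :
    y * proj R p y j = sc R p j • proj R p y j := by
  have hc : Commute y (algebraMap R A (sc R p j)) := (Algebra.commutes _ _).symm
  have h : (y - algebraMap R A (sc R p j)) * proj R p y j = 0 := by
    rw [proj, mul_sub, mul_one, ← pow_succ', Nat.sub_add_cancel (Fact.out : p.Prime).one_le,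
      sub_pow_char_algebra R p hp hc, hy, ← map_pow, ← map_pow, ZMod.pow_card, sub_self]
  rw [sub_mul, sub_eq_zero] at h
  rw [h, Algebra.smul_def]

theorem proj_mul_proj (hp : Odd p) {y : A} (hy : y ^ p = y) (i j : ZMod p) :
    proj R p y i * proj R p y j = if j = i then proj R p y j else 0 :=
  proj_mul_of_eigen p (mul_proj p hp hy j) i

/-- The weight relation says that `x` intertwines `y - j` with `y - (j + m)`, hence also their
powers. -/
theorem proj_mul_weight {y x : A} {m : ZMod p} (h : y * x - x * y = sc R p m • x) (j : ZMod p) :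
    proj R p y (j + m) * x = x * proj R p y j := by
  have h1 : SemiconjBy x (y - algebraMap R A (sc R p j)) (y - algebraMap R A (sc R p (j + m))) := by
    rw [SemiconjBy, mul_sub, sub_mul, map_add, map_add, add_mul,
      ← Algebra.commutes (sc R p j) x, ← Algebra.smul_def (sc R p m), ← h]
    abel
  rw [proj, proj, sub_mul, mul_sub, one_mul, mul_one, (h1.pow_right (p - 1)).eq]

theorem proj_neg (hp : Odd p) (y : A) (j : ZMod p) : proj R p (-y) j = proj R p y (-j) := by
  have hp1 : Even (p - 1) := Nat.Odd.sub_odd hp odd_one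
  rw [proj, proj, ← hp1.neg_pow, map_neg, map_neg]
  congr 2
  abel

end Scalars

/-! ### Exponents modulo `p` -/

section Powers

variable {G : Type*} [Group G] {p : ℕ} [Fact p.Prime]

/-- The power of an element `w` with `w ^ p = 1` to a residue class modulo `p`. -/
def pw (w : G) (j : ZMod p) : G := w ^ j.val

theorem zpow_eq_pw {w : G} (hw : w ^ p = 1) (a : ℤ) : w ^ a = pw w (a : ZMod p) := by
  have h : ((a : ZMod p).val : ℤ) = a % p := ZMod.val_intCast a
  rw [pw, ← zpow_natCast, h]
  conv_lhs => rw [← Int.emod_add_mul_ediv a p, zpow_add, zpow_mul, zpow_natCast, hw, one_zpow,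
    mul_one]

theorem pow_eq_pw {w : G} (hw : w ^ p = 1) (a : ℕ) : w ^ a = pw w (a : ZMod p) := by
  rw [← zpow_natCast, zpow_eq_pw hw, Int.cast_natCast]

theorem pw_add {w : G} (hw : w ^ p = 1) (i j : ZMod p) : pw w (i + j) = pw w i * pw w j := by
  rw [pw.eq_def w i, pw.eq_def w j, ← pow_add, pow_eq_pw hw]
  simp

theorem pw_zero (w : G) : pw w (0 : ZMod p) = 1 := by simp [pw]

theorem pw_one {w : G} (hw : w ^ p = 1) : pw w (1 : ZMod p) = w := by
  rw [← Nat.cast_one, ← pow_eq_pw hw, pow_one]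

end Powers

/-! ### Rising factorials and binomial coefficients modulo `p` -/

section Rising

theorem risingFac_succ_left {A : Type*} [Ring A] (y : A) (m : ℕ) :
    risingFac y (m + 1) = y * risingFac (y + 1) m := by
  induction m with
  | zero => simp [risingFac]
  | succ m ih =>
    rw [risingFac, ih, risingFac, mul_assoc]
    congr 2
    push_cast
    abel

theorem commute_risingFac {A : Type*} [Ring A] {x y : A} (h : Commute x y) (m : ℕ) :
    Commute x (risingFac y m) := by
  induction m with
  | zero => exact Commute.one_right x
  | succ m ih => exact ih.mul_right (h.add_right (Nat.cast_commute m x).symm)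

variable {R : Type*} [CommRing R]

theorem risingFac_neg_add (c : R) (r : ℕ) :
    risingFac (-(c + r)) r = (-1) ^ r * risingFac (c + 1) r := by
  induction r with
  | zero => simp [risingFac]
  | succ r ih =>
    rw [risingFac_succ_left, show -(c + ((r + 1 : ℕ) : R)) + 1 = -(c + r) by push_cast; ring, ih,
      risingFac]
    push_cast
    ring

theorem descFactorial_eq_risingFac (n l : ℕ) :
    (n.descFactorial l : R) = (-1) ^ l * risingFac (-(n : R)) l := by
  induction l with
  | zero => simp [risingFac]
  | succ l ih =>
    rw [Nat.descFactorial_succ, Nat.cast_mul, ih, risingFac]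
    rcases le_or_gt l n with h | h
    · rw [Nat.cast_sub h]; ring
    · have h0 : (-1) ^ l * risingFac (-(n : R)) l = 0 := by
        rw [← ih, Nat.descFactorial_eq_zero_iff_lt.mpr h, Nat.cast_zero]
      linear_combination ((n - l : ℕ) : R) * h0 + (-(n : R) + l) * h0

theorem risingFac_mul_of_eigen {A : Type*} [Ring A] [Algebra R A] {y z : A} {c : R}
    (h : y * z = c • z) (l : ℕ) : risingFac y l * z = risingFac c l • z := by
  induction l with
  | zero => simp [risingFac]
  | succ l ih =>
    have h1 : (y + l) * z = (c + l) • z := by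
      rw [add_mul, h, add_smul, Nat.cast_smul_eq_nsmul, nsmul_eq_mul]
    rw [risingFac, mul_assoc, h1, mul_smul_comm, ih, smul_smul, risingFac, mul_comm]

variable {K : Type*} [Field K] [Algebra K R] {A : Type*} [AddCommGroup A] [Module R A] [Module K A]
  [IsScalarTower K R A]

/-- For `l < p` the factorial `l!` is invertible, so the binomial coefficient depends polynomially
on the residue `j`. This is where the binomial theorem's coefficients become rising factorials and
the `1 / l!` of `divAd` appears. -/
theorem choose_smul_eq (p : ℕ) [Fact p.Prime] [CharP K p] [CharP R p] {l : ℕ} (hl : l < p)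
    (j : ZMod p) (y : A) : (j.val.choose l : R) • y =
      ((-1) ^ l * risingFac (-sc R p j) l) • ((l.factorial : K)⁻¹ • y) := by
  have hy : y = (l.factorial : R) • ((l.factorial : K)⁻¹ • y) := by
    rw [← map_natCast (algebraMap K R), algebraMap_smul, smul_smul,
      mul_inv_cancel₀ (OrderedMonomials.factorial_ne_zero_of_lt p hl), one_smul]
  conv_lhs => rw [hy, smul_smul, mul_comm, ← Nat.cast_mul, ← Nat.descFactorial_eq_factorial_mul_choose,
    descFactorial_eq_risingFac, sc_val]

end Rising

end ModP

/-! ### The twist attached to `[h, e] = e`, `h ^ p = h`, `e ^ p = 0` -/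

/-- Elements `h`, `e` with `[h, e] = e`, `h ^ p = h` and `e ^ p = 0`, and a parameter `t`. -/
structure TwistDatum (R A : Type*) [CommRing R] [Ring A] [Algebra R A] (p : ℕ) where
  h : A
  e : A
  t : R
  odd : Odd p
  h_pow : h ^ p = h
  e_pow : e ^ p = 0
  lie : h * e - e * h = e

namespace TwistDatum

open ModP

set_option linter.unusedSectionVars false

variable {R A : Type*} [CommRing R] [Ring A] [Algebra R A] {p : ℕ} [Fact p.Prime] [CharP R p]
  (T : TwistDatum R A p)

theorem one_add_smul_pow (s : R) : (1 + s • T.e) ^ p = 1 := by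
  rw [add_pow_char_algebra R p (Commute.one_left _), one_pow, smul_pow, T.e_pow, smul_zero,
    add_zero]

theorem one_sub_smul_pow (s : R) : (1 - s • T.e) ^ p = 1 := by
  have := T.one_add_smul_pow (-s)
  rwa [neg_smul, ← sub_eq_add_neg] at this

/-- The unit `1 - t e`. -/
def w : Aˣ := Units.ofPowEqOne (1 - T.t • T.e) p (T.one_sub_smul_pow T.t) (Fact.out : p.Prime).ne_zero

theorem w_val : (T.w : A) = 1 - T.t • T.e := Units.val_ofPowEqOne _ _ _ _

theorem w_pow : T.w ^ p = 1 := Units.ext (by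
  rw [Units.val_pow_eq_pow_val, w_val, one_sub_smul_pow, Units.val_one])

/-- The powers of `1 - t e`. -/
def W (j : ZMod p) : A := ((pw T.w j : Aˣ) : A)

theorem W_add (i j : ZMod p) : T.W (i + j) = T.W i * T.W j := by
  rw [W, pw_add T.w_pow, Units.val_mul]; rfl

theorem W_zero : T.W 0 = 1 := by rw [W, pw_zero, Units.val_one]

theorem W_one : T.W 1 = 1 - T.t • T.e := by rw [W, pw_one T.w_pow, w_val]

theorem W_eq_pow (j : ZMod p) : T.W j = (1 - T.t • T.e) ^ j.val := by
  rw [W, pw, Units.val_pow_eq_pow_val, w_val]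

theorem W_natCast (a : ℕ) : T.W a = (1 - T.t • T.e) ^ a := by
  rw [W, ← pow_eq_pw T.w_pow, Units.val_pow_eq_pow_val, w_val]

theorem zpow_eq_W (a : ℤ) : ((T.w ^ a : Aˣ) : A) = T.W a := by
  rw [W, zpow_eq_pw T.w_pow]

theorem W_mul_neg (j : ZMod p) : T.W j * T.W (-j) = 1 := by
  rw [← W_add, add_neg_cancel, W_zero]

theorem W_neg_mul (j : ZMod p) : T.W (-j) * T.W j = 1 := by
  rw [← W_add, neg_add_cancel, W_zero]

/-- The projection to the eigenvalue `j` of `h`. -/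
def pr (j : ZMod p) : A := proj R p T.h j

theorem sum_pr : ∑ j, T.pr j = 1 := sum_proj p T.odd T.h

theorem pr_mul_pr (i j : ZMod p) : T.pr i * T.pr j = if i = j then T.pr j else 0 := by
  rw [pr, pr, proj_mul_proj p T.odd T.h_pow]
  simp only [eq_comm]

theorem h_mul_pr (j : ZMod p) : T.h * T.pr j = sc R p j • T.pr j := mul_proj p T.odd T.h_pow j

theorem pr_mul_weight {x : A} {m : ZMod p} (hx : T.h * x - x * T.h = sc R p m • x) (j : ZMod p) :
    T.pr j * x = x * T.pr (j - m) := by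
  have := proj_mul_weight p hx (j - m)
  rwa [sub_add_cancel] at this

theorem e_weight : T.h * T.e - T.e * T.h = sc R p 1 • T.e := by rw [T.lie, map_one, one_smul]

theorem pr_mul_e_pow (j : ZMod p) (r : ℕ) : T.pr j * T.e ^ r = T.e ^ r * T.pr (j - r) := by
  induction r generalizing j with
  | zero => simp
  | succ r ih =>
    rw [pow_succ', ← mul_assoc, T.pr_mul_weight T.e_weight, mul_assoc, ih, ← mul_assoc]
    congr 2
    push_cast
    ring

theorem pr_mul_sum (j : ZMod p) (f : ZMod p → A) :
    T.pr j * ∑ i, T.pr i * f i = T.pr j * f j := by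
  rw [Finset.mul_sum, Finset.sum_eq_single j]
  · rw [← mul_assoc, pr_mul_pr, if_pos rfl]
  · intro i _ hij
    rw [← mul_assoc, pr_mul_pr, if_neg (Ne.symm hij), zero_mul]
  · simp

/-- The element `∑ j, π_j (1 + s e) ^ j`. -/
def V (s : R) : A := ∑ j, T.pr j * (1 + s • T.e) ^ j.val

theorem pr_mul_V (s : R) (j : ZMod p) : T.pr j * T.V s = T.pr j * (1 + s • T.e) ^ j.val :=
  T.pr_mul_sum j _

theorem one_add_smul_pow_eq (s : R) (n : ℕ) : (1 + s • T.e) ^ n =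
    ∑ r ∈ Finset.range (n + 1), ((n.choose r : R) * s ^ r) • T.e ^ r := by
  rw [add_comm, (Commute.one_right (s • T.e)).add_pow]
  refine Finset.sum_congr rfl fun r _ => ?_
  rw [one_pow, mul_one, smul_pow, mul_smul, Nat.cast_smul_eq_nsmul, nsmul_eq_mul,
    (Nat.cast_commute _ _).eq]

/-- Moving `e^r` past the projections turns `π_j` into `π_{j-r}`, where `V (-s)` acts as `(1 -
se)^(j-r)`. The sum over `r` is then the binomial expansion of `(se + (1 - se))^j = 1`. -/
theorem V_mul_V_neg (s : R) : T.V s * T.V (-s) = 1 := by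
  have key : ∀ j, T.pr j * (T.V s * T.V (-s)) = T.pr j := by
    intro j
    rw [← mul_assoc, pr_mul_V, one_add_smul_pow_eq, Finset.mul_sum, Finset.sum_mul]
    have hterm : ∀ r ∈ Finset.range (j.val + 1),
        T.pr j * (((j.val.choose r : R) * s ^ r) • T.e ^ r) * T.V (-s) =
          T.pr j * ((s • T.e) ^ r * (1 - s • T.e) ^ (j.val - r) * (j.val.choose r : A)) := by
      intro r hr
      have hrj : r ≤ j.val := Nat.lt_succ_iff.mp (Finset.mem_range.mp hr)
      -- As `r ≤ j.val`, the subtraction of residues does not wrap around.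
      have hval : (j - (r : ZMod p)).val = j.val - r := by
        have hrp : r < p := lt_of_le_of_lt hrj (ZMod.val_lt j)
        rw [ZMod.val_sub (by rwa [ZMod.val_natCast_of_lt hrp]), ZMod.val_natCast_of_lt hrp]
      rw [mul_smul_comm, pr_mul_e_pow, smul_mul_assoc, mul_assoc, pr_mul_V, ← mul_assoc,
        ← pr_mul_e_pow, hval, neg_smul, ← sub_eq_add_neg, mul_assoc, smul_pow, smul_mul_assoc,
        ← (Nat.cast_commute (j.val.choose r) (s ^ r • _)).eq,
        ← map_natCast (algebraMap R A), ← Algebra.smul_def, smul_smul, mul_smul_comm]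
    rw [Finset.sum_congr rfl hterm, ← Finset.mul_sum, ← Commute.add_pow, add_sub_cancel, one_pow,
      mul_one]
    exact (Commute.one_right _).sub_right (Commute.refl _)
  calc T.V s * T.V (-s) = (∑ j, T.pr j) * (T.V s * T.V (-s)) := by rw [sum_pr, one_mul]
    _ = 1 := by rw [Finset.sum_mul, Finset.sum_congr rfl fun j _ => key j, sum_pr]

theorem V_neg_mul_V (s : R) : T.V (-s) * T.V s = 1 := by
  have := T.V_mul_V_neg (-s)
  rwa [neg_neg] at this

/-- A range independent of `j` allows the sums over `r` and `j` to be interchanged. -/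
theorem sum_range_choose {M : Type*} [AddCommMonoid M] [Module R M] (j : ZMod p) (f : ℕ → M) :
    ∑ r ∈ Finset.range (j.val + 1), (j.val.choose r : R) • f r =
      ∑ r ∈ Finset.range p, (j.val.choose r : R) • f r := by
  refine Finset.sum_subset (Finset.range_mono (ZMod.val_lt j)) fun r _ hr => ?_
  rw [Nat.choose_eq_zero_of_lt (by simpa using hr), Nat.cast_zero, zero_smul]

theorem one_add_smul_pow_val (s : R) (j : ZMod p) : (1 + s • T.e) ^ j.val =
    ∑ r ∈ Finset.range p, (j.val.choose r : R) • (s ^ r • T.e ^ r) := by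
  simp only [one_add_smul_pow_eq, mul_smul]
  exact sum_range_choose j _

/-- Upper negation modulo `p`: multiplied by the unit `r!`, both sides become `(i + 1) ⋯ (i + r)`.
-/
theorem choose_add_eq {r : ℕ} (hr : r < p) (i : ZMod p) :
    ((i + r).val.choose r : R) = (-1) ^ r * ((-(i + 1)).val.choose r : R) := by
  have hne : IsUnit (r.factorial : R) := by
    have h0 : (r.factorial : ZMod p) ≠ 0 := OrderedMonomials.factorial_ne_zero_of_lt p hr
    have := (IsUnit.mk0 _ h0).map (sc R p)
    rwa [map_natCast] at this
  refine hne.mul_left_cancel ?_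
  rw [mul_left_comm, ← Nat.cast_mul, ← Nat.cast_mul, ← Nat.descFactorial_eq_factorial_mul_choose,
    ← Nat.descFactorial_eq_factorial_mul_choose, descFactorial_eq_risingFac,
    descFactorial_eq_risingFac, sc_val, sc_val, map_add, map_natCast, risingFac_neg_add, map_neg,
    neg_neg, map_add, map_one]

/-- Moving the projections to the right replaces `π_{i+r} e^r` by `e^r π_i`. The coefficients `binom
(i + r) r` are those of the negative binomial series, here truncated, and sum up to `(1 -
te)^(-(i+1))`. -/
theorem V_eq_sum_W : T.V T.t = ∑ i, T.W (-(i + 1)) * T.pr i := by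
  have h1 : T.V T.t = ∑ r ∈ Finset.range p, ∑ i : ZMod p,
      ((i + r).val.choose r : R) • (T.t ^ r • (T.e ^ r * T.pr i)) := by
    simp only [V, one_add_smul_pow_val, Finset.mul_sum]
    rw [Finset.sum_comm]
    refine Finset.sum_congr rfl fun r _ => ?_
    refine (Fintype.sum_equiv (Equiv.addRight (r : ZMod p)) _ _ fun i => ?_).symm
    rw [Equiv.coe_addRight, mul_smul_comm, mul_smul_comm, pr_mul_e_pow, add_sub_cancel_right]
  rw [h1, Finset.sum_comm]
  refine Finset.sum_congr rfl fun i _ => ?_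
  rw [W_eq_pow, sub_eq_add_neg, ← neg_smul, one_add_smul_pow_val, Finset.sum_mul]
  refine Finset.sum_congr rfl fun r hr => ?_
  rw [choose_add_eq (Finset.mem_range.mp hr), smul_mul_assoc, smul_mul_assoc, neg_pow T.t, mul_comm,
    mul_smul, mul_smul]

theorem V_neg_eq_sum_W : T.V (-T.t) = ∑ j, T.pr j * T.W j := by
  simp only [V, W_eq_pow, neg_smul, ← sub_eq_add_neg]

/-- From `[h, e] = e` one gets `[h, w] = -te = w - 1`, and `w` commutes with this commutator. -/
theorem h_mul_W (j : ZMod p) :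
    T.h * T.W j = T.W j * T.h + sc R p j • (T.W j - T.W (j - 1)) := by
  have h1 : T.h * T.W 1 = T.W 1 * T.h + (T.W 1 - 1) := by
    rw [W_one]
    have := T.lie
    rw [sub_eq_iff_eq_add] at this
    rw [mul_sub, sub_mul, mul_smul_comm, smul_mul_assoc, this, smul_add]
    simp only [mul_one, one_mul]
    abel
  have h2 : ∀ n : ℕ, T.h * T.W n = T.W n * T.h + (n : R) • (T.W n - T.W (n - 1)) := by
    intro n
    induction n with
    | zero => simp [W_zero]
    | succ n ih =>
      have e1 : T.W ((n : ZMod p) - 1) * T.W 1 = T.W n := by rw [← W_add, sub_add_cancel]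
      push_cast
      rw [add_sub_cancel_right, W_add, ← mul_assoc, ih, add_mul, mul_assoc, h1, smul_mul_assoc,
        sub_mul, e1, add_smul, one_smul, mul_add, mul_sub, mul_one, mul_assoc]
      abel
  have := h2 j.val
  rwa [sc_val (R := R), ZMod.natCast_val, ZMod.cast_id', id] at this

/-- The exponent is chosen to make the unshifted terms cancel: `h` contributes `i - (i + a)` and the
added scalar contributes `a`. Only the term with exponent lowered by one is left, so successive
factors of a rising factorial can be absorbed. -/
theorem h_add_mul_W_mul_pr (i : ZMod p) (a : ℕ) :
    (T.h + a) * (T.W (-(i + a)) * T.pr i) = sc R p (i + a) • (T.W (-(i + a) - 1) * T.pr i) := by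
  rw [add_mul, ← mul_assoc, h_mul_W, add_mul, mul_assoc, h_mul_pr, ← nsmul_eq_mul,
    ← Nat.cast_smul_eq_nsmul R, map_neg, map_add, map_natCast, mul_smul_comm, smul_mul_assoc,
    sub_mul]
  module

theorem risingFac_mul_W_mul_pr (i : ZMod p) (l : ℕ) :
    risingFac (T.h + 1) l * (T.W (-(i + 1)) * T.pr i) =
      risingFac (sc R p i + 1) l • (T.W (-(i + 1) - l) * T.pr i) := by
  induction l with
  | zero => simp [risingFac]
  | succ l ih =>
    have hc : Commute (T.h + 1 + l) (risingFac (T.h + 1) l) :=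
      commute_risingFac ((Commute.refl _).add_left (Nat.cast_commute l _)) l
    have h1 := T.h_add_mul_W_mul_pr i (l + 1)
    push_cast at h1
    rw [risingFac, ← hc.eq, mul_assoc, ih, mul_smul_comm, add_assoc T.h, add_comm (1 : A),
      show -(i + 1) - (l : ZMod p) = -(i + (l + 1)) by ring, h1, smul_smul, risingFac]
    congr 2
    · rw [map_add, map_add, map_one, map_natCast]; ring
    · push_cast; ring_nf

/-- The inner derivation `ad e`. -/
def adE : Module.End R A := LinearMap.mulLeft R T.e - LinearMap.mulRight R T.e

theorem adE_pow_apply (l : ℕ) (x : A) : (T.adE ^ l) x = (fun y => T.e * y - y * T.e)^[l] x := by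
  rw [Module.End.pow_apply]
  rfl

/-- Right multiplication by `w` is left multiplication by `w` plus `t ad e`. These operators
commute, so the binomial theorem applies. -/
theorem mul_W (x : A) (i : ZMod p) : x * T.W i =
    ∑ l ∈ Finset.range p, (i.val.choose l : R) • (T.t ^ l • (T.W (i - l) * (T.adE ^ l) x)) := by
  have hc : Commute (LinearMap.mulLeft R (1 - T.t • T.e)) (T.t • T.adE) := by
    refine Commute.smul_right ?_ _
    refine Commute.sub_right ?_ (LinearMap.commute_mulLeft_right _ _)
    have : Commute (1 - T.t • T.e) T.e :=
      (Commute.one_left _).sub_left ((Commute.refl _).smul_left _)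
    ext y
    simp only [Module.End.mul_apply, LinearMap.mulLeft_apply, ← mul_assoc, this.eq]
  have hR : LinearMap.mulRight R (1 - T.t • T.e) =
      T.t • T.adE + LinearMap.mulLeft R (1 - T.t • T.e) := by
    ext y
    simp only [adE, LinearMap.mulRight_apply, LinearMap.add_apply, LinearMap.smul_apply,
      LinearMap.sub_apply, LinearMap.mulLeft_apply, mul_sub, sub_mul, smul_sub, mul_one, one_mul,
      mul_smul_comm, smul_mul_assoc]
    abel
  have h := LinearMap.congr_fun (hc.symm.add_pow i.val) x
  rw [← hR, LinearMap.pow_mulRight, LinearMap.mulRight_apply, ← W_eq_pow] at h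
  rw [h, LinearMap.sum_apply, ← sum_range_choose]
  refine Finset.sum_congr rfl fun l hl => ?_
  have hli : l ≤ i.val := Nat.lt_succ_iff.mp (Finset.mem_range.mp hl)
  have hW : T.W (i - l) = (1 - T.t • T.e) ^ (i.val - l) := by
    rw [← W_natCast, Nat.cast_sub hli, ZMod.natCast_val, ZMod.cast_id', id]
  rw [← (Nat.cast_commute (i.val.choose l) _).eq, ← nsmul_eq_mul, ← Nat.cast_smul_eq_nsmul R,
    LinearMap.smul_apply, (hc.symm.pow_pow _ _).eq, Module.End.mul_apply, LinearMap.pow_mulLeft,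
    LinearMap.mulLeft_apply, smul_pow, LinearMap.smul_apply, mul_smul_comm, hW]

/-- The mirror image of `mul_W`: left multiplication by `w` is right multiplication by `w` minus `t
ad e`. -/
theorem W_mul (x : A) (i : ZMod p) : T.W i * x =
    ∑ l ∈ Finset.range p,
      (i.val.choose l : R) • ((-T.t) ^ l • ((T.adE ^ l) x * T.W (i - l))) := by
  have hc : Commute (LinearMap.mulRight R (1 - T.t • T.e)) ((-T.t) • T.adE) := by
    refine Commute.smul_right ?_ _
    refine Commute.sub_right (LinearMap.commute_mulLeft_right _ _).symm ?_
    have : Commute (1 - T.t • T.e) T.e :=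
      (Commute.one_left _).sub_left ((Commute.refl _).smul_left _)
    ext y
    simp only [Module.End.mul_apply, LinearMap.mulRight_apply, mul_assoc, this.eq]
  have hL : LinearMap.mulLeft R (1 - T.t • T.e) =
      (-T.t) • T.adE + LinearMap.mulRight R (1 - T.t • T.e) := by
    ext y
    simp only [adE, LinearMap.mulRight_apply, LinearMap.add_apply, LinearMap.smul_apply,
      LinearMap.sub_apply, LinearMap.mulLeft_apply, mul_sub, sub_mul, smul_sub, mul_one, one_mul,
      mul_smul_comm, smul_mul_assoc]
    module
  have h := LinearMap.congr_fun (hc.symm.add_pow i.val) x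
  rw [← hL, LinearMap.pow_mulLeft, LinearMap.mulLeft_apply, ← W_eq_pow] at h
  rw [h, LinearMap.sum_apply, ← sum_range_choose]
  refine Finset.sum_congr rfl fun l hl => ?_
  have hli : l ≤ i.val := Nat.lt_succ_iff.mp (Finset.mem_range.mp hl)
  have hW : T.W (i - l) = (1 - T.t • T.e) ^ (i.val - l) := by
    rw [← W_natCast, Nat.cast_sub hli, ZMod.natCast_val, ZMod.cast_id', id]
  rw [← (Nat.cast_commute (i.val.choose l) _).eq, ← nsmul_eq_mul, ← Nat.cast_smul_eq_nsmul R,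
    LinearMap.smul_apply, (hc.symm.pow_pow _ _).eq, Module.End.mul_apply, LinearMap.pow_mulRight,
    LinearMap.mulRight_apply, smul_pow, LinearMap.smul_apply, smul_mul_assoc, hW]

/-! ### Conjugation by `w ^ j` and by `V` in terms of divided powers of `ad e` -/

section DividedPowers

variable {K : Type*} [Field K] [CharP K p] [Algebra K R] [Algebra K A] [IsScalarTower K R A]

theorem W_mul_mul_W_neg (x : A) (j : ZMod p) : T.W j * x * T.W (-j) =
    ∑ l ∈ Finset.range p, ((-1) ^ l * T.t ^ l * risingFac (sc R p j) l) •
      (T.W (-(l : ZMod p)) * divAd K T.e l x) := by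
  rw [mul_assoc, mul_W, Finset.mul_sum]
  refine Finset.sum_congr rfl fun l hl => ?_
  rw [choose_smul_eq (K := K) p (Finset.mem_range.mp hl), map_neg, neg_neg, divAd, ← adE_pow_apply,
    mul_smul_comm, mul_smul_comm, mul_smul_comm, ← mul_assoc, ← W_add,
    show j + (-j - (l : ZMod p)) = -(l : ZMod p) by ring, mul_smul_comm,
    ← smul_comm (T.t ^ l) (_ : K), smul_smul]
  congr 1
  ring

/-- Write `V` with projections on the right. Passing `x` through them shifts indices by `m` and
splits off `w^(-m)`; passing `w^(-(j+1))` through `x` creates the terms `d^(l)(x)` with coefficients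
`(j + 1)^⟨l⟩`. By `risingFac_mul_W_mul_pr` these coefficients, together with the lowered powers of
`w`, are the action of `h_1^⟨l⟩` on `V`, so a factor `V` reappears on the right and cancels. -/
theorem V_mul_mul_V_neg {x : A} {m : ZMod p} (hx : T.h * x - x * T.h = sc R p m • x) :
    T.V T.t * x * T.V (-T.t) = T.W (-m) *
      ∑ l ∈ Finset.range p, T.t ^ l • (divAd K T.e l x * risingFac (T.h + 1) l) := by
  have h1 : T.V T.t * x = T.W (-m) * ∑ j, T.W (-(j + 1)) * x * T.pr j := by
    rw [V_eq_sum_W, Finset.sum_mul, Finset.mul_sum]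
    refine (Fintype.sum_equiv (Equiv.addRight m) _ _ fun j => ?_).symm
    have e1 : -(j + m + 1) = -m + -(j + 1) := by ring
    simp only [Equiv.coe_addRight]
    rw [mul_assoc, mul_assoc (T.W (-(j + m + 1))), T.pr_mul_weight hx, add_sub_cancel_right, e1,
      W_add, mul_assoc]
  have h2 : ∑ j, T.W (-(j + 1)) * x * T.pr j =
      (∑ l ∈ Finset.range p, T.t ^ l • (divAd K T.e l x * risingFac (T.h + 1) l)) * T.V T.t := by
    rw [V_eq_sum_W, Finset.sum_mul]
    simp only [T.W_mul x, Finset.sum_mul]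
    rw [Finset.sum_comm]
    refine Finset.sum_congr rfl fun l hl => ?_
    rw [Finset.mul_sum]
    refine Finset.sum_congr rfl fun j _ => ?_
    rw [choose_smul_eq (K := K) p (Finset.mem_range.mp hl), map_neg, neg_neg, map_add, map_one,
      smul_mul_assoc (T.t ^ l), mul_assoc (divAd K T.e l x), risingFac_mul_W_mul_pr, divAd,
      ← adE_pow_apply, ← smul_comm ((-T.t) ^ l) (_ : K), smul_smul, smul_mul_assoc, smul_mul_assoc,
      mul_smul_comm, smul_smul, smul_mul_assoc, mul_assoc]
    congr 1
    · rw [mul_left_comm, ← mul_pow, neg_one_mul, neg_neg, mul_comm]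
    · rw [mul_assoc]
  rw [h1, h2, mul_assoc, mul_assoc, V_mul_V_neg, mul_one]

end DividedPowers

end TwistDatum

/-! ### Twisting a cocommutative Hopf algebra generated by primitive elements -/

/-- Algebra maps with the types of a comultiplication, a counit and an antipode. -/
structure HopfMaps (R A : Type*) [CommRing R] [Ring A] [Algebra R A] where
  comul : A →ₐ[R] A ⊗[R] A
  counit : A →ₐ[R] R
  antipode : A →ₐ[R] Aᵐᵒᵖ

/-- The elements which behave like primitive elements of a Hopf algebra. -/
structure HopfMaps.IsPrim {R A : Type*} [CommRing R] [Ring A] [Algebra R A] (M : HopfMaps R A)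
    (x : A) : Prop where
  comul : M.comul x = x ⊗ₜ 1 + 1 ⊗ₜ x
  counit : M.counit x = 0
  antipode : M.antipode x = MulOpposite.op (-x)

namespace TwistDatum

open ModP

set_option linter.unusedSectionVars false

variable {R A : Type*} [CommRing R] [Ring A] [Algebra R A] {p : ℕ} [Fact p.Prime] [CharP R p]
  (T : TwistDatum R A p)

/-- The twist `∑ j, π_j ⊗ (1 - t e) ^ j`. -/
def F : A ⊗[R] A := ∑ j, T.pr j ⊗ₜ T.W j

/-- The inverse twist `∑ j, π_j ⊗ (1 - t e) ^ (-j)`. -/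
def Finv : A ⊗[R] A := ∑ j, T.pr j ⊗ₜ T.W (-j)

theorem F_mul_pr_tmul (j : ZMod p) (y : A) : T.F * (T.pr j ⊗ₜ y) = T.pr j ⊗ₜ (T.W j * y) := by
  rw [F, Finset.sum_mul, Finset.sum_eq_single j]
  · rw [Algebra.TensorProduct.tmul_mul_tmul, pr_mul_pr, if_pos rfl]
  · intro i _ hij
    rw [Algebra.TensorProduct.tmul_mul_tmul, pr_mul_pr, if_neg hij, TensorProduct.zero_tmul]
  · simp

theorem pr_tmul_mul_Finv (j : ZMod p) (y : A) :
    (T.pr j ⊗ₜ y) * T.Finv = T.pr j ⊗ₜ (y * T.W (-j)) := by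
  rw [Finv, Finset.mul_sum, Finset.sum_eq_single j]
  · rw [Algebra.TensorProduct.tmul_mul_tmul, pr_mul_pr, if_pos rfl]
  · intro i _ hij
    rw [Algebra.TensorProduct.tmul_mul_tmul, pr_mul_pr, if_neg (Ne.symm hij),
      TensorProduct.zero_tmul]
  · simp

theorem one_tmul_eq_sum (y : A) : (1 : A) ⊗ₜ[R] y = ∑ j, T.pr j ⊗ₜ y := by
  rw [← TensorProduct.sum_tmul, sum_pr]

theorem F_mul_one_tmul_mul_Finv (y : A) :
    T.F * (1 ⊗ₜ y) * T.Finv = ∑ j, T.pr j ⊗ₜ (T.W j * y * T.W (-j)) := by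
  simp only [T.one_tmul_eq_sum y, Finset.mul_sum, Finset.sum_mul, F_mul_pr_tmul, pr_tmul_mul_Finv]

theorem F_mul_Finv : T.F * T.Finv = 1 := by
  have := T.F_mul_one_tmul_mul_Finv 1
  simp only [mul_one, W_mul_neg, ← one_tmul_eq_sum, ← Algebra.TensorProduct.one_def] at this
  exact this

theorem Finv_mul_F : T.Finv * T.F = 1 := by
  have h : ∀ j, T.Finv * (T.pr j ⊗ₜ[R] T.W j) = T.pr j ⊗ₜ 1 := by
    intro j
    rw [Finv, Finset.sum_mul, Finset.sum_eq_single j]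
    · rw [Algebra.TensorProduct.tmul_mul_tmul, pr_mul_pr, if_pos rfl, W_neg_mul]
    · intro i _ hij
      rw [Algebra.TensorProduct.tmul_mul_tmul, pr_mul_pr, if_neg hij, TensorProduct.zero_tmul]
    · simp
  rw [F, Finset.mul_sum, Finset.sum_congr rfl fun j _ => h j, ← one_tmul_eq_sum,
    Algebra.TensorProduct.one_def]

/-- Passing `x` through turns `π_{j+m}` into `π_j`, and the surplus in `w^(j+m)` is `w^m`. -/
theorem F_mul_tmul_one {x : A} {m : ZMod p} (hx : T.h * x - x * T.h = sc R p m • x) :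
    T.F * (x ⊗ₜ 1) = (x ⊗ₜ T.W m) * T.F := by
  rw [F, Finset.sum_mul, Finset.mul_sum]
  refine (Fintype.sum_equiv (Equiv.addRight m) _ _ fun j => ?_).symm
  simp only [Equiv.coe_addRight, Algebra.TensorProduct.tmul_mul_tmul, mul_one]
  rw [T.pr_mul_weight hx, add_sub_cancel_right, add_comm, W_add]

variable (M : HopfMaps R A)

/-- The twisted comultiplication. -/
def comul : A →ₐ[R] A ⊗[R] A where
  toFun a := T.F * M.comul a * T.Finv
  map_one' := by rw [map_one, mul_one, F_mul_Finv]
  map_mul' a b := by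
    rw [map_mul]
    calc T.F * (M.comul a * M.comul b) * T.Finv =
        T.F * M.comul a * 1 * M.comul b * T.Finv := by noncomm_ring
      _ = _ := by rw [← T.Finv_mul_F]; simp only [mul_assoc]
  map_zero' := by rw [map_zero, mul_zero, zero_mul]
  map_add' a b := by rw [map_add, mul_add, add_mul]
  commutes' r := by
    rw [AlgHom.commutes, ← Algebra.commutes, mul_assoc, F_mul_Finv, mul_one]

theorem comul_apply (a : A) : T.comul M a = T.F * M.comul a * T.Finv := rfl

variable {M}

theorem comul_of_isPrim {x : A} {m : ZMod p} (hx : T.h * x - x * T.h = sc R p m • x)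
    (hM : M.IsPrim x) :
    T.comul M x = x ⊗ₜ T.W m + ∑ j, T.pr j ⊗ₜ (T.W j * x * T.W (-j)) := by
  rw [comul_apply, hM.comul, mul_add, add_mul, F_mul_one_tmul_mul_Finv, T.F_mul_tmul_one hx,
    mul_assoc, F_mul_Finv, mul_one]

/-- As `e` commutes with `w`, the formula for weight `1` gives `Δ(e) = e ⊗ w + 1 ⊗ e`. Hence `1 -
tΔ(e) = 1 ⊗ w - te ⊗ w = w ⊗ w`. -/
theorem comul_W (he : M.IsPrim T.e) (j : ZMod p) : T.comul M (T.W j) = T.W j ⊗ₜ T.W j := by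
  have hc : ∀ j, Commute (T.W j) T.e := fun j => by
    rw [W_eq_pow]
    exact ((Commute.one_left _).sub_left ((Commute.refl _).smul_left _)).pow_left _
  have he' : T.comul M T.e = T.e ⊗ₜ (1 - T.t • T.e) + 1 ⊗ₜ T.e := by
    rw [T.comul_of_isPrim T.e_weight he, W_one]
    simp only [(hc _).eq, mul_assoc, W_mul_neg, mul_one, ← one_tmul_eq_sum]
  rw [W_eq_pow, map_pow, ← Algebra.TensorProduct.tmul_pow]
  congr 1
  rw [map_sub, map_one, map_smul, he', Algebra.TensorProduct.one_def, TensorProduct.sub_tmul,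
    ← TensorProduct.smul_tmul', smul_add]
  nth_rw 2 [TensorProduct.tmul_sub]
  rw [TensorProduct.tmul_smul]
  abel

/-- The undeformed `Δ(h) = h ⊗ 1 + 1 ⊗ h` has eigenvalue `a + b` on `π_a ⊗ π_b`, and these tensors
sum to `1`. -/
theorem base_comul_pr (hh : M.IsPrim T.h) (k : ZMod p) :
    M.comul (T.pr k) = ∑ a, T.pr a ⊗ₜ T.pr (k - a) := by
  have h1 : ∀ a b, M.comul (T.pr k) * (T.pr a ⊗ₜ[R] T.pr b) =
      if a + b = k then T.pr a ⊗ₜ T.pr b else 0 := by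
    intro a b
    rw [pr, map_proj]
    refine proj_mul_of_eigen p ?_ k
    rw [hh.comul, add_mul, Algebra.TensorProduct.tmul_mul_tmul, Algebra.TensorProduct.tmul_mul_tmul,
      h_mul_pr, h_mul_pr, one_mul, one_mul, map_add, add_smul, TensorProduct.smul_tmul',
      TensorProduct.tmul_smul]
  have h2 : (1 : A ⊗[R] A) = ∑ a, ∑ b, T.pr a ⊗ₜ T.pr b := by
    simp only [← TensorProduct.tmul_sum, ← TensorProduct.sum_tmul, sum_pr,
      Algebra.TensorProduct.one_def]
  calc M.comul (T.pr k) = M.comul (T.pr k) * 1 := (mul_one _).symm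
    _ = ∑ a, ∑ b, if a + b = k then T.pr a ⊗ₜ T.pr b else 0 := by
      simp only [h2, Finset.mul_sum, h1]
    _ = ∑ a, T.pr a ⊗ₜ T.pr (k - a) := by
      refine Finset.sum_congr rfl fun a _ => ?_
      rw [Finset.sum_eq_single (k - a)]
      · rw [if_pos (by ring)]
      · intro b _ hb
        rw [if_neg]
        rintro rfl
        exact hb (by ring)
      · simp

theorem comul_pr (hh : M.IsPrim T.h) (k : ZMod p) :
    T.comul M (T.pr k) = ∑ j, T.pr j ⊗ₜ (T.W j * T.pr (k - j) * T.W (-j)) := by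
  simp only [comul_apply, T.base_comul_pr hh, Finset.mul_sum, Finset.sum_mul, F_mul_pr_tmul,
    pr_tmul_mul_Finv]

theorem counit_pr (hh : M.IsPrim T.h) (k : ZMod p) :
    M.counit (T.pr k) = if k = 0 then 1 else 0 := by
  have := proj_mul_of_eigen (R := R) p (y := (0 : R)) (z := 1) (i := 0) (by simp) k
  rw [pr, map_proj, hh.counit]
  simpa [eq_comm] using this

theorem counit_W (he : M.IsPrim T.e) (k : ZMod p) : M.counit (T.W k) = 1 := by
  rw [W_eq_pow, map_pow, map_sub, map_one, map_smul, he.counit, smul_zero, sub_zero, one_pow]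

theorem antipode_pr (hh : M.IsPrim T.h) (k : ZMod p) :
    M.antipode (T.pr k) = MulOpposite.op (T.pr (-k)) := by
  rw [pr, map_proj, hh.antipode, pr, ← proj_neg p T.odd]
  simp [proj, MulOpposite.algebraMap_apply]

theorem antipode_W (he : M.IsPrim T.e) (k : ZMod p) :
    M.antipode (T.W k) = MulOpposite.op ((1 + T.t • T.e) ^ k.val) := by
  rw [W_eq_pow, map_pow, map_sub, map_one, map_smul, he.antipode]
  simp

variable (M) in
/-- The twisted antipode. -/
def antipode : A →ₗ[R] A where
  toFun a := T.V T.t * (M.antipode a).unop * T.V (-T.t)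
  map_add' a b := by rw [map_add, MulOpposite.unop_add, mul_add, add_mul]
  map_smul' r a := by
    rw [map_smul, MulOpposite.unop_smul, mul_smul_comm, smul_mul_assoc, RingHom.id_apply]

theorem antipode_apply (a : A) :
    T.antipode M a = T.V T.t * (M.antipode a).unop * T.V (-T.t) := rfl

theorem antipode_mul (a b : A) : T.antipode M (a * b) = T.antipode M b * T.antipode M a := by
  rw [antipode_apply, map_mul, MulOpposite.unop_mul]
  calc T.V T.t * ((M.antipode b).unop * (M.antipode a).unop) * T.V (-T.t) =
      T.V T.t * (M.antipode b).unop * 1 * (M.antipode a).unop * T.V (-T.t) := by noncomm_ring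
    _ = _ := by rw [← V_neg_mul_V T T.t]; simp only [mul_assoc, antipode_apply]

theorem antipode_one : T.antipode M 1 = 1 := by
  rw [antipode_apply, map_one, MulOpposite.unop_one, mul_one, V_mul_V_neg]

/-- The left factor `F` drops out because `π_{-i} V^(-1) = π_{-i} w^(-i)`. What remains depends on
`a ⊗ b` only through `S(a) b`, with `S` the undeformed antipode, so for primitive `x` the two parts
of `x ⊗ 1 + 1 ⊗ x` cancel. -/
theorem mul_antipode_left_tmul (hh : M.IsPrim T.h) (a b : A) :
    LinearMap.mul' R A ((T.antipode M).rTensor A (T.F * (a ⊗ₜ b) * T.Finv)) =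
      T.V T.t * ∑ j, T.pr (-j) * ((M.antipode a).unop * b) * T.W (-j) := by
  have h1 : ∑ i, T.pr (-i) * T.V (-T.t) * T.W i = 1 := by
    rw [← T.sum_pr, ← Fintype.sum_equiv (Equiv.neg (ZMod p)) _ _ fun i => rfl]
    refine Finset.sum_congr rfl fun i _ => ?_
    rw [Equiv.neg_apply, V_neg_eq_sum_W, pr_mul_sum, mul_assoc, W_neg_mul, mul_one, neg_neg]
  simp only [F, Finv, Finset.sum_mul, Finset.mul_sum, Algebra.TensorProduct.tmul_mul_tmul, map_sum,
    LinearMap.rTensor_tmul, LinearMap.mul'_apply, antipode_apply, map_mul, MulOpposite.unop_mul,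
    T.antipode_pr hh, MulOpposite.unop_op]
  refine Finset.sum_congr rfl fun j _ => ?_
  calc _ = T.V T.t * (T.pr (-j) * (M.antipode a).unop *
        (∑ i, T.pr (-i) * T.V (-T.t) * T.W i) * b * T.W (-j)) := by
        simp only [Finset.sum_mul, Finset.mul_sum, mul_assoc]
    _ = _ := by rw [h1]; simp only [mul_assoc, one_mul]

/-- Here `F` drops out because `π_i V = π_i (1 + te)^i` and `(1 + te)^i` is the undeformed antipode
of `w^i`. The result depends only on `a S(b)`. -/
theorem mul_antipode_right_tmul (he : M.IsPrim T.e) (a b : A) :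
    LinearMap.mul' R A ((T.antipode M).lTensor A (T.F * (a ⊗ₜ b) * T.Finv)) =
      (∑ j, T.pr j * (a * (M.antipode b).unop) * (1 + T.t • T.e) ^ j.val) * T.V (-T.t) := by
  have h1 : ∑ i, T.pr i * T.V T.t * (M.antipode (T.W (-i))).unop = 1 := by
    rw [← T.sum_pr]
    refine Finset.sum_congr rfl fun i _ => ?_
    have := congrArg MulOpposite.unop (congrArg M.antipode (T.W_neg_mul i))
    rw [map_mul, MulOpposite.unop_mul, T.antipode_W he i, map_one, MulOpposite.unop_one,
      MulOpposite.unop_op] at this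
    rw [pr_mul_V, mul_assoc, this, mul_one]
  simp only [F, Finv, Finset.sum_mul, Finset.mul_sum, Algebra.TensorProduct.tmul_mul_tmul, map_sum,
    LinearMap.lTensor_tmul, LinearMap.mul'_apply, antipode_apply, map_mul, MulOpposite.unop_mul]
  rw [Finset.sum_comm]
  refine Finset.sum_congr rfl fun j _ => ?_
  rw [T.antipode_W he j, MulOpposite.unop_op]
  calc _ = T.pr j * a * (∑ i, T.pr i * T.V T.t * (M.antipode (T.W (-i))).unop) *
        (M.antipode b).unop * (1 + T.t • T.e) ^ j.val * T.V (-T.t) := by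
        simp only [Finset.sum_mul, Finset.mul_sum, mul_assoc]
    _ = _ := by rw [h1]; simp only [mul_assoc, one_mul]

variable (M)

/-- Since the twisted antipode reverses products, the factor coming from `a` ends up innermost,
where it is a central scalar. Hence the antipode axiom passes from generators to products. -/
theorem mul_antipode_left_mul (a : A) {c : R}
    (h : LinearMap.mul' R A ((T.antipode M).rTensor A (T.comul M a)) = algebraMap R A c)
    (y : A ⊗[R] A) :
    LinearMap.mul' R A ((T.antipode M).rTensor A (T.comul M a * y)) =
      c • LinearMap.mul' R A ((T.antipode M).rTensor A y) := by
  induction y using TensorProduct.induction_on with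
  | zero => simp
  | add y z hy hz => rw [mul_add, map_add, map_add, hy, hz, map_add, map_add, smul_add]
  | tmul y z =>
    have key : ∀ u : A ⊗[R] A,
        LinearMap.mul' R A ((T.antipode M).rTensor A (u * (y ⊗ₜ z))) =
          T.antipode M y * LinearMap.mul' R A ((T.antipode M).rTensor A u) * z := by
      intro u
      induction u using TensorProduct.induction_on with
      | zero => simp
      | add u v hu hv => rw [add_mul, map_add, map_add, hu, hv, map_add, map_add, mul_add, add_mul]
      | tmul u v =>
        simp only [Algebra.TensorProduct.tmul_mul_tmul, LinearMap.rTensor_tmul,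
          LinearMap.mul'_apply, antipode_mul, mul_assoc]
    rw [key, h, ← Algebra.commutes, LinearMap.rTensor_tmul, LinearMap.mul'_apply, mul_assoc,
      Algebra.smul_def]

theorem mul_antipode_right_mul (a : A) {c : R}
    (h : LinearMap.mul' R A ((T.antipode M).lTensor A (T.comul M a)) = algebraMap R A c)
    (y : A ⊗[R] A) :
    LinearMap.mul' R A ((T.antipode M).lTensor A (y * T.comul M a)) =
      c • LinearMap.mul' R A ((T.antipode M).lTensor A y) := by
  induction y using TensorProduct.induction_on with
  | zero => simp
  | add y z hy hz => rw [add_mul, map_add, map_add, hy, hz, map_add, map_add, smul_add]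
  | tmul y z =>
    have key : ∀ u : A ⊗[R] A,
        LinearMap.mul' R A ((T.antipode M).lTensor A ((y ⊗ₜ z) * u)) =
          y * LinearMap.mul' R A ((T.antipode M).lTensor A u) * T.antipode M z := by
      intro u
      induction u using TensorProduct.induction_on with
      | zero => simp
      | add u v hu hv => rw [mul_add, map_add, map_add, hu, hv, map_add, map_add, mul_add, add_mul]
      | tmul u v =>
        simp only [Algebra.TensorProduct.tmul_mul_tmul, LinearMap.lTensor_tmul,
          LinearMap.mul'_apply, antipode_mul, mul_assoc]
    rw [key, h, ← Algebra.commutes, LinearMap.lTensor_tmul, LinearMap.mul'_apply, mul_assoc,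
      Algebra.smul_def]

variable {M}

/-- The twisted Hopf algebra structure. -/
def hopf (hh : M.IsPrim T.h) (he : M.IsPrim T.e) {G : Set A} (hG : Algebra.adjoin R G = ⊤)
    (hprim : ∀ x ∈ G, M.IsPrim x) (hwt : ∀ x ∈ G, ∃ m, T.h * x - x * T.h = sc R p m • x) :
    HopfStructure R A where
  comul := T.comul M
  counit := M.counit
  antipode := T.antipode M
  coassoc := by
    refine AlgHom.ext_of_adjoin_eq_top hG fun x hx => ?_
    obtain ⟨m, hm⟩ := hwt x hx
    -- Conjugation by the grouplike `w^j` is compatible with the twisted comultiplication; it fixes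
    -- the tensor factor `w^m`.
    have h1 : ∀ j, T.comul M (T.W j * x * T.W (-j)) = (T.W j * x * T.W (-j)) ⊗ₜ T.W m +
        ∑ i, (T.W j * T.pr i * T.W (-j)) ⊗ₜ (T.W (i + j) * x * T.W (-(i + j))) := by
      intro j
      rw [map_mul, map_mul, T.comul_W he, T.comul_W he, T.comul_of_isPrim hm (hprim x hx), mul_add,
        add_mul]
      congr 1
      · rw [Algebra.TensorProduct.tmul_mul_tmul, Algebra.TensorProduct.tmul_mul_tmul, ← W_add,
          ← W_add, show j + m + -j = m by ring]
      · simp only [Finset.mul_sum, Finset.sum_mul, Algebra.TensorProduct.tmul_mul_tmul]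
        refine Finset.sum_congr rfl fun i _ => ?_
        rw [add_comm i j, neg_add_rev, W_add, W_add]
        simp only [mul_assoc]
    change Algebra.TensorProduct.assoc R R R A A A
      (Algebra.TensorProduct.map (T.comul M) (AlgHom.id R A) (T.comul M x)) =
      Algebra.TensorProduct.map (AlgHom.id R A) (T.comul M) (T.comul M x)
    rw [T.comul_of_isPrim hm (hprim x hx)]
    simp only [map_add, map_sum, Algebra.TensorProduct.map_tmul, AlgHom.id_apply, h1,
      T.comul_of_isPrim hm (hprim x hx), T.comul_W he, T.comul_pr hh, TensorProduct.add_tmul,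
      TensorProduct.sum_tmul, TensorProduct.tmul_add, TensorProduct.tmul_sum,
      Algebra.TensorProduct.assoc_tmul, Finset.sum_add_distrib]
    rw [add_assoc]
    congr 2
    rw [Finset.sum_comm]
    refine Finset.sum_congr rfl fun j _ => ?_
    -- The shift matches `π_{k-j}` from the coproduct of `π_k` with the exponent `i + j` produced by
    -- conjugation.
    refine (Fintype.sum_equiv (Equiv.addRight j) _ _ fun i => ?_).symm
    simp only [Equiv.coe_addRight, add_sub_cancel_right]
  rTensor_counit_comul := by
    refine AlgHom.ext_of_adjoin_eq_top hG fun x hx => ?_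
    obtain ⟨m, hm⟩ := hwt x hx
    change Algebra.TensorProduct.map M.counit (AlgHom.id R A) (T.comul M x) = 1 ⊗ₜ x
    rw [T.comul_of_isPrim hm (hprim x hx), map_add, map_sum, Finset.sum_eq_single 0]
    · simp [T.counit_pr hh, (hprim x hx).counit, W_zero]
    · intro j _ hj
      simp [T.counit_pr hh, hj]
    · simp
  lTensor_counit_comul := by
    refine AlgHom.ext_of_adjoin_eq_top hG fun x hx => ?_
    obtain ⟨m, hm⟩ := hwt x hx
    change Algebra.TensorProduct.map (AlgHom.id R A) M.counit (T.comul M x) = x ⊗ₜ 1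
    rw [T.comul_of_isPrim hm (hprim x hx), map_add, map_sum, Finset.sum_eq_zero]
    · simp [T.counit_W he]
    · intro j _
      simp [(hprim x hx).counit]
  mul_antipode_rTensor_comul := by
    ext a
    change LinearMap.mul' R A ((T.antipode M).rTensor A (T.comul M a)) =
      algebraMap R A (M.counit a)
    have ha : a ∈ Algebra.adjoin R G := hG ▸ Algebra.mem_top
    induction ha using Algebra.adjoin_induction with
    | mem x hx =>
      rw [comul_apply, (hprim x hx).comul, mul_add, add_mul, map_add, map_add,
        T.mul_antipode_left_tmul hh, T.mul_antipode_left_tmul hh, ← mul_add,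
        ← Finset.sum_add_distrib, (hprim x hx).counit, (hprim x hx).antipode]
      simp
    | algebraMap r =>
      rw [AlgHom.commutes, AlgHom.commutes, Algebra.TensorProduct.algebraMap_apply,
        LinearMap.rTensor_tmul, LinearMap.mul'_apply, mul_one, Algebra.algebraMap_eq_smul_one,
        map_smul, antipode_one, ← Algebra.algebraMap_eq_smul_one]
      rfl
    | add a b _ _ ha hb => simp only [map_add, ha, hb]
    | mul a b _ _ ha hb =>
      rw [map_mul, T.mul_antipode_left_mul M a ha, hb, map_mul, map_mul, Algebra.smul_def]
  mul_antipode_lTensor_comul := by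
    ext a
    change LinearMap.mul' R A ((T.antipode M).lTensor A (T.comul M a)) =
      algebraMap R A (M.counit a)
    have ha : a ∈ Algebra.adjoin R G := hG ▸ Algebra.mem_top
    induction ha using Algebra.adjoin_induction with
    | mem x hx =>
      rw [comul_apply, (hprim x hx).comul, mul_add, add_mul, map_add, map_add,
        T.mul_antipode_right_tmul he, T.mul_antipode_right_tmul he, ← add_mul,
        ← Finset.sum_add_distrib, (hprim x hx).counit, (hprim x hx).antipode]
      simp
    | algebraMap r =>
      rw [AlgHom.commutes, AlgHom.commutes, Algebra.TensorProduct.algebraMap_apply,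
        LinearMap.lTensor_tmul, LinearMap.mul'_apply, antipode_one, mul_one]
      rfl
    | add a b _ _ ha hb => simp only [map_add, ha, hb]
    | mul a b _ _ ha hb =>
      rw [map_mul, T.mul_antipode_right_mul M b hb, ha, map_mul, map_mul, Algebra.smul_def,
        Algebra.commutes]

/-! ### The comultiplication and antipode on weight vectors -/

section Formulas

variable {K : Type*} [Field K] [CharP K p] [Algebra K R] [Algebra K A] [IsScalarTower K R A]

/-- On `π_j` the rising factorial of `h` takes the value `j^⟨l⟩`, so the eigenvalue expansion of
`w^j x w^(-j)` reassembles into `h^⟨l⟩`. -/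
theorem comul_eq {x : A} {m : ZMod p} (hx : T.h * x - x * T.h = sc R p m • x)
    (hM : M.IsPrim x) :
    T.comul M x = x ⊗ₜ T.W m + ∑ l ∈ Finset.range p, ((-1) ^ l * T.t ^ l) •
      (risingFac T.h l ⊗ₜ[R] (T.W (-(l : ZMod p)) * divAd K T.e l x)) := by
  have h1 : ∀ l, risingFac T.h l = ∑ j, risingFac (sc R p j) l • T.pr j := by
    intro l
    rw [← mul_one (risingFac T.h l), ← T.sum_pr, Finset.mul_sum]
    exact Finset.sum_congr rfl fun j _ => risingFac_mul_of_eigen (T.h_mul_pr j) l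
  rw [T.comul_of_isPrim hx hM]
  congr 1
  simp only [T.W_mul_mul_W_neg (K := K) x, h1, TensorProduct.tmul_sum, TensorProduct.sum_tmul,
    Finset.smul_sum]
  rw [Finset.sum_comm]
  refine Finset.sum_congr rfl fun l _ => Finset.sum_congr rfl fun j _ => ?_
  rw [TensorProduct.tmul_smul, TensorProduct.smul_tmul', TensorProduct.smul_tmul', mul_smul]

theorem antipode_eq {x : A} {m : ZMod p} (hx : T.h * x - x * T.h = sc R p m • x)
    (hM : M.IsPrim x) :
    T.antipode M x = -(T.W (-m) * ∑ l ∈ Finset.range p, T.t ^ l •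
      (divAd K T.e l x * risingFac (T.h + 1) l)) := by
  rw [antipode_apply, hM.antipode, MulOpposite.unop_op, mul_neg, neg_mul, T.V_mul_mul_V_neg (K := K) hx]

end Formulas

end TwistDatum

/-! ### Monomials and derivations of the divided power algebra -/

namespace DivPow

set_option linter.unusedSectionVars false

variable {K : Type*} [Field K] {p : ℕ} {σ : Type*} [Fintype σ] [DecidableEq σ]

/-- The linear form `f ↦ f.coef γ`. -/
def coefLin (K : Type*) [Field K] {p : ℕ} {σ : Type*} [Fintype σ] [DecidableEq σ]
    (γ : σ → Fin p) : DivPow K p σ →ₗ[K] K where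
  toFun f := f.coef γ
  map_add' _ _ := rfl
  map_smul' _ _ := rfl

theorem sum_coef {ι : Type*} (s : Finset ι) (f : ι → DivPow K p σ) (γ : σ → Fin p) :
    (∑ i ∈ s, f i).coef γ = ∑ i ∈ s, (f i).coef γ := map_sum (coefLin K γ) f s

theorem sub_coef (f g : DivPow K p σ) (γ : σ → Fin p) : (f - g).coef γ = f.coef γ - g.coef γ :=
  map_sub (coefLin K γ) f g

theorem mono_coef (α γ : σ → Fin p) :
    (mono α : DivPow K p σ).coef γ = if γ = α then 1 else 0 := rfl

theorem eq_sum_mono (f : DivPow K p σ) : f = ∑ α, f.coef α • mono α := by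
  refine ext' fun γ => ?_
  rw [sum_coef, Finset.sum_eq_single γ]
  · simp [mono_coef]
  · intro α _ hα
    simp [mono_coef, Ne.symm hα]
  · simp

theorem linearMap_ext {M : Type*} [AddCommMonoid M] [Module K M] {f g : DivPow K p σ →ₗ[K] M}
    (h : ∀ α, f (mono α) = g (mono α)) : f = g := by
  refine LinearMap.ext fun x => ?_
  rw [eq_sum_mono x, map_sum, map_sum]
  exact Finset.sum_congr rfl fun α _ => by rw [map_smul, map_smul, h]

theorem linearIndependent_mono : LinearIndependent K (mono : (σ → Fin p) → DivPow K p σ) := by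
  rw [Fintype.linearIndependent_iff]
  intro c hc α
  have := congrArg (fun f => f.coef α) hc
  simpa [sum_coef, mono_coef] using this

variable [Fact p.Prime]

theorem eps_val (j i : σ) : ((eps j : σ → Fin p) i : ℕ) = if i = j then 1 else 0 := by
  rw [eps, Pi.single_apply]
  split_ifs <;> simp

theorem X_mul_coef (j : σ) (g : DivPow K p σ) (γ : σ → Fin p) :
    (X K p j * g).coef γ = if h : 1 ≤ (γ j : ℕ) then
      ((γ j : ℕ) : K) * g.coef (Function.update γ j ⟨(γ j : ℕ) - 1, by omega⟩) else 0 := by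
  have hco : ∀ β : σ → Fin p, (∀ i, ((eps j : σ → Fin p) i : ℕ) + β i = γ i) →
      coeff K (eps j) β γ = ((γ j : ℕ) : K) := by
    intro β hβ
    rw [coeff, Finset.prod_eq_single j]
    · rw [coeffOne, if_pos (hβ j), eps_val, if_pos rfl, Nat.choose_one_right]
    · intro i _ hi
      rw [coeffOne, if_pos (hβ i), eps_val, if_neg hi, Nat.choose_zero_right, Nat.cast_one]
    · simp
  have hco0 : ∀ β : σ → Fin p, ¬ (∀ i, ((eps j : σ → Fin p) i : ℕ) + β i = γ i) →
      coeff K (eps j) β γ = 0 := by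
    intro β hβ
    push Not at hβ
    obtain ⟨i, hi⟩ := hβ
    exact Finset.prod_eq_zero (Finset.mem_univ i) (if_neg hi)
  rw [mul_apply, Finset.sum_eq_single (eps j)]
  · simp only [X, mono_coef, if_true, one_mul]
    split_ifs with h
    · rw [Finset.sum_eq_single (Function.update γ j ⟨(γ j : ℕ) - 1, by omega⟩)]
      · rw [hco]
        intro i
        rw [eps_val]
        by_cases hi : i = j
        · subst hi; simp; omega
        · simp [hi]
      · intro β _ hβ
        rw [hco0, zero_mul]
        intro h'
        refine hβ (funext fun i => Fin.ext ?_)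
        have := h' i
        rw [eps_val] at this
        by_cases hi : i = j
        · subst hi; simp at this ⊢; omega
        · simp [hi] at this ⊢; omega
      · simp
    · refine Finset.sum_eq_zero fun β _ => ?_
      rw [hco0, zero_mul]
      intro h'
      have := h' j
      rw [eps_val, if_pos rfl] at this
      omega
  · intro α _ hα
    simp [X, mono_coef, hα]
  · simp

variable [CharP K p]

theorem D_coef (j : σ) (f : DivPow K p σ) (γ : σ → Fin p) :
    (D K p j f).coef γ = if h : (γ j : ℕ) + 1 < p then
      f.coef (Function.update γ j ⟨(γ j : ℕ) + 1, h⟩) else 0 := rfl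

theorem X_mul_D_coef (j : σ) (f : DivPow K p σ) (γ : σ → Fin p) :
    (X K p j * D K p j f).coef γ = ((γ j : ℕ) : K) * f.coef γ := by
  rw [X_mul_coef]
  split_ifs with h
  · rw [D_coef]
    simp only [Function.update_self, Function.update_idem]
    have h' : (γ j : ℕ) - 1 + 1 = γ j := by omega
    simp only [h', Fin.isLt, dif_pos, Fin.eta, Function.update_eq_self]
  · have : (γ j : ℕ) = 0 := by omega
    simp [this]

theorem X_mul_D_mono (j : σ) (α : σ → Fin p) :
    X K p j * D K p j (mono α) = ((α j : ℕ) : K) • mono α := by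
  refine ext' fun γ => ?_
  rw [X_mul_D_coef, smul_apply, mono_coef]
  split_ifs with h
  · rw [h]
  · simp

theorem D_mono_of_eq_zero {j : σ} {α : σ → Fin p} (h : (α j : ℕ) = 0) :
    D K p j (mono α : DivPow K p σ) = 0 := by
  refine ext' fun γ => ?_
  rw [D_coef, zero_apply]
  split_ifs with h'
  · rw [mono_coef, if_neg]
    rintro rfl
    simp at h
  · rfl

theorem D_mono_of_eq {j : σ} {α β : σ → Fin p} (h : ∀ i, (α i : ℕ) = β i + if i = j then 1 else 0) :
    D K p j (mono α : DivPow K p σ) = mono β := by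
  refine ext' fun γ => ?_
  rw [D_coef, mono_coef]
  have hj := h j
  rw [if_pos rfl] at hj
  by_cases hγ : γ = β
  · subst hγ
    have := (α j).isLt
    rw [dif_pos (by omega), mono_coef, if_pos rfl, if_pos]
    funext i
    refine Fin.ext ?_
    by_cases hi : i = j
    · subst hi; simp; omega
    · have := h i; simp [hi] at this ⊢; omega
  · rw [if_neg hγ]
    split_ifs with h'
    · rw [mono_coef, if_neg]
      rintro rfl
      refine hγ (funext fun i => Fin.ext ?_)
      have hi' := h i
      by_cases hi : i = j
      · subst hi; simp at hi'; omega
      · simp [hi] at hi'; omega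
    · rfl

/-- The multi-index `α - ε_j`. -/
def lower (α : σ → Fin p) (j : σ) : σ → Fin p :=
  Function.update α j ⟨(α j : ℕ) - 1, by omega⟩

theorem lower_self (α : σ → Fin p) (j : σ) : (lower α j j : ℕ) = α j - 1 := by simp [lower]

theorem lower_of_ne (α : σ → Fin p) {i j : σ} (h : i ≠ j) : lower α j i = α i := by
  simp [lower, h]

theorem D_mono {j : σ} {α : σ → Fin p} (h : 1 ≤ (α j : ℕ)) :
    D K p j (mono α : DivPow K p σ) = mono (lower α j) := by
  refine D_mono_of_eq fun i => ?_
  by_cases hi : i = j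
  · subst hi; simp [lower_self]; omega
  · simp [lower_of_ne α hi, hi]

theorem natCast_ne_zero_of_lt {a : ℕ} (h1 : 1 ≤ a) (h : a < p) : (a : K) ≠ 0 := by
  rw [Ne, CharP.cast_eq_zero_iff K p]
  intro hd
  exact absurd (Nat.le_of_dvd (by omega) hd) (by omega)

theorem mono_eq_X_mul {j : σ} {α : σ → Fin p} (h : 1 ≤ (α j : ℕ)) :
    (mono α : DivPow K p σ) = ((α j : ℕ) : K)⁻¹ • (X K p j * mono (lower α j)) := by
  rw [← D_mono h, X_mul_D_mono, smul_smul,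
    inv_mul_cancel₀ (natCast_ne_zero_of_lt h (α j).isLt), one_smul]

theorem X_dvd_mono {j : σ} {α : σ → Fin p} (h : 1 ≤ (α j : ℕ)) :
    X K p j ∣ (mono α : DivPow K p σ) := by
  rw [mono_eq_X_mul h]
  exact ⟨_, (mul_smul_comm _ _ _).symm⟩

theorem X_sq_dvd_mono {j : σ} {α : σ → Fin p} (h : 2 ≤ (α j : ℕ)) :
    X K p j ^ 2 ∣ (mono α : DivPow K p σ) := by
  rw [mono_eq_X_mul (show 1 ≤ (α j : ℕ) by omega), ← mul_smul_comm, sq]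
  refine mul_dvd_mul_left _ ((X_dvd_mono (j := j) (α := lower α j)
    (by rw [lower_self]; omega)).trans ?_)
  exact ⟨algebraMap K _ ((α j : ℕ) : K)⁻¹, by rw [Algebra.smul_def, mul_comm]⟩

theorem D_X (j l : σ) : D K p j (X K p l) = if j = l then 1 else 0 := by
  split_ifs with h
  · subst h
    refine D_mono_of_eq (β := fun _ => 0) fun i => ?_
    rw [eps_val]
    simp
  · exact D_mono_of_eq_zero (by rw [eps_val, if_neg h])

/-- A coefficient at `γ ≠ 0` can be read off from `D_j f` at `γ - ε_j` for any `j` with `γ_j ≥ 1`.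
-/
theorem eq_smul_one_of_D_eq_zero {f : DivPow K p σ} (h : ∀ j, D K p j f = 0) :
    f = f.coef (fun _ => 0) • 1 := by
  refine ext' fun γ => ?_
  change _ = f.coef (fun _ => 0) * if γ = fun _ => 0 then 1 else 0
  by_cases hγ : γ = fun _ => 0
  · simp [hγ]
  · obtain ⟨j, hj⟩ := Function.ne_iff.mp hγ
    have hj1 : 1 ≤ (γ j : ℕ) := by
      rcases Nat.eq_zero_or_pos (γ j : ℕ) with h0 | h0
      · exact absurd (Fin.ext h0) hj
      · exact h0
    have := congrArg (fun g => g.coef (lower γ j)) (h j)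
    simp only [D_coef, zero_apply, lower_self] at this
    have h' : (γ j : ℕ) - 1 + 1 = γ j := by omega
    rw [dif_pos (by omega)] at this
    simp only [lower, Function.update_idem, h', Fin.eta, Function.update_eq_self] at this
    rw [this, if_neg hγ, mul_zero]

/-- All `D_l` kill a `p`-th power in characteristic `p`, so it is a constant; its constant term is
zero. -/
theorem X_pow_p (j : σ) : X K p j ^ p = 0 := by
  have h : ∀ l, D K p l (X K p j ^ p) = 0 := by
    intro l
    rw [Derivation.leibniz_pow, ← Nat.cast_smul_eq_nsmul K, CharP.cast_eq_zero, zero_smul]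
  rw [eq_smul_one_of_D_eq_zero h]
  have : (X K p j ^ p).coef (fun _ => 0) = 0 := by
    rw [← mul_pow_sub_one (Fact.out : p.Prime).ne_zero, X_mul_coef]
    simp
  rw [this, zero_smul]

theorem mono_pow_p {α : σ → Fin p} (h : α ≠ fun _ => 0) : (mono α : DivPow K p σ) ^ p = 0 := by
  obtain ⟨j, hj⟩ := Function.ne_iff.mp h
  have hj1 : 1 ≤ (α j : ℕ) := by
    rcases Nat.eq_zero_or_pos (α j : ℕ) with h0 | h0
    · exact absurd (Fin.ext h0) hj
    · exact h0
  have := pow_dvd_pow_of_dvd (X_dvd_mono (K := K) hj1) p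
  rwa [X_pow_p, zero_dvd_iff] at this

/-- A map satisfying the Leibniz rule vanishes if it vanishes on the variables. -/
theorem eq_zero_of_leibniz {δ : Module.End K (DivPow K p σ)}
    (hδ : ∀ f g, δ (f * g) = f * δ g + g * δ f) (h : ∀ j, δ (X K p j) = 0) : δ = 0 := by
  refine linearMap_ext fun α => ?_
  rw [LinearMap.zero_apply]
  have h1 : δ 1 = 0 := by
    have := hδ 1 1
    simpa using this
  induction hN : ∑ i, (α i : ℕ) generalizing α with
  | zero =>
    have : α = fun _ => 0 := funext fun i =>
      Fin.ext (Finset.sum_eq_zero_iff.mp hN i (Finset.mem_univ i))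
    subst this
    exact h1
  | succ N ih =>
    obtain ⟨j, hj⟩ : ∃ j, 1 ≤ (α j : ℕ) := by
      by_contra hne
      push Not at hne
      rw [Finset.sum_eq_zero fun i _ => by have := hne i; omega] at hN
      omega
    rw [mono_eq_X_mul hj, map_smul, hδ, h, mul_zero, add_zero, ih, mul_zero, smul_zero]
    have e1 := Finset.add_sum_erase Finset.univ (fun i => (α i : ℕ)) (Finset.mem_univ j)
    have e2 := Finset.add_sum_erase Finset.univ (fun i => (lower α j i : ℕ)) (Finset.mem_univ j)
    have e3 : ∑ i ∈ Finset.univ.erase j, (lower α j i : ℕ) =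
        ∑ i ∈ Finset.univ.erase j, (α i : ℕ) :=
      Finset.sum_congr rfl fun i hi => by rw [lower_of_ne α (Finset.ne_of_mem_erase hi)]
    rw [lower_self] at e2
    omega

/-- In characteristic `p` the `p`-th power of a derivation satisfies the Leibniz rule. -/
theorem leibniz_pow_p (hp : Odd p) (δ : Derivation K (DivPow K p σ) (DivPow K p σ))
    (f g : DivPow K p σ) :
    ((δ : Module.End K (DivPow K p σ)) ^ p) (f * g) =
      f * ((δ : Module.End K (DivPow K p σ)) ^ p) g +
        g * ((δ : Module.End K (DivPow K p σ)) ^ p) f := by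
  set d : Module.End K (DivPow K p σ) := (δ : DivPow K p σ →ₗ[K] DivPow K p σ) with hd
  -- The powers of `ad d` send multiplication by `f` to multiplication by `d^m f`. In characteristic
  -- `p` also `(ad d)^p = ad (d^p)`, and comparing the two for `m = p` is the Leibniz rule.
  have h1 : ∀ m : ℕ, ((LinearMap.mulLeft K d - LinearMap.mulRight K d) ^ m)
      (LinearMap.mulLeft K f) = LinearMap.mulLeft K ((d ^ m) f) := by
    intro m
    induction m with
    | zero => simp
    | succ m ih =>
      rw [pow_succ', Module.End.mul_apply, ih]
      ext u
      simp only [LinearMap.sub_apply, LinearMap.mulLeft_apply, LinearMap.mulRight_apply,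
        Module.End.mul_apply, pow_succ']
      rw [hd, Derivation.coeFn_coe, Derivation.leibniz, smul_eq_mul, smul_eq_mul]
      ring_nf
  have h2 := ModP.sub_pow_char_algebra K p hp
    (LinearMap.commute_mulLeft_right (R := K) d d)
  have h3 := h1 p
  rw [h2, LinearMap.pow_mulLeft, LinearMap.pow_mulRight] at h3
  have h4 := LinearMap.congr_fun h3 g
  simp only [LinearMap.sub_apply, LinearMap.mulLeft_apply, LinearMap.mulRight_apply,
    Module.End.mul_apply] at h4
  rw [sub_eq_iff_eq_add] at h4
  rw [h4]
  ring

theorem derivation_pow_p_eq_zero (hp : Odd p) (δ : Derivation K (DivPow K p σ) (DivPow K p σ))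
    (h : ∀ j, ((δ : Module.End K (DivPow K p σ)) ^ p) (X K p j) = 0) :
    (δ : Module.End K (DivPow K p σ)) ^ p = 0 :=
  eq_zero_of_leibniz (leibniz_pow_p hp δ) h

theorem D_pow_p (hp : Odd p) (j : σ) :
    (D K p j : Module.End K (DivPow K p σ)) ^ p = 0 := by
  refine derivation_pow_p_eq_zero hp _ fun l => ?_
  rw [← pow_sub_mul_pow _ (Fact.out : p.Prime).two_le, Module.End.mul_apply, sq, Module.End.mul_apply]
  simp only [Derivation.coeFn_coe]
  rw [D_X]
  split_ifs <;> simp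

/-- An endomorphism which raises divisibility by powers of `g` is nilpotent if `g` is. -/
theorem pow_eq_zero_of_dvd {d : Module.End K (DivPow K p σ)} {g : DivPow K p σ} {m : ℕ}
    (h : ∀ (k : ℕ) (u : DivPow K p σ), g ^ k ∣ u → g ^ (k + 1) ∣ d u) (hg : g ^ m = 0) :
    d ^ m = 0 := by
  have h1 : ∀ (k : ℕ) (u : DivPow K p σ), g ^ k ∣ (d ^ k) u := by
    intro k u
    induction k with
    | zero => simp
    | succ k ih =>
      rw [pow_succ' d, Module.End.mul_apply]
      exact h k _ ih
  ext1 u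
  have := h1 m u
  rwa [hg, zero_dvd_iff] at this

end DivPow

/-! ### The `p`-th powers of the contact vector fields -/

namespace Contact

open CIdx DivPow

set_option linter.unusedSectionVars false

variable {K : Type*} [Field K] {p : ℕ} [Fact p.Prime] [CharP K p] {n : ℕ}

/-- A derivation of `O(2n+1; 1)`, as an endomorphism. -/
abbrev toEnd (d : W K p n) : Module.End K (O K p n) := (d : O K p n →ₗ[K] O K p n)

/-- The total degree of a multi-index in the variables other than `x_0`. -/
def sdeg (α : CIdx n → Fin p) : ℕ := ∑ i : Fin n, ((α (pos i) : ℕ) + (α (neg i) : ℕ))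

theorem euler_mono (α : CIdx n → Fin p) :
    euler (mono α : O K p n) = (sdeg α : K) • mono α := by
  rw [euler_apply, sdeg, Nat.cast_sum, Finset.sum_smul]
  refine Finset.sum_congr rfl fun i _ => ?_
  rw [X_mul_D_mono, X_mul_D_mono, Nat.cast_add, add_smul]

theorem pois_self (f : O K p n) : pois f f = 0 :=
  Finset.sum_eq_zero fun i _ => by ring

/-- The Hamiltonian vector field `{f, ·}`. -/
def ham (f : O K p n) : W K p n :=
  ∑ i : Fin n, (D K p (neg i) f • D K p (pos i) - D K p (pos i) f • D K p (neg i))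

theorem ham_apply (f g : O K p n) : ham f g = pois f g := by
  simp [ham, pois, sum_apply']

theorem pois_mul_right (f g h : O K p n) : pois f (g * h) = g * pois f h + h * pois f g := by
  rw [← ham_apply, Derivation.leibniz, ham_apply, ham_apply, smul_eq_mul, smul_eq_mul]

theorem pois_X_zero (f : O K p n) : pois f (X K p zero) = 0 := by
  simp [pois, X_apply]

theorem pois_mul_left (f g h : O K p n) : pois (f * g) h = f * pois g h + g * pois f h := by
  rw [pois_swap h (f * g), pois_mul_right, pois_swap g h, pois_swap f h]
  ring

theorem X_pow_dvd_D {j l : CIdx n} (h : l ≠ j) {m : ℕ} {u : O K p n} (hu : X K p j ^ m ∣ u) :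
    X K p j ^ m ∣ D K p l u := by
  obtain ⟨v, rfl⟩ := hu
  rw [Derivation.leibniz, Derivation.leibniz_pow, D_X, if_neg h]
  simp

theorem X_pow_dvd_X_mul_D (j l : CIdx n) {m : ℕ} {u : O K p n} (hu : X K p j ^ m ∣ u) :
    X K p j ^ m ∣ X K p j * D K p l u := by
  obtain ⟨v, rfl⟩ := hu
  rcases m with _ | m
  · simp
  · rw [Derivation.leibniz, Derivation.leibniz_pow, Nat.add_sub_cancel, mul_add]
    refine dvd_add ?_ ?_
    · rw [smul_eq_mul]
      exact (dvd_mul_right _ _).mul_left _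
    · refine ⟨((m + 1 : ℕ) : O K p n) * v * D K p l (X K p j), ?_⟩
      rw [smul_eq_mul, smul_eq_mul, nsmul_eq_mul]
      ring

theorem X_pow_dvd_D_succ (j l : CIdx n) {m : ℕ} {u : O K p n} (hu : X K p j ^ (m + 1) ∣ u) :
    X K p j ^ m ∣ D K p l u := by
  obtain ⟨v, rfl⟩ := hu
  rw [Derivation.leibniz, Derivation.leibniz_pow, Nat.add_sub_cancel]
  refine dvd_add ?_ ?_
  · rw [smul_eq_mul, pow_succ, mul_assoc]
    exact dvd_mul_right _ _
  · refine ⟨((m + 1 : ℕ) : O K p n) * v * D K p l (X K p j), ?_⟩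
    rw [smul_eq_mul, smul_eq_mul, nsmul_eq_mul]
    ring

theorem DK_apply_eq_sum (f g : O K p n) : DK f g = ∑ l, dkCoef f l * D K p l g := by
  change (∑ j, dkCoef f j • D K p j) g = _
  rw [sum_apply']
  rfl

/-- Every coefficient of `D_K(f)` is divisible by `x_j`, and the coefficient of `D_j` even by
`x_j^2`. So the field raises the order in `x_j`, and `x_j^p = 0`. -/
theorem DK_pow_p_of_X_sq_dvd {j : CIdx n} {f : O K p n} (hf : X K p j ^ 2 ∣ f) :
    toEnd (DK f) ^ p = 0 := by
  have h1 : ∀ l, X K p j ∣ D K p l f := fun l => by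
    have := X_pow_dvd_D_succ j l (m := 1) hf
    rwa [pow_one] at this
  have hX : X K p j ∣ f := (Dvd.intro_left _ (sq (X K p j)).symm).trans hf
  have hco : ∀ l, X K p j ∣ dkCoef f l := by
    intro l
    rcases l with _ | i | i
    · rw [dkCoef, two_smul]
      refine dvd_sub (dvd_add hX hX) (Finset.dvd_sum fun i _ => ?_)
      exact dvd_add ((h1 _).mul_left _) ((h1 _).mul_left _)
    · exact dvd_add ((h1 _).mul_right _) (h1 _)
    · exact dvd_sub ((h1 _).mul_right _) (h1 _)
  have hco2 : X K p j ^ 2 ∣ dkCoef f j := by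
    rcases j with _ | i | i
    · rw [dkCoef, two_smul]
      refine dvd_sub (dvd_add hf hf) (Finset.dvd_sum fun i _ => ?_)
      exact dvd_add ((X_pow_dvd_D (by simp) hf).mul_left _)
        ((X_pow_dvd_D (by simp) hf).mul_left _)
    · exact dvd_add ((X_pow_dvd_D (by simp) hf).mul_right _) (X_pow_dvd_D (by simp) hf)
    · exact dvd_sub ((X_pow_dvd_D (by simp) hf).mul_right _) (X_pow_dvd_D (by simp) hf)
  refine pow_eq_zero_of_dvd (g := X K p j) (fun k u hu => ?_) (X_pow_p j)
  change _ ∣ DK f u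
  rw [DK_apply_eq_sum]
  refine Finset.dvd_sum fun l _ => ?_
  by_cases hl : l = j
  · subst hl
    obtain ⟨c, hc⟩ := hco2
    rw [hc, pow_succ', sq]
    rw [show X K p l * X K p l * c * D K p l u = X K p l * (c * (X K p l * D K p l u)) by ring]
    exact mul_dvd_mul_left _ ((X_pow_dvd_X_mul_D l l hu).mul_left _)
  · rw [pow_succ']
    exact mul_dvd_mul (hco l) (X_pow_dvd_D hl hu)

theorem toEnd_add_pow_p {d₁ d₂ : W K p n} (h : ∀ u, d₁ (d₂ u) = d₂ (d₁ u))
    (h₁ : toEnd d₁ ^ p = 0) (h₂ : toEnd d₂ ^ p = 0) : toEnd (d₁ + d₂) ^ p = 0 := by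
  have hc : Commute (toEnd d₁) (toEnd d₂) := LinearMap.ext h
  have e : toEnd (d₁ + d₂) = toEnd d₁ + toEnd d₂ := rfl
  rw [e, ModP.add_pow_char_algebra K p hc, h₁, h₂, add_zero]

theorem euler_X_zero : euler (X K p (zero : CIdx n)) = 0 := by
  simp [euler_apply, X_apply]

/-- With `g` free of `x_0` and `E g = d g`, the field splits as `A + B`, where `A = g ((2 - d) x_0
D_0 + E)` and `B = x_0 {g, ·}` commute. `A` raises divisibility by powers of `g` and `B` that by
powers of `x_0`, and both have vanishing `p`-th powers. -/
theorem DK_X_zero_mul_pow_p {β : CIdx n → Fin p} (h0 : (β zero : ℕ) = 0) (hβ : β ≠ fun _ => 0) :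
    toEnd (DK (X K p zero * mono β)) ^ p = 0 := by
  set g : O K p n := mono β
  set x₀ : O K p n := X K p zero with hx₀
  set d : O K p n := algebraMap K _ (sdeg β : K) with hd
  have hD0 : D K p zero g = 0 := D_mono_of_eq_zero h0
  have hDx : D K p zero x₀ = 1 := by rw [hx₀, D_X, if_pos rfl]
  have hDd : ∀ δ : W K p n, δ d = 0 := fun δ => δ.map_algebraMap _
  have hpd : ∀ f, pois f d = 0 := fun f => by rw [← ham_apply, hDd]
  have hpx : ∀ f, pois f x₀ = 0 := pois_X_zero
  have hE : euler g = d * g := by rw [euler_mono, Algebra.smul_def]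
  have hXE : euler x₀ = 0 := euler_X_zero
  let A : W K p n := ((2 - d) * (x₀ * g)) • D K p zero + g • euler
  let B : W K p n := x₀ • ham g
  have hA : ∀ u, A u = g * ((2 - d) * x₀ * D K p zero u + euler u) := by
    intro u
    simp only [A, Derivation.add_apply, Derivation.smul_apply, smul_eq_mul]
    ring
  have hB : ∀ u, B u = x₀ * pois g u := by
    intro u
    simp only [B, Derivation.smul_apply, smul_eq_mul, ham_apply]
  have hsum : DK (x₀ * g) = A + B := by
    refine Derivation.ext fun u => ?_
    rw [Derivation.add_apply, hA, hB, DK_apply, pois_mul_left, Derivation.leibniz,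
      Derivation.leibniz, hD0, hE, hXE, hDx, pois_swap u x₀, hpx]
    simp only [smul_eq_mul]
    ring
  rw [hsum]
  refine toEnd_add_pow_p (fun u => ?_) ?_ ?_
  -- The term with `2 - d` coming from `D_0 x_0 = 1` cancels against `d - 2`, which arises because
  -- `E` acts on the bracket as a derivation up to `-2`.
  · have e1 : pois (d * g) u = d * pois g u := by
      rw [pois_mul_left, pois_swap u d, hpd]
      ring
    have e2 : pois g (2 - d) = 0 := by
      rw [← ham_apply, map_sub, D_two, hDd, sub_zero]
    rw [hA, hB, hB, hA]
    simp only [pois_mul_right, Derivation.leibniz, hDx, hXE, pois_self, D_pois, hD0,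
      euler_pois, hE, e1, ← ham_apply g (_ + _), map_add, smul_eq_mul]
    simp only [ham_apply, hpx, e2]
    have e3 : pois 0 u = 0 := by simp [pois]
    rw [e3]
    ring
  · refine pow_eq_zero_of_dvd (g := g) (fun k u hu => ?_) (mono_pow_p hβ)
    obtain ⟨v, rfl⟩ := hu
    change _ ∣ A _
    rw [hA, pow_succ']
    refine mul_dvd_mul_left _ ?_
    have e4 : euler (g ^ k) = k * d * g ^ k := by
      rw [Derivation.leibniz_pow, hE, smul_eq_mul, nsmul_eq_mul]
      rcases k with _ | k
      · simp
      · rw [Nat.add_sub_cancel]; ring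
    have e5 : D K p zero (g ^ k) = 0 := by
      rw [Derivation.leibniz_pow, hD0]; simp
    rw [Derivation.leibniz, Derivation.leibniz, e4, e5]
    refine ⟨(2 - d) * x₀ * D K p zero v + euler v + k * d * v, ?_⟩
    simp only [smul_eq_mul]
    ring
  · refine pow_eq_zero_of_dvd (g := x₀) (fun k u hu => ?_) (X_pow_p _)
    obtain ⟨v, rfl⟩ := hu
    change _ ∣ B _
    rw [hB, pow_succ']
    refine mul_dvd_mul_left _ ?_
    rw [pois_mul_right, ← ham_apply g (x₀ ^ k), Derivation.leibniz_pow, ham_apply, hpx]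
    simp

/-- The multi-index `-j`, for `j ≠ 0`. -/
abbrev opp (s : Fin n ⊕ Fin n) : Fin n ⊕ Fin n := s.swap

/-- The sign of an index. -/
def sgn (s : Fin n ⊕ Fin n) : O K p n := Sum.elim (fun _ => 1) (fun _ => -1) s

theorem pois_X_some (f : O K p n) (s : Fin n ⊕ Fin n) :
    pois f (X K p (some s)) = sgn s * D K p (some (opp s)) f := by
  rcases s with i | i
  · rw [pois_X_pos]; simp [sgn]
  · rw [pois_X_neg]; simp [sgn]

theorem opp_ne (s : Fin n ⊕ Fin n) : opp s ≠ s := by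
  rcases s with i | i <;> simp [opp]

/-- It suffices to test on variables. If `f = x_{-s} a` with `a` free of `x_s`, applying the field
twice kills `x_s`. If `f = x_{-s} x_s r`, then `{f, x_s} = ± x_s r` and `{f, r} = 0`, so the
iterates are `± x_s r^m`. -/
theorem ham_pow_p (hp : Odd p) {α : CIdx n → Fin p} (hα : ∀ j, (α j : ℕ) ≤ 1)
    (h1 : ∀ i : Fin n, α ≠ eps (pos i) + eps (neg i)) :
    toEnd (ham (mono α : O K p n)) ^ p = 0 := by
  set f : O K p n := mono α with hf
  have hsq : ∀ u, ham f (ham f u) = 0 → (toEnd (ham f) ^ p) u = 0 := by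
    intro u hu
    rw [← pow_sub_mul_pow _ (Fact.out : p.Prime).two_le, Module.End.mul_apply, sq,
      Module.End.mul_apply]
    change (toEnd (ham f) ^ (p - 2)) (ham f (ham f u)) = 0
    rw [hu, map_zero]
  have hsgn : ∀ (s : Fin n ⊕ Fin n) (δ : W K p n), δ (sgn s) = 0 := by
    intro s δ
    rcases s with i | i <;> simp [sgn]
  refine derivation_pow_p_eq_zero hp _ fun j => ?_
  rcases j with _ | s
  · refine hsq _ ?_
    rw [ham_apply f (X K p none), pois_X_zero, map_zero]
  set s' := opp s with hs'
  have hss : opp s' = s := by simp [hs', opp]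
  have hne : (some s : CIdx n) ≠ some s' := fun h => opp_ne s (Option.some_injective _ h).symm
  by_cases hs1 : (α (some s') : ℕ) = 0
  · refine hsq _ ?_
    rw [ham_apply f (X K p (some s)), pois_X_some, D_mono_of_eq_zero hs1, mul_zero, map_zero]
  have hs1 : (α (some s') : ℕ) = 1 := by have := hα (some s'); omega
  set a : O K p n := mono (lower α (some s')) with ha
  have hfa : f = X K p (some s') * a := by
    rw [hf, mono_eq_X_mul (j := some s') (by omega), hs1, Nat.cast_one, inv_one, one_smul]
  have hDa : D K p (some s') a = 0 := D_mono_of_eq_zero (by rw [lower_self, hs1])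
  have hX : ham f (X K p (some s)) = sgn s * a := by
    rw [ham_apply, pois_X_some, ha, ← D_mono (by omega)]
  by_cases hs2 : (α (some s) : ℕ) = 0
  · refine hsq _ ?_
    have hDa' : D K p (some s) a = 0 := D_mono_of_eq_zero (by rw [lower_of_ne α hne, hs2])
    rw [hX, Derivation.leibniz, hsgn, smul_zero, add_zero, ham_apply, hfa, pois_mul_left, pois_self,
      pois_swap a, pois_X_some, hss, hDa']
    simp
  have hs2 : (α (some s) : ℕ) = 1 := by have := hα (some s); omega
  set r : O K p n := mono (lower (lower α (some s')) (some s)) with hr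
  have hval : (lower α (some s') (some s) : ℕ) = 1 := by rw [lower_of_ne α hne, hs2]
  have har : a = X K p (some s) * r := by
    rw [ha, mono_eq_X_mul (j := some s) (by omega), hval, Nat.cast_one, inv_one, one_smul]
  have hDr : D K p (some s) r = 0 := D_mono_of_eq_zero (by rw [lower_self, hval])
  have hDr' : D K p (some s') r = 0 := D_mono_of_eq_zero (by
    rw [lower_of_ne _ hne.symm, lower_self, hs1])
  -- The excluded exponents `ε_i + ε_{-i}` are exactly those with `r = 1`.
  have hrp : r ^ p = 0 := by
    refine mono_pow_p fun hz => ?_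
    have key : α = eps (some s) + eps (some s') := by
      funext l
      refine Fin.ext ?_
      have hzl := congrArg Fin.val (congrFun hz l)
      simp only [Fin.val_zero] at hzl
      have hp1 := (Fact.out : p.Prime).one_lt
      rw [Pi.add_apply, Fin.val_add, eps_val, eps_val]
      by_cases hl : l = some s
      · subst hl
        rw [if_pos rfl, if_neg hne, hs2, Nat.mod_eq_of_lt (by omega)]
      · by_cases hl' : l = some s'
        · subst hl'
          rw [if_pos rfl, if_neg hne.symm, hs1, Nat.mod_eq_of_lt (by omega)]
        · rw [lower_of_ne _ hl, lower_of_ne _ hl'] at hzl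
          rw [if_neg hl, if_neg hl', hzl]
          simp
    rcases s with i | i
    · exact h1 i key
    · exact h1 i (key.trans (add_comm _ _))
  have hhr : ham f r = 0 := by
    rw [ham_apply, hfa, har, pois_mul_left, pois_mul_left, pois_self, pois_swap r, pois_X_some,
      pois_swap r, pois_X_some, hss, hDr, ← hs', hDr']
    simp
  have hiter : ∀ m : ℕ, (toEnd (ham f) ^ m) (X K p (some s)) =
      sgn s ^ m * X K p (some s) * r ^ m := by
    intro m
    induction m with
    | zero => simp
    | succ m ih =>
      rw [pow_succ', Module.End.mul_apply, ih]
      change ham f _ = _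
      rw [Derivation.leibniz, Derivation.leibniz, Derivation.leibniz_pow, Derivation.leibniz_pow,
        hhr, hsgn, hX, har]
      simp only [smul_eq_mul, smul_zero, mul_zero, zero_add, add_zero]
      ring
  change (toEnd (ham f) ^ p) _ = 0
  rw [hiter, hrp, mul_zero]

/-- Without `x_0` the field is `(2 - d) f D_0 + {f, ·}`. The summands commute because `{f, f} = 0`
and `D_0 f = 0`, and the first has `p`-th power `((2 - d) f)^p D_0^p = 0`. -/
theorem DK_pow_p_of_zero (hp : Odd p) {α : CIdx n → Fin p} (hα : ∀ j, (α j : ℕ) ≤ 1)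
    (h0 : (α zero : ℕ) = 0) (h1 : ∀ i : Fin n, α ≠ eps (pos i) + eps (neg i)) :
    toEnd (DK (mono α : O K p n)) ^ p = 0 := by
  set f : O K p n := mono α with hf
  set d : O K p n := algebraMap K _ (sdeg α : K) with hd
  have hDd : ∀ δ : W K p n, δ d = 0 := fun δ => δ.map_algebraMap _
  have hD0 : D K p zero f = 0 := D_mono_of_eq_zero h0
  have hE : euler f = d * f := by rw [hf, euler_mono, Algebra.smul_def]
  have hc : ∀ δ : W K p n, δ (2 - d) = 0 := fun δ => by rw [map_sub, D_two, hDd, sub_zero]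
  let C : W K p n := ((2 - d) * f) • D K p zero
  have hC : ∀ u, C u = (2 - d) * f * D K p zero u := fun u => rfl
  have hsum : DK f = C + ham f := by
    refine Derivation.ext fun u => ?_
    rw [Derivation.add_apply, ham_apply, DK_apply, hC, hE, hD0]
    ring
  rw [hsum]
  refine toEnd_add_pow_p (fun u => ?_) ?_ (ham_pow_p hp hα h1)
  · have e3 : pois 0 u = 0 := by simp [pois]
    rw [hC, hC, Derivation.leibniz, Derivation.leibniz, hc, ham_apply, D_pois, hD0, e3, ham_apply,
      ham_apply, pois_self]
    simp
  · have hiter : ∀ m : ℕ, ∀ u, (toEnd C ^ m) u =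
        ((2 - d) * f) ^ m * (toEnd (D K p zero) ^ m) u := by
      intro m
      induction m with
      | zero => simp
      | succ m ih =>
        intro u
        have e : D K p zero (((2 - d) * f) ^ m) = 0 := by
          rw [Derivation.leibniz_pow, Derivation.leibniz, hc, hD0]
          simp
        rw [pow_succ', Module.End.mul_apply, ih]
        change C _ = _
        rw [hC, Derivation.leibniz, e, pow_succ' (toEnd (D K p zero)), Module.End.mul_apply]
        change _ = _ * D K p zero _
        simp only [smul_eq_mul]
        ring
    ext1 u
    rw [hiter, show toEnd (D K p zero) ^ p = 0 from D_pow_p hp zero]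
    simp

theorem DK_mono_pow_p_eq_zero (hp : Odd p) {α : CIdx n → Fin p}
    (h1 : ∀ i : Fin n, α ≠ eps (pos i) + eps (neg i)) (h0 : α ≠ eps zero) :
    toEnd (DK (mono α : O K p n)) ^ p = 0 := by
  by_cases hα : ∃ j, 2 ≤ (α j : ℕ)
  · obtain ⟨j, hj⟩ := hα
    exact DK_pow_p_of_X_sq_dvd (X_sq_dvd_mono hj)
  push Not at hα
  by_cases hz : (α zero : ℕ) = 0
  · exact DK_pow_p_of_zero hp (fun j => by have := hα j; omega) hz h1
  · have hz1 : (α zero : ℕ) = 1 := by have := hα zero; omega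
    rw [mono_eq_X_mul (j := zero) (by omega), hz1, Nat.cast_one, inv_one, one_smul]
    refine DK_X_zero_mul_pow_p (by rw [lower_self, hz1]) fun hc => h0 (funext fun l => Fin.ext ?_)
    have hcl := congrArg Fin.val (congrFun hc l)
    simp only [Fin.val_zero] at hcl
    rw [eps_val]
    by_cases hl : l = zero
    · subst hl; rw [if_pos rfl, hz1]
    · rw [if_neg hl, ← hcl, lower_of_ne α hl]

theorem eps_add_eps_val {j l : CIdx n} (h : j ≠ l) (i : CIdx n) :
    ((eps j + eps l : CIdx n → Fin p) i : ℕ) =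
      (if i = j then 1 else 0) + if i = l then 1 else 0 := by
  have hp1 := (Fact.out : p.Prime).one_lt
  rw [Pi.add_apply, Fin.val_add, eps_val, eps_val, Nat.mod_eq_of_lt]
  split_ifs with h1 h2
  · exact absurd (h1.symm.trans h2) h
  all_goals omega

theorem D_mono_pair_left {j l : CIdx n} (h : j ≠ l) :
    D K p j (mono (eps j + eps l) : O K p n) = X K p l :=
  D_mono_of_eq fun i => by rw [eps_add_eps_val h, eps_val, add_comm]

theorem D_mono_pair_right {j l : CIdx n} (h : j ≠ l) :
    D K p l (mono (eps j + eps l) : O K p n) = X K p j :=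
  D_mono_of_eq fun i => by rw [eps_add_eps_val h, eps_val]

theorem D_mono_pair_of_ne {j l m : CIdx n} (h : j ≠ l) (h1 : m ≠ j) (h2 : m ≠ l) :
    D K p m (mono (eps j + eps l) : O K p n) = 0 :=
  D_mono_of_eq_zero (by rw [eps_add_eps_val h, if_neg h1, if_neg h2])

theorem pos_ne_neg (i l : Fin n) : (pos i : CIdx n) ≠ neg l := by simp

theorem pois_pair (k : Fin n) (g : O K p n) :
    pois (mono (eps (pos k) + eps (neg k))) g =
      X K p (pos k) * D K p (pos k) g - X K p (neg k) * D K p (neg k) g := by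
  rw [pois, Finset.sum_eq_single k]
  · rw [D_mono_pair_left (pos_ne_neg k k), D_mono_pair_right (pos_ne_neg k k)]
  · intro i _ hi
    rw [D_mono_pair_of_ne (pos_ne_neg k k) (pos_ne_neg k i).symm (by simpa using hi),
      D_mono_pair_of_ne (pos_ne_neg k k) (by simpa using hi) (pos_ne_neg i k)]
    ring
  · simp

theorem euler_pair (k : Fin n) : euler (mono (eps (pos k) + eps (neg k)) : O K p n) =
    2 * mono (eps (pos k) + eps (neg k)) := by
  have h : sdeg (eps (pos k) + eps (neg k) : CIdx n → Fin p) = 2 := by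
    have h1 : ∀ i : Fin n, ((eps (pos k) + eps (neg k) : CIdx n → Fin p) (pos i) : ℕ) =
        if i = k then 1 else 0 := fun i => by
      rw [eps_add_eps_val (pos_ne_neg k k)]
      simp
    have h2 : ∀ i : Fin n, ((eps (pos k) + eps (neg k) : CIdx n → Fin p) (neg i) : ℕ) =
        if i = k then 1 else 0 := fun i => by
      rw [eps_add_eps_val (pos_ne_neg k k)]
      simp
    simp only [sdeg, h1, h2, Finset.sum_add_distrib, Finset.sum_ite_eq', Finset.mem_univ, if_true]
  rw [euler_mono, h, two_mul, Nat.cast_ofNat, two_smul]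

theorem D_zero_pair (k : Fin n) : D K p zero (mono (eps (pos k) + eps (neg k)) : O K p n) = 0 :=
  D_mono_pair_of_ne (pos_ne_neg k k) (by simp) (by simp)

/-- The eigenvalues lie in the prime field, where `c^p = c`. -/
theorem pow_p_of_diagonal {d : Module.End K (O K p n)} (c : (CIdx n → Fin p) → ℤ)
    (h : ∀ γ, d (mono γ) = (c γ : K) • mono γ) : d ^ p = d := by
  refine linearMap_ext fun γ => ?_
  have h1 : ∀ m : ℕ, (d ^ m) (mono γ) = (c γ : K) ^ m • mono γ := by
    intro m
    induction m with
    | zero => simp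
    | succ m ih => rw [pow_succ', Module.End.mul_apply, ih, map_smul, h, smul_smul, pow_succ]
  have h2 : (c γ : K) ^ p = c γ := by
    have := congrArg (ModP.sc K p) (ZMod.pow_card (c γ : ZMod p))
    rwa [map_pow, map_intCast] at this
  rw [h1, h2, h]

theorem DK_pair_pow_p (k : Fin n) :
    toEnd (DK (mono (eps (pos k) + eps (neg k)) : O K p n)) ^ p =
      toEnd (DK (mono (eps (pos k) + eps (neg k)) : O K p n)) := by
  refine pow_p_of_diagonal (fun γ => (γ (pos k) : ℕ) - (γ (neg k) : ℕ)) fun γ => ?_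
  change DK _ (mono γ) = _
  rw [DK_apply, euler_pair, D_zero_pair, pois_pair, X_mul_D_mono, X_mul_D_mono, sub_self, zero_mul,
    zero_mul, zero_add, zero_add, ← sub_smul]
  push_cast
  rfl

theorem DK_zero_pow_p :
    toEnd (DK (mono (eps zero) : O K p n)) ^ p = toEnd (DK (mono (eps zero) : O K p n)) := by
  refine pow_p_of_diagonal (fun γ => (2 * (γ zero : ℕ) + sdeg γ : ℕ)) fun γ => ?_
  change DK (X K p zero) (mono γ) = _
  have h1 : pois (X K p zero) (mono γ : O K p n) = 0 := by rw [pois_swap, pois_X_zero, neg_zero]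
  rw [DK_apply, euler_X_zero, D_X, if_pos rfl, h1, euler_mono, sub_zero, mul_assoc, X_mul_D_mono,
    one_mul, add_zero]
  push_cast
  rw [add_smul, mul_smul, two_mul, two_smul]

end Contact

/-! ### The contact algebra -/

namespace Contact

open CIdx DivPow

set_option linter.unusedSectionVars false

variable {K : Type*} [Field K] {p : ℕ} [Fact p.Prime] [CharP K p] {n : ℕ}

theorem two_ne_zero_of_odd (hp : Odd p) : (2 : K) ≠ 0 := by
  have h2 := (Fact.out : p.Prime).two_le
  have : p ≠ 2 := by rintro rfl; exact absurd hp (by decide)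
  have := natCast_ne_zero_of_lt (K := K) (p := p) (a := 2) (by omega) (by omega)
  simpa using this

theorem DK_apply_X (f : O K p n) (l : CIdx n) : DK f (X K p l) = dkCoef f l := by
  rw [DK_apply_eq_sum, Finset.sum_eq_single l]
  · rw [D_X, if_pos rfl, mul_one]
  · intro j _ hj
    rw [D_X, if_neg hj, mul_zero]
  · simp

theorem DK_injective (hp : Odd p) : Function.Injective (DK : O K p n →ₗ[K] W K p n) := by
  rw [injective_iff_map_eq_zero]
  intro f hf
  have h : ∀ l, dkCoef f l = 0 := fun l => by rw [← DK_apply_X, hf, Derivation.zero_apply]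
  -- In `x_{-i}` times the coefficient of `D_i` minus `x_i` times that of `D_{-i}`, the terms with
  -- `D_0 f` cancel and the `i`-th summand of `E f` remains. The coefficient of `D_0` then reads `2
  -- f = 0`.
  have hE : euler f = 0 := by
    rw [euler_apply]
    refine Finset.sum_eq_zero fun i _ => ?_
    have h1 : D K p zero f * X K p (pos i) + D K p (neg i) f = 0 := h (pos i)
    have h2 : D K p zero f * X K p (neg i) - D K p (pos i) f = 0 := h (neg i)
    linear_combination X K p (neg i) * h1 - X K p (pos i) * h2
  have h0 := h zero
  rw [dkCoef_zero, hE, sub_zero, two_mul, ← two_smul K] at h0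
  exact (smul_eq_zero.mp h0).resolve_left (two_ne_zero_of_odd hp)

/-- `D_K`, as a map to `K'(2n+1; 1)`. -/
def DKPrime : O K p n →ₗ[K] contactPrime K p n :=
  LinearMap.codRestrict (contactPrime K p n).toSubmodule DK fun f => ⟨f, rfl⟩

theorem coe_DKPrime (f : O K p n) : ((DKPrime f : contactPrime K p n) : W K p n) = DK f := rfl

theorem exists_DKPrime (x : contactPrime K p n) : ∃ f, DKPrime f = x := by
  obtain ⟨_, f, rfl⟩ := x
  exact ⟨f, rfl⟩

theorem lie_DKPrime (f g : O K p n) : ⁅DKPrime f, DKPrime g⁆ = DKPrime (contactBracket f g) :=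
  Subtype.ext (lie_DK f g)

theorem derivedSeries_one_eq_span :
    (LieAlgebra.derivedSeries K (contactPrime K p n) 1).toSubmodule =
      Submodule.span K {x | ∃ f g : O K p n, DKPrime (contactBracket f g) = x} := by
  rw [LieAlgebra.derivedSeries_def, LieAlgebra.derivedSeriesOfIdeal_succ,
    LieAlgebra.derivedSeriesOfIdeal_zero, LieSubmodule.lieIdeal_oper_eq_linear_span']
  congr 1
  ext x
  constructor
  · rintro ⟨y, -, z, -, rfl⟩
    obtain ⟨f, rfl⟩ := exists_DKPrime y
    obtain ⟨g, rfl⟩ := exists_DKPrime z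
    exact ⟨f, g, (lie_DKPrime f g).symm⟩
  · rintro ⟨f, g, rfl⟩
    exact ⟨DKPrime f, LieSubmodule.mem_top _, DKPrime g, LieSubmodule.mem_top _, lie_DKPrime f g⟩

variable (K p n) in
/-- The functions `f` with `D_K(f)` in the contact algebra. -/
def derivedFun : Submodule K (O K p n) :=
  (LieAlgebra.derivedSeries K (contactPrime K p n) 1).toSubmodule.comap DKPrime

theorem contactBracket_mem (f g : O K p n) : contactBracket f g ∈ derivedFun K p n := by
  change DKPrime _ ∈ (LieAlgebra.derivedSeries K (contactPrime K p n) 1).toSubmodule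
  rw [derivedSeries_one_eq_span]
  exact Submodule.subset_span ⟨f, g, rfl⟩

theorem D_zero_mem (hp : Odd p) (g : O K p n) : D K p zero g ∈ derivedFun K p n := by
  have h := contactBracket_mem 1 g
  have e : contactBracket 1 g = (2 : K) • D K p zero g := by
    simp only [contactBracket, pois, Derivation.map_one_eq_zero]
    simp [two_smul, two_mul]
  rw [e] at h
  exact (Submodule.smul_mem_iff _ (two_ne_zero_of_odd hp)).mp h

/-- Bracketing with the opposite variable `x_{-s}` gives `D_0(x_{-s} g)` up to `± D_s g`, and the
former already comes from the bracket with `1`. -/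
theorem D_mem (hp : Odd p) (j : CIdx n) (g : O K p n) : D K p j g ∈ derivedFun K p n := by
  rcases j with _ | s
  · exact D_zero_mem hp g
  · have h := contactBracket_mem (X K p (some (opp s))) g
    have hx : D K p zero (X K p (some (opp s)) : O K p n) = 0 := by rw [D_X, if_neg (by simp)]
    have e : contactBracket (X K p (some (opp s))) g =
        D K p zero (X K p (some (opp s)) * g) - sgn (opp s) * D K p (some s) g := by
      rw [contactBracket, euler_X, Derivation.leibniz, hx, pois_swap g, pois_X_some, smul_eq_mul,
        smul_eq_mul, show opp (opp s) = s by simp [opp]]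
      ring
    rw [e] at h
    have h2 := Submodule.sub_mem _ (D_zero_mem hp (X K p (some (opp s)) * g)) h
    rw [sub_sub_cancel] at h2
    rcases s with i | i
    · simpa [sgn, opp] using h2
    · simpa [sgn, opp] using h2

theorem tau_val (i : CIdx n) : ((tau : CIdx n → Fin p) i : ℕ) = p - 1 := rfl

theorem natCast_pred : ((p - 1 : ℕ) : K) = -1 := by
  rw [Nat.cast_sub (Fact.out : p.Prime).one_le, CharP.cast_eq_zero, zero_sub, Nat.cast_one]

/-- If some `α_j < p - 1` then `x^(α) = D_j x^(α + ε_j)`. For `α = τ`, bracketing with `x_0`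
multiplies `x^(τ)` by `2 + 2n + 2`, because `p - 1 = -1` in `K`. -/
theorem mono_mem (hp : Odd p) {α : CIdx n → Fin p} (hα : p ∣ 2 * n + 4 → α ≠ tau) :
    mono α ∈ derivedFun K p n := by
  by_cases h : α = tau
  · have hn : ¬ p ∣ 2 * n + 4 := fun hd => hα hd h
    have hc : ((2 * n + 4 : ℕ) : K) ≠ 0 := by rwa [Ne, CharP.cast_eq_zero_iff K p]
    have hsd : (sdeg (tau : CIdx n → Fin p) : K) = -(2 * n) := by
      simp only [sdeg, tau_val, Finset.sum_const, Finset.card_univ, Fintype.card_fin, nsmul_eq_mul,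
        Nat.cast_mul, Nat.cast_add, natCast_pred, Nat.cast_id]
      ring
    have hb := contactBracket_mem (mono tau) (X K p (zero : CIdx n))
    have e : contactBracket (mono tau) (X K p (zero : CIdx n)) =
        ((2 * n + 4 : ℕ) : K) • mono tau := by
      rw [contactBracket, euler_X_zero, D_X, if_pos rfl, pois_X_zero, euler_mono, sub_zero,
        mul_assoc, X_mul_D_mono, hsd, tau_val, natCast_pred]
      simp only [Algebra.smul_def]
      push_cast
      simp only [map_ofNat]
      ring
    rw [e] at hb
    rw [h]
    exact (Submodule.smul_mem_iff _ hc).mp hb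
  · obtain ⟨j, hj⟩ := Function.ne_iff.mp h
    have hj' : (α j : ℕ) + 1 < p := by
      have := (α j).isLt
      have h' : (α j : ℕ) ≠ p - 1 := fun h' => hj (Fin.ext h')
      omega
    have e : D K p j (mono (Function.update α j ⟨α j + 1, hj'⟩) : O K p n) = mono α := by
      refine D_mono_of_eq fun i => ?_
      by_cases hi : i = j
      · subst hi; simp
      · simp [hi]
    rw [← e]
    exact D_mem hp j _

theorem D_coef_tau (j : CIdx n) (f : O K p n) : (D K p j f).coef tau = 0 := by
  rw [D_coef, dif_neg]
  rw [tau_val]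
  have := (Fact.out : p.Prime).pos
  omega

/-- Integration by parts: modulo images of the `D_j`, each of the `2n` nonzero indices contributes
one `f D_0 g`, and the remaining `4` comes from the terms with `2f` and `2g`. Since no `D_j` reaches
`x^(τ)`, this decides whether `x^(τ)` is in the derived algebra. -/
theorem contactBracket_eq (f g : O K p n) : contactBracket f g =
    (2 * n + 4 : ℕ) • (f * D K p zero g) + D K p zero (f * euler g - 2 * (f * g)) +
      ∑ i : Fin n, (D K p (neg i) (f * D K p (pos i) g) - D K p (pos i) (f * D K p (neg i) g) -
        D K p (pos i) (X K p (pos i) * (f * D K p zero g)) -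
        D K p (neg i) (X K p (neg i) * (f * D K p zero g))) := by
  have h1 : ∑ i : Fin n, (D K p (neg i) (f * D K p (pos i) g) -
      D K p (pos i) (f * D K p (neg i) g) -
      D K p (pos i) (X K p (pos i) * (f * D K p zero g)) -
      D K p (neg i) (X K p (neg i) * (f * D K p zero g))) =
      pois f g - (2 * n : ℕ) • (f * D K p zero g) - euler f * D K p zero g -
        f * euler (D K p zero g) := by
    rw [pois, euler_apply, euler_apply, Finset.sum_mul, Finset.mul_sum,
      show (2 * n : ℕ) • (f * D K p zero g) = ∑ _i : Fin n, 2 * (f * D K p zero g) by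
        rw [Finset.sum_const, Finset.card_univ, Fintype.card_fin, mul_comm, mul_smul, two_mul,
          two_smul],
      ← Finset.sum_sub_distrib, ← Finset.sum_sub_distrib, ← Finset.sum_sub_distrib]
    refine Finset.sum_congr rfl fun i _ => ?_
    simp only [Derivation.leibniz, D_X, if_true, smul_eq_mul]
    rw [D_comm (neg i) (pos i)]
    ring
  rw [h1, contactBracket]
  simp only [map_sub, Derivation.leibniz, D_two, D_zero_euler, smul_eq_mul, nsmul_eq_mul]
  push_cast
  ring

theorem coef_tau_of_mem (hn : p ∣ 2 * n + 4) (hp : Odd p) {f : O K p n}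
    (hf : f ∈ derivedFun K p n) : f.coef tau = 0 := by
  have hle : (LieAlgebra.derivedSeries K (contactPrime K p n) 1).toSubmodule ≤
      Submodule.map DKPrime (LinearMap.ker (coefLin K (tau : CIdx n → Fin p))) := by
    rw [derivedSeries_one_eq_span, Submodule.span_le]
    rintro _ ⟨f, g, rfl⟩
    refine ⟨_, ?_, rfl⟩
    change (contactBracket f g).coef tau = 0
    have hc : ((2 * n + 4 : ℕ) : K) = 0 := by rwa [CharP.cast_eq_zero_iff K p]
    rw [contactBracket_eq, ← Nat.cast_smul_eq_nsmul K, hc, zero_smul, zero_add, DivPow.add_apply,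
      D_coef_tau, sum_coef, zero_add]
    refine Finset.sum_eq_zero fun i _ => ?_
    simp only [sub_coef, D_coef_tau, sub_zero]
  obtain ⟨g, hg, hgf⟩ := hle hf
  have : g = f := DK_injective hp (congrArg Subtype.val hgf)
  rw [← this]
  exact hg

variable (p n) in
/-- The multi-indices `α` with `D_K(x^(α))` in the contact algebra. -/
abbrev CBasis : Type := {α : CIdx n → Fin p // p ∣ 2 * n + 4 → α ≠ tau}

/-- The standard basis of the contact algebra. -/
def cvec (hp : Odd p) (α : CBasis p n) : ContactAlg K p n := ⟨DKPrime (mono α.1), mono_mem hp α.2⟩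

theorem toDer_cvec (hp : Odd p) (α : CBasis p n) :
    toDer (cvec hp α : ContactAlg K p n) = DK (mono α.1) := rfl

theorem toDer_injective : Function.Injective (toDer : ContactAlg K p n → W K p n) :=
  fun _ _ h => Subtype.ext (Subtype.ext h)

/-- The inclusion of the contact algebra into the derivations, as a linear map. -/
def toDerLin : ContactAlg K p n →ₗ[K] W K p n where
  toFun := toDer
  map_add' _ _ := rfl
  map_smul' _ _ := rfl

theorem linearIndependent_cvec (hp : Odd p) :
    LinearIndependent K (cvec hp : CBasis p n → ContactAlg K p n) := by
  refine LinearIndependent.of_comp toDerLin ?_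
  exact (linearIndependent_mono.comp _ Subtype.val_injective).map' DK
    (LinearMap.ker_eq_bot.mpr (DK_injective hp))

theorem span_cvec (hp : Odd p) :
    Submodule.span K (Set.range (cvec hp : CBasis p n → ContactAlg K p n)) = ⊤ := by
  rw [eq_top_iff]
  rintro x -
  obtain ⟨f, hf⟩ := exists_DKPrime (x : contactPrime K p n)
  have hmem : f ∈ derivedFun K p n := by
    have := x.2
    rw [← hf] at this
    exact this
  classical
  -- The value `0` at an excluded `τ` is harmless: there `coef_tau_of_mem` says that the coefficient
  -- of `f` vanishes.
  let v : (CIdx n → Fin p) → ContactAlg K p n := fun α =>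
    if h : p ∣ 2 * n + 4 → α ≠ tau then f.coef α • (cvec hp ⟨α, h⟩ : ContactAlg K p n) else 0
  have hv : ∀ α, toDerLin (v α) = f.coef α • DK (mono α) := by
    intro α
    by_cases h : p ∣ 2 * n + 4 → α ≠ tau
    · simp only [v, dif_pos h]
      rfl
    · have hv0 : v α = 0 := dif_neg h
      push Not at h
      rw [hv0, map_zero, h.2, coef_tau_of_mem h.1 hp hmem, zero_smul]
  have hx : x = ∑ α, v α := by
    refine toDer_injective ?_
    change toDerLin x = toDerLin (∑ α, v α)
    have e : toDerLin x = DK f := by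
      change ((x : contactPrime K p n) : W K p n) = _
      rw [← hf, coe_DKPrime]
    rw [map_sum, e]
    simp only [hv]
    nth_rw 1 [eq_sum_mono f]
    rw [map_sum]
    simp only [map_smul]
  rw [hx]
  refine Submodule.sum_mem _ fun α _ => ?_
  by_cases h : p ∣ 2 * n + 4 → α ≠ tau
  · simp only [v, dif_pos h]
    exact Submodule.smul_mem _ _ (Submodule.subset_span ⟨⟨α, h⟩, rfl⟩)
  · simp only [v, dif_neg h]
    exact Submodule.zero_mem _

theorem card_CBasis_of_not_dvd (h : ¬ p ∣ 2 * n + 4) :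
    Nat.card (CBasis p n) = p ^ (2 * n + 1) := by
  have e : CBasis p n ≃ (CIdx n → Fin p) := Equiv.subtypeUnivEquiv fun _ hd => absurd hd h
  rw [Nat.card_congr e, Nat.card_eq_fintype_card, Fintype.card_fun]
  simp [two_mul]

theorem card_CBasis_of_dvd (h : p ∣ 2 * n + 4) :
    Nat.card (CBasis p n) + 1 = p ^ (2 * n + 1) := by
  classical
  have e : CBasis p n ≃ {α : CIdx n → Fin p // α ≠ tau} :=
    Equiv.subtypeEquivRight fun α => ⟨fun hα => hα h, fun hα _ => hα⟩
  rw [Nat.card_congr e, Nat.card_eq_fintype_card, Fintype.card_subtype_compl,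
    Fintype.card_subtype_eq, Fintype.card_fun, Nat.sub_add_cancel]
  · simp [two_mul]
  · exact Nat.pos_of_ne_zero (by simp [(Fact.out : p.Prime).ne_zero])

end Contact

/-! ### The restricted enveloping algebra -/

namespace Contact

open CIdx DivPow

set_option linter.unusedSectionVars false

attribute [local instance] LieRing.ofAssociativeRing

variable {K : Type*} [Field K] {p : ℕ} [Fact p.Prime] [CharP K p] {n : ℕ}

/-- The map from the contact algebra to its restricted enveloping algebra. -/
noncomputable def incU : ContactAlg K p n →ₗ⁅K⁆ RestrictedEnv K p n :=
  (RingQuot.mkAlgHom K (RestrictedRel K p n)).toLieHom.comp (UniversalEnvelopingAlgebra.ι K)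

theorem incU_apply (x : ContactAlg K p n) : incU x =
    RingQuot.mkAlgHom K (RestrictedRel K p n) (UniversalEnvelopingAlgebra.ι K x) := rfl

/-- The relations of the restricted enveloping algebra hold for the values of `f`. -/
structure IsRestricted {B : Type*} [Ring B] (f : ContactAlg K p n → B) : Prop where
  pair : ∀ (x : ContactAlg K p n) (i : Fin n),
    toDer x = DK (mono (eps (pos i) + eps (neg i))) → f x ^ p = f x
  zero : ∀ x : ContactAlg K p n, toDer x = DK (mono (eps zero)) → f x ^ p = f x
  nil : ∀ (x : ContactAlg K p n) (α : CIdx n → Fin p),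
    (∀ i : Fin n, α ≠ eps (pos i) + eps (neg i)) → α ≠ eps CIdx.zero →
      toDer x = DK (mono α) → f x ^ p = 0

/-- All relations have the form `y^p = y` or `y^p = 0`, so transporting these two shapes suffices.
-/
theorem IsRestricted.of_pow {B C : Type*} [Ring B] [Ring C] {f : ContactAlg K p n → B}
    (hf : IsRestricted f) {g : ContactAlg K p n → C}
    (h1 : ∀ x, f x ^ p = f x → g x ^ p = g x) (h0 : ∀ x, f x ^ p = 0 → g x ^ p = 0) :
    IsRestricted g where
  pair x i hx := h1 x (hf.pair x i hx)
  zero x hx := h1 x (hf.zero x hx)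
  nil x α h h' hx := h0 x (hf.nil x α h h' hx)

theorem isRestricted_incU : IsRestricted (incU : ContactAlg K p n → RestrictedEnv K p n) where
  pair x i hx := by
    rw [incU_apply, ← map_pow]
    exact RingQuot.mkAlgHom_rel K (RestrictedRel.pair x i hx)
  zero x hx := by
    rw [incU_apply, ← map_pow]
    exact RingQuot.mkAlgHom_rel K (RestrictedRel.zero x hx)
  nil x α h1 h0 hx := by
    rw [incU_apply, ← map_pow, RingQuot.mkAlgHom_rel K (RestrictedRel.nil x α h1 h0 hx), map_zero]

/-! ### Universal property and generation of the restricted enveloping algebra -/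

section Lift

variable {B : Type*} [Ring B] [Algebra K B]

/-- The universal property of the restricted enveloping algebra. -/
noncomputable def liftU (f : ContactAlg K p n →ₗ⁅K⁆ B) (hf : IsRestricted f) :
    RestrictedEnv K p n →ₐ[K] B :=
  RingQuot.liftAlgHom K ⟨UniversalEnvelopingAlgebra.lift K f, by
    intro a b hab
    induction hab with
    | pair x i hx => rw [map_pow, UniversalEnvelopingAlgebra.lift_ι_apply, hf.pair x i hx]
    | zero x hx => rw [map_pow, UniversalEnvelopingAlgebra.lift_ι_apply, hf.zero x hx]
    | nil x α h1 h0 hx =>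
      rw [map_pow, UniversalEnvelopingAlgebra.lift_ι_apply, hf.nil x α h1 h0 hx, map_zero]⟩

theorem liftU_incU (f : ContactAlg K p n →ₗ⁅K⁆ B) (hf : IsRestricted f)
    (x : ContactAlg K p n) : liftU f hf (incU x) = f x := by
  rw [liftU, incU_apply, RingQuot.liftAlgHom_mkAlgHom_apply,
    UniversalEnvelopingAlgebra.lift_ι_apply]

/-- The restriction of a homomorphism to the contact algebra. -/
noncomputable def compIncU (f : RestrictedEnv K p n →ₐ[K] B) : ContactAlg K p n →ₗ⁅K⁆ B :=
  f.toLieHom.comp incU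

theorem compIncU_lie (f : RestrictedEnv K p n →ₐ[K] B) (x y : ContactAlg K p n) :
    compIncU f ⁅x, y⁆ = compIncU f x * compIncU f y - compIncU f y * compIncU f x :=
  LieHom.map_lie (compIncU f) x y

/-- The map into the generated subalgebra lifts to the enveloping algebra; followed by the inclusion
it is the identity by uniqueness, so the inclusion is onto. -/
theorem adjoin_range_ι {L : Type*} [LieRing L] [LieAlgebra K L] :
    Algebra.adjoin K (Set.range (UniversalEnvelopingAlgebra.ι K : L → _)) = ⊤ := by
  set S := Algebra.adjoin K (Set.range (UniversalEnvelopingAlgebra.ι K : L → _))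
  let f : L →ₗ⁅K⁆ S :=
    { toFun := fun x => ⟨UniversalEnvelopingAlgebra.ι K x, Algebra.subset_adjoin ⟨x, rfl⟩⟩
      map_add' := fun x y => Subtype.ext (map_add _ x y)
      map_smul' := fun c x => Subtype.ext (map_smul _ c x)
      map_lie' := fun {x y} => Subtype.ext (LieHom.map_lie _ x y) }
  have h : S.val.comp (UniversalEnvelopingAlgebra.lift K f) =
      AlgHom.id K (UniversalEnvelopingAlgebra K L) := by
    refine UniversalEnvelopingAlgebra.hom_ext (R := K) (L := L) (A := UniversalEnvelopingAlgebra K L) ?_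
    ext x
    simp [f]
  rw [eq_top_iff]
  rintro y -
  have := AlgHom.congr_fun h y
  simp only [AlgHom.comp_apply, AlgHom.id_apply] at this
  rw [← this]
  exact Subtype.property _

theorem adjoin_range_incU :
    Algebra.adjoin K (Set.range (incU : ContactAlg K p n → RestrictedEnv K p n)) = ⊤ := by
  have h : Set.range (incU : ContactAlg K p n → RestrictedEnv K p n) =
      RingQuot.mkAlgHom K (RestrictedRel K p n) '' Set.range (UniversalEnvelopingAlgebra.ι K) := by
    rw [← Set.range_comp]
    rfl
  rw [h, ← AlgHom.map_adjoin, adjoin_range_ι, Algebra.map_top, AlgHom.range_eq_top]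
  exact RingQuot.mkAlgHom_surjective K _

end Lift

/-! ### Undeformed comultiplication, antipode and counit on the Lie algebra -/

section Primitive

variable (R : Type*) [CommRing R] [Algebra K R] {A : Type*} [Ring A] [Algebra R A] [Algebra K A]
  [IsScalarTower K R A] (j : ContactAlg K p n →ₗ⁅K⁆ A)

/-- The Lie algebra map `x ↦ x ⊗ 1 + 1 ⊗ x`. -/
noncomputable def comulLie : ContactAlg K p n →ₗ⁅K⁆ A ⊗[R] A where
  toFun x := j x ⊗ₜ 1 + 1 ⊗ₜ j x
  map_add' x y := by
    rw [map_add, TensorProduct.add_tmul, TensorProduct.tmul_add]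
    abel
  map_smul' c x := by
    rw [RingHom.id_apply, map_smul, smul_add, TensorProduct.smul_tmul',
      ← algebraMap_smul R c (j x), TensorProduct.tmul_smul, algebraMap_smul, algebraMap_smul]
  map_lie' {x y} := by
    rw [LieHom.map_lie, LieRing.of_associative_ring_bracket, LieRing.of_associative_ring_bracket]
    simp only [mul_add, add_mul, Algebra.TensorProduct.tmul_mul_tmul, mul_one, one_mul,
      TensorProduct.sub_tmul, TensorProduct.tmul_sub]
    abel

theorem comulLie_apply (x : ContactAlg K p n) : comulLie R j x = j x ⊗ₜ 1 + 1 ⊗ₜ j x := rfl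

/-- The Lie algebra map `x ↦ -x` to the opposite algebra. -/
def antipodeLie {A : Type*} [Ring A] [Algebra K A] (j : ContactAlg K p n →ₗ⁅K⁆ A) :
    ContactAlg K p n →ₗ⁅K⁆ Aᵐᵒᵖ where
  toFun x := MulOpposite.op (-j x)
  map_add' x y := by rw [map_add, neg_add, MulOpposite.op_add]
  map_smul' c x := by rw [RingHom.id_apply, map_smul, ← smul_neg, MulOpposite.op_smul]
  map_lie' {x y} := by
    rw [LieHom.map_lie, LieRing.of_associative_ring_bracket, LieRing.of_associative_ring_bracket,
      ← MulOpposite.op_mul, ← MulOpposite.op_mul, ← MulOpposite.op_sub]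
    simp

variable {j}

theorem isRestricted_comulLie (hj : IsRestricted j) : IsRestricted (comulLie R j) := by
  have h : ∀ x, comulLie R j x ^ p = (j x ^ p) ⊗ₜ 1 + 1 ⊗ₜ (j x ^ p) := by
    intro x
    have hc : Commute (j x ⊗ₜ[R] (1 : A)) ((1 : A) ⊗ₜ[R] j x) := by simp [Commute, SemiconjBy]
    rw [comulLie_apply, ModP.add_pow_char_algebra K p hc, Algebra.TensorProduct.tmul_pow,
      Algebra.TensorProduct.tmul_pow, one_pow]
  refine hj.of_pow (fun x hx => ?_) (fun x hx => ?_)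
  · rw [h, hx, comulLie_apply]
  · rw [h, hx, TensorProduct.zero_tmul, TensorProduct.tmul_zero, add_zero]

theorem isRestricted_antipodeLie (hp : Odd p) (hj : IsRestricted j) :
    IsRestricted (antipodeLie j) := by
  have h : ∀ x, antipodeLie j x ^ p = MulOpposite.op (-(j x ^ p)) := by
    intro x
    change MulOpposite.op (-j x) ^ p = _
    rw [← MulOpposite.op_pow, hp.neg_pow]
  refine hj.of_pow (fun x hx => ?_) (fun x hx => ?_)
  · rw [h, hx]; rfl
  · rw [h, hx, neg_zero, MulOpposite.op_zero]

theorem isRestricted_zero {B : Type*} [Ring B] [Algebra K B] :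
    IsRestricted (0 : ContactAlg K p n →ₗ⁅K⁆ B) := by
  have h : ∀ x, (0 : ContactAlg K p n →ₗ⁅K⁆ B) x ^ p = 0 := fun x => by
    rw [LieHom.zero_apply, zero_pow (Fact.out : p.Prime).ne_zero]
  exact ⟨fun x _ _ => h x, fun x _ => h x, fun x _ _ _ _ => h x⟩

end Primitive

/-! ### Faithful action on the divided power algebra -/

section Faithful

/-- The action of the contact algebra on `O(2n+1; 1)`. -/
def action : ContactAlg K p n →ₗ⁅K⁆ Module.End K (O K p n) where
  toFun x := toEnd (toDer x)
  map_add' _ _ := rfl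
  map_smul' _ _ := rfl
  map_lie' {x y} := Derivation.commutator_coe_linear_map (D1 := toDer x) (D2 := toDer y)

theorem isRestricted_action (hp : Odd p) :
    IsRestricted (action : ContactAlg K p n → Module.End K (O K p n)) where
  pair x i hx := by
    change toEnd (toDer x) ^ p = toEnd (toDer x)
    rw [hx, DK_pair_pow_p]
  zero x hx := by
    change toEnd (toDer x) ^ p = toEnd (toDer x)
    rw [hx, DK_zero_pow_p]
  nil x α h1 h0 hx := by
    change toEnd (toDer x) ^ p = 0
    rw [hx, DK_mono_pow_p_eq_zero hp h1 h0]

/-- The action by derivations extends to the restricted enveloping algebra, so elements with equal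
images there are equal derivations. -/
theorem incU_injective (hp : Odd p) :
    Function.Injective (incU : ContactAlg K p n → RestrictedEnv K p n) := by
  intro x y hxy
  have h := congrArg (liftU action (isRestricted_action hp)) hxy
  rw [liftU_incU, liftU_incU] at h
  refine toDer_injective (Derivation.ext fun u => ?_)
  exact LinearMap.congr_fun h u

end Faithful

/-! ### Basis and dimension of the restricted enveloping algebra -/

section Dimension

variable (K p n) in
/-- The ordered monomials in the standard basis of the contact algebra form a basis of its
restricted enveloping algebra. -/
theorem exists_basis (hp : Odd p) :
    Nonempty (Module.Basis (Fin (Nat.card (CBasis p n)) → Fin p) K (RestrictedEnv K p n)) := by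
  let e : Fin (Nat.card (CBasis p n)) ≃ CBasis p n := (Finite.equivFin _).symm
  let x : Fin (Nat.card (CBasis p n)) → RestrictedEnv K p n := fun i => incU (cvec hp (e i))
  have hspan : Submodule.span K (Set.range x) =
      LinearMap.range ((incU : ContactAlg K p n →ₗ⁅K⁆ RestrictedEnv K p n) :
        ContactAlg K p n →ₗ[K] RestrictedEnv K p n) := by
    have h1 : Set.range x = ((incU : ContactAlg K p n →ₗ⁅K⁆ RestrictedEnv K p n) :
        ContactAlg K p n →ₗ[K] RestrictedEnv K p n) ''
        Set.range (cvec hp : CBasis p n → ContactAlg K p n) := by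
      rw [← Set.range_comp]
      exact e.surjective.range_comp (fun α => incU (cvec hp α : ContactAlg K p n))
    rw [h1, Submodule.span_image, span_cvec hp, Submodule.map_top]
  have hmem : ∀ y : ContactAlg K p n, incU y ∈ Submodule.span K (Set.range x) := fun y => by
    rw [hspan]; exact ⟨y, rfl⟩
  refine ⟨OrderedMonomials.basis x p (fun i j => ?_) (fun i => ?_) ?_
    (liftU (comulLie K incU) (isRestricted_comulLie K isRestricted_incU))
    (fun i => liftU_incU _ _ _) ?_ (liftU 0 isRestricted_zero) (fun i => liftU_incU _ _ _)⟩
  · rw [← LieRing.of_associative_ring_bracket, ← LieHom.map_lie]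
    exact hmem _
  · by_cases h1 : ∃ l : Fin n, (e i).1 = eps (pos l) + eps (neg l)
    · obtain ⟨l, hl⟩ := h1
      rw [isRestricted_incU.pair (cvec hp (e i)) l (by rw [toDer_cvec, hl])]
      exact hmem _
    · by_cases h0 : (e i).1 = eps zero
      · rw [isRestricted_incU.zero (cvec hp (e i)) (by rw [toDer_cvec, h0])]
        exact hmem _
      · push Not at h1
        rw [isRestricted_incU.nil (cvec hp (e i)) _ h1 h0 rfl]
        exact Submodule.zero_mem _
  · rw [eq_top_iff, ← adjoin_range_incU, Algebra.adjoin_le_iff]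
    rintro _ ⟨y, rfl⟩
    exact Algebra.span_le_adjoin K _ (hmem y)
  · exact ((linearIndependent_cvec (K := K) hp).comp e e.injective).map'
      ((incU : ContactAlg K p n →ₗ⁅K⁆ RestrictedEnv K p n) :
        ContactAlg K p n →ₗ[K] RestrictedEnv K p n)
      (LinearMap.ker_eq_bot.mpr (incU_injective hp))

theorem finite_restrictedEnv (hp : Odd p) : Module.Finite K (RestrictedEnv K p n) :=
  Module.Finite.of_basis (exists_basis K p n hp).some

theorem finrank_restrictedEnv (hp : Odd p) :
    Module.finrank K (RestrictedEnv K p n) = p ^ Nat.card (CBasis p n) := by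
  rw [Module.finrank_eq_card_basis (exists_basis K p n hp).some]
  simp

end Dimension

end Contact

/-! ### Failure of cocommutativity -/

namespace TwistDatum

open ModP

section Cocommutative

variable {R A : Type*} [CommRing R] [Ring A] [Algebra R A] {p : ℕ} [Fact p.Prime] [CharP R p]
  (T : TwistDatum R A p) {M : HopfMaps R A}

/-- Since `[e, h] = -e` commutes with `e`, only `l = 0, 1` contribute, and `w^(-1) = 1 + t w^(-1) e`
merges the terms with first factor `h`. -/
theorem comul_h (K : Type*) [Field K] [CharP K p] [Algebra K R] [Algebra K A]
    [IsScalarTower K R A] (hh : M.IsPrim T.h) :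
    T.comul M T.h = T.h ⊗ₜ T.W (-1) + 1 ⊗ₜ T.h := by
  have h0 : T.h * T.h - T.h * T.h = sc R p 0 • T.h := by rw [map_zero, zero_smul, sub_self]
  have h1 : T.e * T.h - T.h * T.e = -T.e := by rw [← neg_sub, T.lie]
  have h2 : (fun y : A => T.e * y - y * T.e)^[2] T.h = 0 := by
    change T.e * (T.e * T.h - T.h * T.e) - (T.e * T.h - T.h * T.e) * T.e = 0
    rw [h1]
    noncomm_ring
  have h3 : T.W (-1) = 1 + T.t • (T.W (-1) * T.e) := by
    have h' := T.W_mul_neg (-1)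
    rw [neg_neg, W_one, mul_sub, mul_one, sub_eq_iff_eq_add, mul_smul_comm] at h'
    exact h'
  rw [T.comul_eq (K := K) h0 hh, T.W_zero,
    ← Finset.sum_subset (Finset.range_subset_range.mpr (Fact.out : p.Prime).two_le)]
  · rw [Finset.sum_range_succ, Finset.sum_range_one]
    have hd0 : divAd K T.e 0 T.h = T.h := by simp [divAd]
    have hd1 : divAd K T.e 1 T.h = -T.e := by simp [divAd, h1]
    rw [hd0, hd1]
    simp only [risingFac, pow_zero, pow_one, one_mul, Nat.cast_zero, neg_zero, W_zero, one_smul,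
      Nat.cast_one, add_zero]
    conv_rhs => rw [h3]
    rw [TensorProduct.tmul_add, TensorProduct.tmul_smul, mul_neg, TensorProduct.tmul_neg, neg_mul,
      one_mul, neg_smul, smul_neg, neg_neg]
    abel
  · intro l _ hl
    obtain ⟨m, rfl⟩ : ∃ m, l = m + 2 := ⟨l - 2, by simp at hl; omega⟩
    rw [divAd, Function.iterate_add_apply, h2, Function.iterate_fixed (by simp), smul_zero,
      mul_zero, TensorProduct.tmul_zero, smul_zero]

/-- Applying `φ` to the first tensor factor of a symmetric `Δ(h)` expresses `w^(-1)` through `h` and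
`1`. Then `h` commutes with `w = 1 - te`, so `te = [h, te] = 0`. -/
theorem comm_comul_h_ne (K : Type*) [Field K] [CharP K p] [Algebra K R] [Algebra K A]
    [IsScalarTower K R A] (hh : M.IsPrim T.h) (φ : A →ₗ[R] R) (hφ : φ T.h = 1)
    (hte : T.t • T.e ≠ 0) : TensorProduct.comm R A A (T.comul M T.h) ≠ T.comul M T.h := by
  intro h
  rw [T.comul_h K hh, map_add, TensorProduct.comm_tmul, TensorProduct.comm_tmul] at h
  have h1 := congrArg (TensorProduct.lid R A ∘ φ.rTensor A) h
  simp only [Function.comp_apply, map_add, LinearMap.rTensor_tmul, TensorProduct.lid_tmul, hφ,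
    one_smul] at h1
  have h2 : Commute T.h (T.W (-1)) := by
    rw [eq_sub_of_add_eq h1.symm]
    exact (((Commute.refl _).smul_right _).add_right (Commute.one_right _)).sub_right
      ((Commute.refl _).smul_right _)
  have h3 : Commute T.h (T.W 1) := by
    have e1 := T.W_mul_neg 1
    have e2 := T.W_mul_neg (-1)
    rw [neg_neg] at e2
    calc T.h * T.W 1 = T.W 1 * T.W (-1) * T.h * T.W 1 := by rw [e1, one_mul]
      _ = T.W 1 * (T.h * T.W (-1)) * T.W 1 := by rw [h2.eq]; simp only [mul_assoc]
      _ = T.W 1 * T.h * (T.W (-1) * T.W 1) := by simp only [mul_assoc]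
      _ = T.W 1 * T.h := by rw [e2, mul_one]
  have h4 := h3.eq
  rw [W_one, mul_sub, sub_mul, mul_one, one_mul, sub_right_inj, mul_smul_comm, smul_mul_assoc,
    ← sub_eq_zero, ← smul_sub, T.lie] at h4
  exact hte h4

end Cocommutative

end TwistDatum

/-! ### The quantization of the contact algebra -/

namespace Contact

open CIdx DivPow

set_option linter.unusedSectionVars false

attribute [local instance] LieRing.ofAssociativeRing

/-! ### The coefficient ring -/

section TruncPoly

variable {K : Type*} [Field K] (p : ℕ) [Fact p.Prime] (q : K)

theorem natDegree_modulus :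
    (Polynomial.X ^ p - Polynomial.C q * Polynomial.X : Polynomial K).natDegree = p := by
  have hp := (Fact.out : p.Prime).one_lt
  rw [Polynomial.natDegree_sub_eq_left_of_natDegree_lt, Polynomial.natDegree_X_pow]
  rw [Polynomial.natDegree_X_pow]
  exact lt_of_le_of_lt ((Polynomial.natDegree_C_mul_le _ _).trans Polynomial.natDegree_X_le) hp

theorem modulus_ne_zero : (Polynomial.X ^ p - Polynomial.C q * Polynomial.X : Polynomial K) ≠ 0 := by
  intro h
  have := natDegree_modulus p q
  rw [h, Polynomial.natDegree_zero] at this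
  exact (Fact.out : p.Prime).ne_zero this.symm

theorem nontrivial_truncPoly : Nontrivial (TruncPoly K p q) := by
  refine AdjoinRoot.nontrivial _ ?_
  rw [Polynomial.degree_eq_natDegree (modulus_ne_zero p q), natDegree_modulus]
  exact_mod_cast (Fact.out : p.Prime).ne_zero

theorem finite_truncPoly : Module.Finite K (TruncPoly K p q) :=
  (AdjoinRoot.powerBasis (modulus_ne_zero p q)).finite

theorem finrank_truncPoly : Module.finrank K (TruncPoly K p q) = p := by
  rw [(AdjoinRoot.powerBasis (modulus_ne_zero p q)).finrank, AdjoinRoot.powerBasis_dim,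
    natDegree_modulus]

theorem charP_truncPoly [CharP K p] : CharP (TruncPoly K p q) p :=
  have := nontrivial_truncPoly p q
  charP_of_injective_algebraMap (algebraMap K (TruncPoly K p q)).injective p

theorem tElt_ne_zero : tElt K p q ≠ 0 := by
  intro h
  have h1 : (Polynomial.X ^ p - Polynomial.C q * Polynomial.X : Polynomial K) ∣ Polynomial.X :=
    AdjoinRoot.mk_eq_zero.mp h
  have h2 := Polynomial.natDegree_le_of_dvd h1 Polynomial.X_ne_zero
  rw [natDegree_modulus, Polynomial.natDegree_X] at h2
  exact absurd h2 (not_le.mpr (Fact.out : p.Prime).one_lt)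

end TruncPoly

/-! ### Base change to the coefficient ring -/

section BaseChange

variable {K : Type*} [Field K] {p : ℕ} [Fact p.Prime] [CharP K p] {n : ℕ} (q : K)

/-- The map `inc` as a homomorphism of Lie algebras. -/
noncomputable abbrev incLie :=
  compIncU (Algebra.TensorProduct.includeRight : RestrictedEnv K p n →ₐ[K] UTQ K p n q)

theorem incLie_apply (x : ContactAlg K p n) : incLie q x = inc q x := rfl

theorem inc_eq (x : ContactAlg K p n) : inc q x = 1 ⊗ₜ[K] incU x := rfl

theorem inc_lie (x y : ContactAlg K p n) :
    inc q ⁅x, y⁆ = inc q x * inc q y - inc q y * inc q x :=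
  compIncU_lie (Algebra.TensorProduct.includeRight :
    RestrictedEnv K p n →ₐ[K] UTQ K p n q) x y

theorem inc_smul (c : K) (x : ContactAlg K p n) : inc q (c • x) = c • inc q x :=
  map_smul (incLie q) c x

theorem isRestricted_incLie : IsRestricted (incLie q : ContactAlg K p n → UTQ K p n q) := by
  have h : ∀ x : ContactAlg K p n, incLie q x ^ p = 1 ⊗ₜ[K] (incU x ^ p) := fun x => by
    rw [incLie_apply, inc_eq, Algebra.TensorProduct.tmul_pow, one_pow]
  refine isRestricted_incU.of_pow (fun x hx => ?_) (fun x hx => ?_)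
  · rw [h, hx, incLie_apply, inc_eq]
  · rw [h, hx, TensorProduct.tmul_zero]

/-- The undeformed structure maps. -/
noncomputable def hopfMaps (hp : Odd p) : HopfMaps (TruncPoly K p q) (UTQ K p n q) where
  comul := AlgHom.liftEquiv K _ _ _
    (liftU (comulLie (TruncPoly K p q) (incLie q))
      (isRestricted_comulLie (TruncPoly K p q) (isRestricted_incLie q)))
  counit := AlgHom.liftEquiv K _ _ _ (liftU 0 isRestricted_zero)
  antipode := AlgHom.liftEquiv K _ _ _
    (liftU (antipodeLie (incLie q)) (isRestricted_antipodeLie hp (isRestricted_incLie q)))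

theorem isPrim_inc (hp : Odd p) (x : ContactAlg K p n) : (hopfMaps q hp).IsPrim (inc q x) where
  comul := by
    rw [inc_eq, hopfMaps, AlgHom.liftEquiv_tmul, one_smul, liftU_incU]
    rfl
  counit := by
    rw [inc_eq, hopfMaps, AlgHom.liftEquiv_tmul, one_smul, liftU_incU]
    rfl
  antipode := by
    rw [inc_eq, hopfMaps, AlgHom.liftEquiv_tmul, one_smul, liftU_incU]
    rfl

theorem adjoin_inc_cvec (hp : Odd p) : Algebra.adjoin (TruncPoly K p q)
    (Set.range fun α : CBasis p n => inc q (cvec hp α : ContactAlg K p n)) = ⊤ := by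
  set S := Algebra.adjoin (TruncPoly K p q)
    (Set.range fun α : CBasis p n => inc q (cvec hp α : ContactAlg K p n)) with hS
  have h1 : ∀ x : ContactAlg K p n, inc q x ∈ S := fun x => by
    have hx : x ∈ Submodule.span K (Set.range (cvec hp : CBasis p n → ContactAlg K p n)) := by
      rw [span_cvec]; trivial
    induction hx using Submodule.span_induction with
    | mem x hx =>
      obtain ⟨α, rfl⟩ := hx
      exact Algebra.subset_adjoin ⟨α, rfl⟩
    | zero =>
      rw [← incLie_apply, map_zero]
      exact S.zero_mem
    | add x y _ _ hx hy =>
      rw [← incLie_apply, map_add]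
      exact S.add_mem hx hy
    | smul c x _ hx =>
      rw [inc_smul, ← algebraMap_smul (TruncPoly K p q)]
      exact S.smul_mem hx _
  have h2 : (⊤ : Subalgebra K (RestrictedEnv K p n)) ≤
      (S.restrictScalars K).comap Algebra.TensorProduct.includeRight := by
    rw [← adjoin_range_incU, Algebra.adjoin_le_iff]
    rintro _ ⟨x, rfl⟩
    exact h1 x
  rw [eq_top_iff]
  rintro z -
  induction z using TensorProduct.induction_on with
  | zero => exact S.zero_mem
  | add x y hx hy => exact S.add_mem hx hy
  | tmul r u =>
    have h : r ⊗ₜ[K] u = r • ((1 : TruncPoly K p q) ⊗ₜ[K] u) := by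
      rw [TensorProduct.smul_tmul', smul_eq_mul, mul_one]
    rw [h]
    exact S.smul_mem (h2 (Algebra.mem_top : u ∈ ⊤)) r

/-- The coefficient ring need not be a domain, so `inc q x ≠ 0` would not be enough to show that a
multiple such as `t e` is nonzero; a functional with value `1` is. -/
theorem exists_functional_inc (hp : Odd p) {x : ContactAlg K p n} (hx : x ≠ 0) :
    ∃ φ : UTQ K p n q →ₗ[TruncPoly K p q] TruncPoly K p q, φ (inc q x) = 1 := by
  have h : incU x ≠ 0 := fun h => hx (incU_injective hp (h.trans (map_zero _).symm))
  obtain ⟨f, hf⟩ := Module.Projective.exists_dual_eq_one K h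
  refine ⟨Module.Dual.baseChange (TruncPoly K p q) f, ?_⟩
  rw [inc_eq, Module.Dual.baseChange_apply_tmul, hf, one_smul]

theorem finite_UTQ (hp : Odd p) : Module.Finite K (UTQ K p n q) :=
  have := finite_truncPoly p q
  have := finite_restrictedEnv (K := K) (n := n) hp
  inferInstance

theorem finrank_UTQ (hp : Odd p) :
    Module.finrank K (UTQ K p n q) = p ^ (Nat.card (CBasis p n) + 1) := by
  rw [Module.finrank_tensorProduct, finrank_truncPoly, finrank_restrictedEnv hp, pow_succ, mul_comm]

end BaseChange

/-! ### Weights of the standard basis under `h` -/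

section Weights

variable {K : Type*} [Field K] {p : ℕ} [Fact p.Prime] [CharP K p] {n : ℕ}

theorem contactBracket_pair (k : Fin n) (α : CIdx n → Fin p) :
    contactBracket (mono (eps (pos k) + eps (neg k)) : O K p n) (mono α) =
      (((α (pos k) : ℕ) : K) - ((α (neg k) : ℕ) : K)) • mono α := by
  rw [contactBracket, euler_pair, D_zero_pair, pois_pair, X_mul_D_mono, X_mul_D_mono, sub_smul]
  ring

theorem pair_zero (k : Fin n) : ((eps (pos k) + eps (neg k) : CIdx n → Fin p) zero : ℕ) = 0 := by
  rw [eps_add_eps_val (pos_ne_neg k k)]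
  simp

theorem triple_val (hp : Odd p) (k : Fin n) (i : CIdx n) :
    ((eps (pos k) + eps (pos k) + eps (neg k) : CIdx n → Fin p) i : ℕ) =
      if i = pos k then 2 else if i = neg k then 1 else 0 := by
  have hp1 := (Fact.out : p.Prime).two_le
  have hp3 : 2 < p := by
    obtain ⟨m, hm⟩ := hp
    omega
  rw [Pi.add_apply, Pi.add_apply, Fin.val_add, Fin.val_add, eps_val, eps_val]
  split_ifs with h1 h2
  · exact absurd (h1.symm.trans h2) (pos_ne_neg k k)
  · simp [Nat.mod_eq_of_lt hp3]
  · simp [Nat.mod_eq_of_lt (show 1 < p by omega)]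
  · simp

/-- The exponents of `h` and `e` do not involve `x_0`, so both lie in the contact algebra whether or
not `p` divides `2n + 4`. -/
theorem ne_tau_of_zero {α : CIdx n → Fin p} (h : (α zero : ℕ) = 0) : α ≠ tau := by
  rintro rfl
  rw [tau_val] at h
  have := (Fact.out : p.Prime).two_le
  omega

/-- The index of `h`. -/
def hIdx (p : ℕ) [Fact p.Prime] (k : Fin n) : CBasis p n :=
  ⟨eps (pos k) + eps (neg k), fun _ => ne_tau_of_zero (pair_zero k)⟩

/-- The index of `e`. -/
def eIdx (hp : Odd p) (k : Fin n) : CBasis p n :=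
  ⟨eps (pos k) + eps (pos k) + eps (neg k), fun _ => ne_tau_of_zero (triple_val hp k zero)⟩

/-- `h` acts diagonally on the standard basis. -/
theorem lie_cvec (hp : Odd p) (k : Fin n) (α : CBasis p n) :
    ⁅(cvec hp (hIdx p k) : ContactAlg K p n), cvec hp α⁆ =
      (((α.1 (pos k) : ℕ) : K) - ((α.1 (neg k) : ℕ) : K)) • (cvec hp α : ContactAlg K p n) := by
  refine toDer_injective ?_
  change ⁅DK (mono (eps (pos k) + eps (neg k))), DK (mono α.1)⁆ = _ • DK (mono α.1)
  rw [lie_DK, contactBracket_pair, map_smul]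

theorem eIdx_ne_pair (hp : Odd p) (k i : Fin n) : (eIdx hp k).1 ≠ eps (pos i) + eps (neg i) := by
  intro h
  have h1 := congrArg (fun α : CIdx n → Fin p => (α (pos k) : ℕ)) h
  simp only [eIdx, triple_val hp, eps_add_eps_val (pos_ne_neg i i)] at h1
  split_ifs at h1 <;> simp_all

theorem eIdx_ne_zero (hp : Odd p) (k : Fin n) : (eIdx hp k).1 ≠ eps zero := by
  intro h
  have h1 := congrArg (fun α : CIdx n → Fin p => (α (pos k) : ℕ)) h
  simp only [eIdx, triple_val hp, eps_val] at h1
  simp at h1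

theorem cvec_ne_zero (hp : Odd p) (α : CBasis p n) : (cvec hp α : ContactAlg K p n) ≠ 0 :=
  (linearIndependent_cvec (K := K) hp).ne_zero α

variable (K) in
/-- The element `e`. -/
def eVec (hp : Odd p) (k : Fin n) : ContactAlg K p n := 
  (2 : K) • (cvec hp (eIdx hp k) : ContactAlg K p n)

theorem lie_eVec (hp : Odd p) (k : Fin n) :
    ⁅(cvec hp (hIdx p k) : ContactAlg K p n), eVec K hp k⁆ = eVec K hp k := by
  -- The weight of `e` is `2 - 1`.
  have h1 : ((((eIdx hp k).1 (pos k) : ℕ) : K) - (((eIdx hp k).1 (neg k) : ℕ) : K)) = 1 := by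
    simp only [eIdx, triple_val hp, if_true, if_neg (pos_ne_neg k k).symm]
    norm_num
  rw [eVec, lie_smul, lie_cvec, h1, one_smul]

theorem eVec_ne_zero (hp : Odd p) (k : Fin n) : eVec K hp k ≠ 0 :=
  smul_ne_zero (two_ne_zero_of_odd (K := K) hp) (cvec_ne_zero (K := K) hp _)

end Weights

/-! ### The twist datum in the contact algebra -/

section Quantization

variable {K : Type*} [Field K] {p : ℕ} [Fact p.Prime] [CharP K p] {n : ℕ}

/-- The twist datum given by `h` and `e`. -/
noncomputable def twistDatum (hp : Odd p) (k : Fin n) (q : K) :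
    TwistDatum (TruncPoly K p q) (UTQ K p n q) p where
  h := inc q (cvec hp (hIdx p k))
  e := inc q (eVec K hp k)
  t := tElt K p q
  odd := hp
  h_pow := (isRestricted_incLie q).pair _ k rfl
  e_pow := by
    have h := (isRestricted_incLie q).nil (cvec hp (eIdx hp k)) _ (eIdx_ne_pair hp k)
      (eIdx_ne_zero hp k) rfl
    rw [incLie_apply] at h
    rw [eVec, inc_smul, smul_pow, h, smul_zero]
  lie := by rw [← inc_lie, lie_eVec]

theorem twistDatum_weight (hp : Odd p) (k : Fin n) (q : K) [CharP (TruncPoly K p q) p]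
    (α : CBasis p n) :
    (twistDatum hp k q).h * inc q (cvec hp α) - inc q (cvec hp α) * (twistDatum hp k q).h =
      ModP.sc (TruncPoly K p q) p
        (((((α.1 (pos k) : ℕ) : ℤ) - ((α.1 (neg k) : ℕ) : ℤ) : ℤ)) : ZMod p) •
          inc q (cvec hp α : ContactAlg K p n) := by
  change inc q (cvec hp (hIdx p k)) * _ - _ * inc q (cvec hp (hIdx p k)) = _
  rw [← inc_lie, lie_cvec, inc_smul, ← algebraMap_smul (TruncPoly K p q)]
  congr 1
  simp

end Quantization

end Contact

/-! ### The quantization theorem -/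

theorem mainTheorem1 (p : ℕ) [Fact p.Prime] (hp : p ≠ 2) (K : Type*) [Field K] [CharP K p]
    (n : ℕ) (k : Fin n) (q : K) :
    ∃ (h e : Contact.ContactAlg K p n) (w : (Contact.UTQ K p n q)ˣ)
      (H : HopfStructure (Contact.TruncPoly K p q) (Contact.UTQ K p n q)),
      Contact.toDer h =
        Contact.DK (DivPow.mono (DivPow.eps (CIdx.pos k) + DivPow.eps (CIdx.neg k))) ∧
      Contact.toDer e = (2 : K) • Contact.DK (DivPow.mono
        (DivPow.eps (CIdx.pos k) + DivPow.eps (CIdx.pos k) + DivPow.eps (CIdx.neg k))) ∧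
      (w : Contact.UTQ K p n q) = 1 - Contact.tElt K p q • Contact.inc q e ∧
      (∀ α : CIdx n → Fin p, (p ∣ 2 * n + 4 → α ≠ DivPow.tau) →
        ∃ x : Contact.ContactAlg K p n,
          Contact.toDer x = Contact.DK (DivPow.mono α) ∧
          H.comul (Contact.inc q x) =
            Contact.inc q x ⊗ₜ[Contact.TruncPoly K p q]
              ((w ^ (((α (CIdx.pos k) : ℕ) : ℤ) - ((α (CIdx.neg k) : ℕ) : ℤ)) : (Contact.UTQ K p n q)ˣ) :
                Contact.UTQ K p n q) +
            ∑ l ∈ Finset.range p, ((-1) ^ l * Contact.tElt K p q ^ l) •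
              (risingFac (Contact.inc q h) l ⊗ₜ[Contact.TruncPoly K p q]
                (((w ^ (-(l : ℤ)) : (Contact.UTQ K p n q)ˣ) : Contact.UTQ K p n q) *
                  divAd K (Contact.inc q e) l (Contact.inc q x))) ∧
          H.antipode (Contact.inc q x) =
            -(((w ^ (((α (CIdx.neg k) : ℕ) : ℤ) - ((α (CIdx.pos k) : ℕ) : ℤ)) : (Contact.UTQ K p n q)ˣ) :
                Contact.UTQ K p n q) *
              ∑ l ∈ Finset.range p, Contact.tElt K p q ^ l •
                (divAd K (Contact.inc q e) l (Contact.inc q x) *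
                  risingFac (Contact.inc q h + 1) l)) ∧
          H.counit (Contact.inc q x) = 0) ∧
      (∃ a b : Contact.UTQ K p n q, a * b ≠ b * a) ∧
      (∃ a : Contact.UTQ K p n q,
        TensorProduct.comm (Contact.TruncPoly K p q) _ _ (H.comul a) ≠ H.comul a) ∧
      Module.Finite K (Contact.UTQ K p n q) ∧
      (¬ p ∣ 2 * n + 4 → Module.finrank K (Contact.UTQ K p n q) = p ^ (p ^ (2 * n + 1) + 1)) ∧
      (p ∣ 2 * n + 4 → Module.finrank K (Contact.UTQ K p n q) = p ^ p ^ (2 * n + 1)) := by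
  have hodd : Odd p := (Fact.out : p.Prime).odd_of_ne_two hp
  have := Contact.charP_truncPoly p q
  let T := Contact.twistDatum hodd k q
  have hprim := Contact.isPrim_inc (K := K) (n := n) q hodd
  have hwt := Contact.twistDatum_weight hodd k q
  refine ⟨Contact.cvec hodd (Contact.hIdx p k), Contact.eVec K hodd k, T.w,
    T.hopf (M := Contact.hopfMaps q hodd) (hprim _) (hprim _) (Contact.adjoin_inc_cvec q hodd) ?_ ?_,
    rfl, rfl, T.w_val, fun α hα => ⟨Contact.cvec hodd ⟨α, hα⟩, rfl, ?_, ?_, ?_⟩,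
    ⟨T.h, T.e, fun h => ?_⟩, ⟨T.h, ?_⟩, Contact.finite_UTQ q hodd, fun h => ?_, fun h => ?_⟩
  · rintro _ ⟨α, rfl⟩
    exact hprim _
  · rintro _ ⟨α, rfl⟩
    exact ⟨_, hwt α⟩
  · refine (T.comul_eq (K := K) (hwt ⟨α, hα⟩) (hprim _)).trans ?_
    simp only [T.zpow_eq_W, Int.cast_neg, Int.cast_natCast]
    rfl
  · refine (T.antipode_eq (K := K) (hwt ⟨α, hα⟩) (hprim _)).trans ?_
    rw [T.zpow_eq_W, ← Int.cast_neg, neg_sub]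
    rfl
  · exact (hprim _).counit
  -- If `h` and `e` commuted, then `e = [h, e]` would be zero.
  · obtain ⟨φ, hφ⟩ := Contact.exists_functional_inc q hodd (Contact.eVec_ne_zero (K := K) hodd k)
    have h0 : T.e = 0 := by rw [← T.lie, h, sub_self]
    have h1 : φ T.e = 1 := hφ
    rw [h0, map_zero] at h1
    have := Contact.nontrivial_truncPoly p q
    exact zero_ne_one h1
  · obtain ⟨φ, hφ⟩ := Contact.exists_functional_inc q hodd
      (Contact.cvec_ne_zero (K := K) hodd (Contact.hIdx p k))
    refine T.comm_comul_h_ne K (hprim _) φ hφ fun h => ?_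
    -- A functional with value `1` at `e` sends `te` to `t`, which is nonzero because the modulus
    -- has degree `p > 1`.
    obtain ⟨ψ, hψ⟩ := Contact.exists_functional_inc q hodd (Contact.eVec_ne_zero (K := K) hodd k)
    have h1 : ψ T.e = 1 := hψ
    have h2 := congrArg ψ h
    rw [map_smul, h1, map_zero, smul_eq_mul, mul_one] at h2
    exact Contact.tElt_ne_zero p q h2
  · rw [Contact.finrank_UTQ q hodd, Contact.card_CBasis_of_not_dvd h]
  · rw [Contact.finrank_UTQ q hodd, Contact.card_CBasis_of_dvd h]
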